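/- Let $d\in\{2,3\}$, $k>0$, $R>R_0>0$, and write $x=(\underline x,x_d)\in\mathbb R^{d-1}\times\mathbb R$. Let $n_p^2\in L^\infty(\mathbb R^d_+)$ be complex valued, $2\pi$-periodic in each component of $\underline x$, with $n_p^2=1$ for $x_d>R_0$. Put $\Omega^R=\mathbb R^{d-1}\times(0,R)$, $\Gamma^R=\mathbb R^{d-1}\times\{R\}$, $\Omega_0^R=(-\pi,\pi)^{d-1}\times(0,R)$, $\Gamma_0^R=(-\pi,\pi)^{d-1}\times\{R\}$, $I=(-\tfrac12,\tfrac12)^{d-1}$. The root $\sqrt{\cdot}$ is cut along the negative imaginary axis, so $\sqrt{s}=i\sqrt{|s|}$ for $s<0$. A function is $\alpha$-quasi-periodic if $u(\underline x+2\pi j,x_d)=e^{-2\pi i\alpha\cdot j}u(\underline x,x_d)$ for all $j\in\mathbb Z^{d-1}$. Let $\tilde H^1(\Omega^R)$, $\tilde H^1_\alpha(\Omega_0^R)$ be the spaces of $H^1$-functions, respectively $\alpha$-quasi-periodic $H^1$-functions, with vanishing trace on $\{x_d=0\}$. Let $\hat\phi(\xi)=(2\pi)^{-(d-1)/2}\int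 e^{-i\xi\cdot\underline x}\phi(\underline x)\,d\underline x$ be the unitary Fourier transform on $L^2(\mathbb R^{d-1})$, and for $\alpha$-quasi-periodic $\phi$ put $\hat\phi_j(\alpha)=(2\pi)^{-(d-1)/2}\int_{(-\pi,\pi)^{d-1}}\phi(\underline x)e^{i(\alpha+j)\cdot\underline x}\,d\underline x$, so that $\phi=(2\pi)^{-(d-1)/2}\sum_j\hat\phi_j(\alpha)e^{-i(\alpha+j)\cdot\underline x}$. With $\beta_j=\sqrt{k^2-|\alpha+j|^2}$ define $$\widehat{T\phi}(\xi)=i\sqrt{k^2-|\xi|^2}\,\hat\phi(\xi),\qquad T_\alpha\phi=\frac{i}{(2\pi)^{(d-1)/2}}\sum_{j\in\mathbb Z^{d-1}}\beta_j\,\hat\phi_j(\alpha)e^{-i(\alpha+j)\cdot\underline x},$$ as operators $H^{1/2}(\Gamma^R)\to H^{-1/2}(\Gamma^R)$ and $H^{1/2}_\alpha(\Gamma_0^R)\to H^{-1/2}_\alpha(\Gamma_0^R)$; boundary integrals below are duality pairings. The Bloch--Floquet transform is $$\mathcal Ju(\alpha,\underline x,x_d)=\sum_{j\in\mathbb Z^{d-1}}u(\underline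 x+2\pi j,x_d)\,e^{2\pi i\alpha\cdot j},$$ the series converging in $L^2(I\times\Omega_0^R)$ for every $u\in L^2(\Omega^R)$; $\mathcal Ju(\alpha,\cdot)$ is extended $\alpha$-quasi-periodically. **(1)** Let $f,u\in L^2(\Omega^R)$. Then $u\in\tilde H^1(\Omega^R)$ if and only if $\mathcal Ju\in L^2(I;\tilde H^1_\alpha(\Omega_0^R))$. Moreover, $u\in\tilde H^1(\Omega^R)$ and $$\int_{\Omega^R}\nabla u\cdot\nabla\overline v-k^2n_p^2u\overline v\,dx-\int_{\Gamma^R}T(u|_{\Gamma^R})\overline v\,dS=\int_{\Omega^R}f\overline v\,dx\quad\text{for all }v\in\tilde H^1(\Omega^R)$$ if and only if $w=\mathcal Ju\in L^2(I;\tilde H^1_\alpha(\Omega_0^R))$ and $$\int_I\Big[\int_{\Omega_0^R}\nabla_xw\cdot\nabla_x\overline v-k^2n_p^2w\overline v\,dx-\int_{\Gamma_0^R}T_\alpha(w|_{\Gamma_0^R})\overline v\,dS\Big]d\alpha=\int_I\int_{\Omega_0^R}(\mathcal Jf)(\alpha,\cdot)\,\overline v\,dx\,d\alpha$$ for all $v\in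 L^2(I;\tilde H^1_\alpha(\Omega_0^R))$. **(2)** Let $u$ be a function on $\mathbb R^d_+$ with $u\in\tilde H^1(\Omega^{R'})$ for every $R'>R_0$. Then $\mathcal Ju$ is defined on every strip $\Omega^{R'}$, $R'>R_0$ (by one function of $(\alpha,x)$), and, with $u_\alpha=\mathcal Ju(\alpha,\cdot)$, the angular spectrum representation $$u(x)=\frac1{(2\pi)^{(d-1)/2}}\int_{\mathbb R^{d-1}}e^{i\underline x\cdot\xi+i\sqrt{k^2-|\xi|^2}(x_d-R)}\,\widehat{u|_{\Gamma^R}}(\xi)\,d\xi\quad\text{for a.e. }x\text{ with }x_d>R$$ holds if and only if, for almost every $\alpha\in I$, the Rayleigh expansion $$u_\alpha(x)=\frac1{(2\pi)^{(d-1)/2}}\sum_{j\in\mathbb Z^{d-1}}\widehat{(u_\alpha|_{\Gamma_0^R})}_j(\alpha)\,e^{-i(\alpha+j)\cdot\underline x+i\beta_j(x_d-R)}\quad\text{for a.e. }x\text{ with }x_d>R$$ holds. -/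

import Mathlib

open MeasureTheory Filter Topology
open scoped ContDiff ComplexConjugate FourierTransform ENNReal

noncomputable section

namespace BlochScattering

/-! ### Geometry.  A point of `ℝ^d` is a pair `x = (y, t)`, `y ∈ ℝ^m` horizontal, `m = d - 1`,
and `t` the vertical coordinate. -/

/-- The horizontal space `ℝ^m`, `m = d - 1`. -/
abbrev Hor (m : ℕ) : Type := EuclideanSpace ℝ (Fin m)

/-- The full space `ℝ^d = ℝ^m × ℝ`. -/
abbrev Pt (m : ℕ) : Type := Hor m × ℝ

/-- Index set of the `d = m + 1` coordinate directions. -/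
abbrev Dir (m : ℕ) : Type := Fin m ⊕ Unit

/-- The coordinate unit vectors of `ℝ^d`. -/
def dirVec {m : ℕ} : Dir m → Pt m
  | Sum.inl i => (EuclideanSpace.single i 1, 0)
  | Sum.inr _ => (0, 1)

/-- The vertical direction `e_d`. -/
abbrev vert {m : ℕ} : Dir m := Sum.inr ()

/-- The upper half space `{x_d > 0}`. -/
def halfSpace (m : ℕ) : Set (Pt m) := {x | 0 < x.2}

/-- The strip `Ω^R = ℝ^m × (0, R)`. -/
def strip (m : ℕ) (R : ℝ) : Set (Pt m) := {x | 0 < x.2 ∧ x.2 < R}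

/-- The horizontal periodicity cell `(-π, π)^m`. -/
def cell (m : ℕ) : Set (Hor m) := {y | ∀ i, -Real.pi < y i ∧ y i < Real.pi}

/-- The bounded cell `Ω_0^R = (-π, π)^m × (0, R)`. -/
def cellStrip (m : ℕ) (R : ℝ) : Set (Pt m) := {x | x.1 ∈ cell m ∧ 0 < x.2 ∧ x.2 < R}

/-- The set `I = (-1/2, 1/2)^m` of quasi-periodicities. -/
def brillouin (m : ℕ) : Set (Hor m) := {a | ∀ i, -(1 / 2 : ℝ) < a i ∧ a i < 1 / 2}

/-- The integer vector `j ∈ ℤ^m` as an element of `ℝ^m`. -/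
def lat {m : ℕ} (j : Fin m → ℤ) : Hor m := WithLp.toLp 2 (fun i => (j i : ℝ))

/-- Horizontal translation `(y, t) ↦ (y + 2πj, t)`. -/
def shift {m : ℕ} (j : Fin m → ℤ) (x : Pt m) : Pt m := (x.1 + (2 * Real.pi) • lat j, x.2)

/-- The normalizing factor `(2π)^{-m/2}`. -/
def nrm (m : ℕ) : ℝ := (2 * Real.pi) ^ (-(m : ℝ) / 2)

/-- The square root with branch cut along the negative imaginary axis, on real arguments:
`√s ≥ 0` for `s ≥ 0` and `i √|s|` for `s < 0`. -/
def sqrtBranch (s : ℝ) : ℂ := if 0 ≤ s then (Real.sqrt s : ℂ) else Complex.I * Real.sqrt (-s)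

/-- Test functions: smooth and compactly supported in `ℝ^d`, with support in `U`. -/
structure IsTest {m : ℕ} (U : Set (Pt m)) (φ : Pt m → ℂ) : Prop where
  smooth : ContDiff ℝ ∞ φ
  compact : HasCompactSupport φ
  supp : tsupport φ ⊆ U

/-! ### Weak derivatives and traces -/

/-- `g` is the weak partial derivative of `u` in direction `i` in the strip `Ω^R`
(used only for locally integrable `u`, `g`). -/
def IsWeakPartial {m : ℕ} (R : ℝ) (i : Dir m) (u g : Pt m → ℂ) : Prop :=
  ∀ φ : Pt m → ℂ, IsTest (strip m R) φ →
    ∫ x in strip m R, u x * fderiv ℝ φ x (dirVec i) = -∫ x in strip m R, g x * φ x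

/-- `u`, with weak vertical derivative `g`, has trace `τ` on the upper boundary `Γ^R`
(Green's formula against test functions that vanish near `Γ^0`). -/
def HasUpperTrace {m : ℕ} (R : ℝ) (u g : Pt m → ℂ) (τ : Hor m → ℂ) : Prop :=
  ∀ φ : Pt m → ℂ, IsTest {x | 0 < x.2} φ →
    ∫ x in strip m R, (g x * φ x + u x * fderiv ℝ φ x (dirVec vert)) = ∫ y, τ y * φ (y, R)

/-- `u`, with weak vertical derivative `g`, has vanishing trace on the lower boundary `Γ^0`
(Green's formula against test functions that vanish near `Γ^R`). -/
def HasZeroLowerTrace {m : ℕ} (R : ℝ) (u g : Pt m → ℂ) : Prop :=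
  ∀ φ : Pt m → ℂ, IsTest {x | x.2 < R} φ →
    ∫ x in strip m R, (g x * φ x + u x * fderiv ℝ φ x (dirVec vert)) = 0

/-! ### The spaces on the strip -/

/-- `u ∈ H̃¹(Ω^R)`, with weak gradient `G`: `u` and `G` are in `L²(Ω^R)` and `u` has vanishing
trace on `Γ^0`. -/
structure IsH1 {m : ℕ} (R : ℝ) (u : Pt m → ℂ) (G : Dir m → Pt m → ℂ) : Prop where
  memLp : MemLp u 2 (volume.restrict (strip m R))
  grad_memLp : ∀ i, MemLp (G i) 2 (volume.restrict (strip m R))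
  weak : ∀ i, IsWeakPartial R i u (G i)
  lower : HasZeroLowerTrace R u (G vert)

/-- `u ∈ H̃¹(Ω^R)`. -/
def MemH1 {m : ℕ} (R : ℝ) (u : Pt m → ℂ) : Prop := ∃ G, IsH1 R u G

/-- The unitary Fourier transform `τ̂(ξ) = (2π)^{-m/2} ∫ e^{-i ξ·y} τ(y) dy` on `L²(ℝ^m)`,
obtained from Mathlib's `L²` transform (which has the kernel `e^{-2πi ξ·y}`) by scaling. -/
def fourierHat {m : ℕ} (τ : Hor m → ℂ) (ξ : Hor m) : ℂ :=
  open Classical in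
  if h : MemLp τ 2 (volume : Measure (Hor m)) then
    nrm m * ((𝓕 (h.toLp τ) : Lp ℂ 2 (volume : Measure (Hor m))) : Hor m → ℂ)
      ((2 * Real.pi)⁻¹ • ξ)
  else 0

/-- `τ ∈ H^{1/2}(Γ^R)`, with `Γ^R` identified with `ℝ^m`. -/
structure MemHalf {m : ℕ} (τ : Hor m → ℂ) : Prop where
  memLp : MemLp τ 2 (volume : Measure (Hor m))
  weighted : Integrable (fun ξ : Hor m => (1 + ‖ξ‖ ^ 2) ^ (1 / 2 : ℝ) * ‖fourierHat τ ξ‖ ^ 2)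

/-- `τ ∈ H^{1/2}(Γ^R)` is the trace on `Γ^R` of `u ∈ H̃¹(Ω^R)`, whose weak gradient is `G`. -/
structure IsTrace {m : ℕ} (R : ℝ) (u : Pt m → ℂ) (G : Dir m → Pt m → ℂ) (τ : Hor m → ℂ) :
    Prop where
  half : MemHalf τ
  green : HasUpperTrace R u (G vert) τ

/-- The Fourier transform of `T τ ∈ H^{-1/2}(Γ^R)`, where `T` is the exterior
Dirichlet-to-Neumann operator and `τ ∈ H^{1/2}(Γ^R)`. -/
def dtnHat {m : ℕ} (k : ℝ) (τ : Hor m → ℂ) (ξ : Hor m) : ℂ :=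
  Complex.I * sqrtBranch (k ^ 2 - ‖ξ‖ ^ 2) * fourierHat τ ξ

/-- The boundary form `∫_{Γ^R} T(τ) σ̄ dS`, that is, the duality pairing of
`T τ ∈ H^{-1/2}(Γ^R)` with `σ ∈ H^{1/2}(Γ^R)`, computed on the Fourier side. -/
def dtnForm {m : ℕ} (k : ℝ) (τ σ : Hor m → ℂ) : ℂ :=
  ∫ ξ, dtnHat k τ ξ * conj (fourierHat σ ξ)

/-- The volume integrand `∇u · ∇v̄ - k² n² u v̄` (`n2` is the squared refractive index,
`G`, `H` are the gradients). -/
def volIntegrand {m : ℕ} (k : ℝ) (n2 : Pt m → ℂ) (u : Pt m → ℂ) (G : Dir m → Pt m → ℂ)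
    (v : Pt m → ℂ) (H : Dir m → Pt m → ℂ) (x : Pt m) : ℂ :=
  (∑ i, G i x * conj (H i x)) - (k : ℂ) ^ 2 * n2 x * u x * conj (v x)

/-- `u ∈ H̃¹(Ω^R)` solves the variational problem on the strip with squared refractive index `n2`
and right-hand side `f`. -/
def IsStripSolution {m : ℕ} (k R : ℝ) (n2 f u : Pt m → ℂ) : Prop :=
  ∃ G τ, IsH1 R u G ∧ IsTrace R u G τ ∧
    ∀ v H σ, IsH1 R v H → IsTrace R v H σ →
      (∫ x in strip m R, volIntegrand k n2 u G v H x) - dtnForm k τ σ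
        = ∫ x in strip m R, f x * conj (v x)

/-! ### Quasi-periodic functions

Elements of the quasi-periodic spaces on the cell are represented by their `α`-quasi-periodic
extensions to the whole strip (respectively to `ℝ^m`). -/

/-- The factor `e^{-2πi α·j}`. -/
def qpFactor {m : ℕ} (α : Hor m) (j : Fin m → ℤ) : ℂ :=
  Complex.exp (-(2 * Real.pi * (inner ℝ α (lat j) : ℝ)) * Complex.I)

/-- `u` is `α`-quasi-periodic in the strip. -/
def IsQP {m : ℕ} (R : ℝ) (α : Hor m) (u : Pt m → ℂ) : Prop :=
  ∀ j : Fin m → ℤ, ∀ᵐ x ∂(volume.restrict (strip m R)), u (shift j x) = qpFactor α j * u x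

/-- `u ∈ H̃¹_α(Ω_0^R)`, with weak gradient `G`: the quasi-periodic function `u` has square
integrable weak derivatives across the cell walls, and vanishing trace on the bottom. -/
structure IsH1QP {m : ℕ} (R : ℝ) (α : Hor m) (u : Pt m → ℂ) (G : Dir m → Pt m → ℂ) : Prop where
  meas : AEStronglyMeasurable u (volume.restrict (strip m R))
  qp : IsQP R α u
  memLp : MemLp u 2 (volume.restrict (cellStrip m R))
  grad_meas : ∀ i, AEStronglyMeasurable (G i) (volume.restrict (strip m R))
  grad_qp : ∀ i, IsQP R α (G i)
  grad_memLp : ∀ i, MemLp (G i) 2 (volume.restrict (cellStrip m R))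
  weak : ∀ i, IsWeakPartial R i u (G i)
  lower : HasZeroLowerTrace R u (G vert)

/-- The function `ψ^j(y) = (2π)^{-m/2} e^{-i j·y}`. -/
def psi {m : ℕ} (j : Fin m → ℤ) (y : Hor m) : ℂ :=
  nrm m * Complex.exp (-((inner ℝ (lat j) y : ℝ) : ℂ) * Complex.I)

/-- The `j`-th Fourier coefficient `∫ τ(y) e^{i α·y} conj(ψ^j(y)) dy` of an `α`-quasi-periodic
function on `Γ_0^R`. -/
def coeff {m : ℕ} (α : Hor m) (τ : Hor m → ℂ) (j : Fin m → ℤ) : ℂ :=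
  ∫ y in cell m, τ y * Complex.exp (((inner ℝ α y : ℝ) : ℂ) * Complex.I) * conj (psi j y)

/-- `τ ∈ H^{1/2}_α(Γ_0^R)`. -/
structure MemHalfQP {m : ℕ} (α : Hor m) (τ : Hor m → ℂ) : Prop where
  meas : AEStronglyMeasurable τ (volume : Measure (Hor m))
  qp : ∀ j : Fin m → ℤ, ∀ᵐ y : Hor m, τ (y + (2 * Real.pi) • lat j) = qpFactor α j * τ y
  memLp : MemLp τ 2 (volume.restrict (cell m))
  weighted : Summable (fun j : Fin m → ℤ =>
    (1 + ‖α + lat j‖ ^ 2) ^ (1 / 2 : ℝ) * ‖coeff α τ j‖ ^ 2)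

/-- `τ ∈ H^{1/2}_α(Γ_0^R)` is the trace of `u ∈ H̃¹_α(Ω_0^R)` on the top `Γ_0^R`. -/
structure IsTraceQP {m : ℕ} (R : ℝ) (α : Hor m) (u : Pt m → ℂ) (G : Dir m → Pt m → ℂ)
    (τ : Hor m → ℂ) : Prop where
  half : MemHalfQP α τ
  green : HasUpperTrace R u (G vert) τ

/-- `β_j = √(k² - |α + j|²)`. -/
def beta {m : ℕ} (k : ℝ) (α : Hor m) (j : Fin m → ℤ) : ℂ :=
  sqrtBranch (k ^ 2 - ‖α + lat j‖ ^ 2)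

/-- The `j`-th Fourier coefficient of `T_α τ ∈ H^{-1/2}_α(Γ_0^R)`. -/
def dtnCoeff {m : ℕ} (k : ℝ) (α : Hor m) (τ : Hor m → ℂ) (j : Fin m → ℤ) : ℂ :=
  Complex.I * beta k α j * coeff α τ j

/-- The boundary form `∫_{Γ_0^R} T_α(τ) σ̄ dS`, that is, the duality pairing of
`T_α τ ∈ H^{-1/2}_α` with `σ ∈ H^{1/2}_α`, computed from Fourier coefficients (the functions
`e^{-iα·y} ψ^j` are orthonormal on `Γ_0^R`). -/
def dtnFormQP {m : ℕ} (k : ℝ) (α : Hor m) (τ σ : Hor m → ℂ) : ℂ :=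
  ∑' j, dtnCoeff k α τ j * conj (coeff α σ j)

/-! ### The Bloch-Floquet transform and the spaces of `α`-dependent functions -/

/-- `w = J u`: the transform of `u ∈ L²(Ω^R)`.  The defining series
`∑_j u(y + 2πj, t) e^{2πi α·j}` converges to `w` in `L²(I × Ω_0^R)`,
and `w(α, ·)` is `α`-quasi-periodic. -/
structure IsBlochTransform {m : ℕ} (R : ℝ) (u : Pt m → ℂ) (w : Hor m → Pt m → ℂ) : Prop where
  meas : AEStronglyMeasurable (Function.uncurry w)
    ((volume.restrict (brillouin m)).prod (volume.restrict (strip m R)))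
  qp : ∀ᵐ α ∂(volume.restrict (brillouin m)), IsQP R α (w α)
  series : Tendsto
    (fun s : Finset (Fin m → ℤ) => eLpNorm
      (fun p : Hor m × Pt m =>
        (∑ j ∈ s, u (shift j p.2) *
          Complex.exp ((2 * Real.pi * (inner ℝ p.1 (lat j) : ℝ)) * Complex.I)) - w p.1 p.2) 2
      ((volume.restrict (brillouin m)).prod (volume.restrict (cellStrip m R))))
    atTop (𝓝 0)

/-- `w ∈ L²(I; H̃¹_α(Ω_0^R))`, with gradient field `G(α) = ∇_x w(α, ·)`. -/
structure IsL2H1 {m : ℕ} (R : ℝ) (w : Hor m → Pt m → ℂ) (G : Hor m → Dir m → Pt m → ℂ) :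
    Prop where
  meas : AEStronglyMeasurable (Function.uncurry w)
    ((volume.restrict (brillouin m)).prod (volume.restrict (strip m R)))
  memLp : MemLp (Function.uncurry w) 2
    ((volume.restrict (brillouin m)).prod (volume.restrict (cellStrip m R)))
  grad_meas : ∀ i, AEStronglyMeasurable (fun p : Hor m × Pt m => G p.1 i p.2)
    ((volume.restrict (brillouin m)).prod (volume.restrict (strip m R)))
  grad_memLp : ∀ i, MemLp (fun p : Hor m × Pt m => G p.1 i p.2) 2
    ((volume.restrict (brillouin m)).prod (volume.restrict (cellStrip m R)))
  fiber : ∀ᵐ α ∂(volume.restrict (brillouin m)), IsH1QP R α (w α) (G α)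

/-- `w ∈ L²(I; H̃¹_α(Ω_0^R))`. -/
def MemL2H1 {m : ℕ} (R : ℝ) (w : Hor m → Pt m → ℂ) : Prop := ∃ G, IsL2H1 R w G

/-- `τ ∈ L²(I; H^{1/2}_α(Γ_0^R))` is the field of the traces on `Γ_0^R` of
`w ∈ L²(I; H̃¹_α(Ω_0^R))`. -/
structure IsTraceField {m : ℕ} (R : ℝ) (w : Hor m → Pt m → ℂ) (G : Hor m → Dir m → Pt m → ℂ)
    (τ : Hor m → Hor m → ℂ) : Prop where
  meas : AEStronglyMeasurable (Function.uncurry τ)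
    ((volume.restrict (brillouin m)).prod (volume : Measure (Hor m)))
  fiber : ∀ᵐ α ∂(volume.restrict (brillouin m)), IsTraceQP R α (w α) (G α) (τ α)
  half : ∫⁻ α in brillouin m, ∑' j : Fin m → ℤ,
    ENNReal.ofReal ((1 + ‖α + lat j‖ ^ 2) ^ (1 / 2 : ℝ) * ‖coeff α (τ α) j‖ ^ 2) < ⊤

/-- `w ∈ L²(I; H̃¹_α(Ω_0^R))` solves the `α`-integrated family of quasi-periodic variational
problems with right-hand side `F`. -/
def IsBlochSolution {m : ℕ} (k R : ℝ) (n2 : Pt m → ℂ) (F w : Hor m → Pt m → ℂ) : Prop :=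
  ∃ G τ, IsL2H1 R w G ∧ IsTraceField R w G τ ∧
    ∀ v H σ, IsL2H1 R v H → IsTraceField R v H σ →
      (∫ α in brillouin m,
        ((∫ x in cellStrip m R, volIntegrand k n2 (w α) (G α) (v α) (H α) x)
          - dtnFormQP k α (τ α) (σ α)))
        = ∫ α in brillouin m, ∫ x in cellStrip m R, F α x * conj (v α x)

/-! ### Refractive index and radiation conditions -/

/-- The squared refractive index of the unperturbed layer: (complex valued) in `L^∞` of the half
space, `2π`-periodic in the horizontal variables, and equal to `1` for `x_d > R₀`. -/
structure IsPeriodicIndex {m : ℕ} (R₀ : ℝ) (n2 : Pt m → ℂ) : Prop where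
  memLp : MemLp n2 ⊤ (volume.restrict (halfSpace m))
  periodic : ∀ j : Fin m → ℤ, ∀ᵐ x ∂(volume.restrict (halfSpace m)), n2 (shift j x) = n2 x
  eq_one : ∀ᵐ x : Pt m, R₀ < x.2 → n2 x = 1

/-- The angular spectrum representation of `u` above `Γ^R`. -/
def SatisfiesAngularSpectrum {m : ℕ} (k R : ℝ) (u : Pt m → ℂ) : Prop :=
  ∃ G τ, IsH1 R u G ∧ IsTrace R u G τ ∧
    ∀ᵐ x : Pt m, R < x.2 →
      u x = nrm m * ∫ ξ : Hor m,
        Complex.exp (Complex.I * (inner ℝ x.1 ξ : ℝ)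
          + Complex.I * sqrtBranch (k ^ 2 - ‖ξ‖ ^ 2) * ((x.2 - R : ℝ) : ℂ)) * fourierHat τ ξ

/-- The Rayleigh expansion of the `α`-quasi-periodic function `w` above `Γ_0^R`. -/
def SatisfiesRayleigh {m : ℕ} (k R : ℝ) (α : Hor m) (w : Pt m → ℂ) : Prop :=
  ∃ G τ, IsH1QP R α w G ∧ IsTraceQP R α w G τ ∧
    ∀ᵐ x : Pt m, R < x.2 →
      w x = nrm m * ∑' j : Fin m → ℤ, coeff α τ j *
        Complex.exp (-(Complex.I * (inner ℝ (α + lat j) x.1 : ℝ))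
          + Complex.I * beta k α j * ((x.2 - R : ℝ) : ℂ))

end BlochScattering

end

/-!
The Bloch-Floquet transform is, for almost every point `x`, the Fourier series in the
quasi-periodicity `α` with coefficients `u(x + 2πj)`. It is therefore an isometry of `L²` of the
strip onto the square integrable fields of quasi-periodic functions, with inverse
`u(x) = ∫_I w(α, x) dα`. The transform is treated for an abstract action of `ℤ^m` that tiles a
measure space (`IsTiling`), and is characterized by the inversion formula (`IsBT`); the same
results then apply to the strip, to the boundary, and (for the tiling of the Fourier side by the
points `-(α + j)`) to integrals over `ξ`.

*Weak derivatives and traces.* Weak derivatives and traces are given by Green's formulas, that is, by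
linear relations tested against a family of functions that is invariant under the translations by
`2πj`. The Fourier coefficients in `α` of a fibre relation are the global relation for the
translated test functions, so the global relation holds if and only if almost every fibre relation
holds for a given test function; separability of `L²` makes the null set independent of the test
function (`relation_iff_ae`, `green_iff_ae`). Hence `u ∈ H̃¹` with gradient `G` if and only if the
transform of `u` is in `L²(I; H̃¹_α)` with the transform of `G` as its gradient (`isH1_iff`).

*The boundary.* The Fourier coefficients of the fibres of the transform of a boundary function `t`
are the values `t̂(-(α + j))` of its Fourier transform (`IsBT.coeff_eq_fourierHat`): this is a
direct computation for Schwartz functions, and both sides depend continuously on `t ∈ L²`. It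
identifies the `H^{1/2}` norms (`isTrace_iff`) and the Dirichlet-to-Neumann forms (`dtnForm_eq`).
With Parseval's identity for the volume terms, the sesquilinear forms agree, and the equivalence of
the variational problems follows (`isStripSolution_iff`).

*Radiation conditions.* Above `Γ^R` the Fourier integral of the angular spectrum representation
converges absolutely, since the modes decay exponentially with the height, and its transform is the
series with coefficients `t̂(-(α + j))`. By uniqueness of the transform, the representation of `u`
is equivalent to the expansion of the fibres (`angular_iff`). It remains to obtain a trace of `u`
from the traces of the fibres, which are not assumed to depend measurably on `α`
(`exists_trace_of_rayleigh`). Their coefficients `a_j(α)` are recovered from `w` in the slab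
`R < x_d < R + 1`, where the coefficients of `w(α, ·)` are `a_j e^{iβ_j (x_d - R)}` and those of its
vertical derivative are `iβ_j` times as large. The `L²` norms of both over the slab control
`∑_j (1 + |α + j|²)^{1/2} |a_j|²` (`tsum_halfWeight_le`), so that the `a_j(α)` are the values of the
Fourier transform of some `t ∈ H^{1/2}`, and `t` is the trace of `u`.
-/

noncomputable section

namespace BlochScattering

/-! ### Fourier series on the Brillouin zone -/

/-- Lebesgue measure on the set `I` of quasi-periodicities. -/
abbrev volI (m : ℕ) : Measure (Hor m) := volume.restrict (brillouin m)

variable {m : ℕ}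

lemma inner_lat (α : Hor m) (j : Fin m → ℤ) : (inner ℝ α (lat j) : ℝ) = ∑ i, α i * j i := by
  simp [lat, PiLp.inner_apply, mul_comm]

lemma lat_add (i j : Fin m → ℤ) : lat (i + j) = lat i + lat j := by
  ext l; simp [lat]

lemma lat_neg (j : Fin m → ℤ) : lat (-j) = -lat j := by
  ext l; simp [lat]

@[simp] lemma lat_zero : lat (0 : Fin m → ℤ) = 0 := by
  ext l; simp [lat]

lemma qpFactor_add (α : Hor m) (i j : Fin m → ℤ) :
    qpFactor α (i + j) = qpFactor α i * qpFactor α j := by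
  simp only [qpFactor, ← Complex.exp_add, lat_add, inner_add_right]
  congr 1; push_cast; ring

@[simp] lemma qpFactor_zero (α : Hor m) : qpFactor α 0 = 1 := by
  simp [qpFactor]

lemma conj_qpFactor (α : Hor m) (j : Fin m → ℤ) : conj (qpFactor α j) = qpFactor α (-j) := by
  simp only [qpFactor, ← Complex.exp_conj, lat_neg, inner_neg_right]
  congr 1
  simp [map_ofNat (starRingEnd ℂ) 2]

@[simp] lemma norm_qpFactor (α : Hor m) (j : Fin m → ℤ) : ‖qpFactor α j‖ = 1 := by
  rw [qpFactor]
  have : -(2 * (Real.pi : ℂ) * ((inner ℝ α (lat j) : ℝ) : ℂ)) * Complex.I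
    = ((-(2 * Real.pi * inner ℝ α (lat j)) : ℝ) : ℂ) * Complex.I := by push_cast; ring
  rw [this, Complex.norm_exp_ofReal_mul_I]

lemma continuous_qpFactor (j : Fin m → ℤ) : Continuous fun α : Hor m => qpFactor α j := by
  unfold qpFactor; fun_prop

/-- Up to a null set, a cube in `ℝ^m` may be taken open or half-open. -/
lemma cube_ae_eq (a b : ℝ) (S : Set ℝ) (h1 : Set.Ioo a b ⊆ S) (h2 : S ⊆ Set.Icc a b) :
    {y : Hor m | ∀ i, a < y i ∧ y i < b} =ᵐ[volume] {y : Hor m | ∀ i, y i ∈ S} := by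
  have key : (Set.univ.pi fun _ : Fin m => Set.Ioo a b) =ᵐ[volume]
      (Set.univ.pi fun _ : Fin m => Set.Icc a b) := by
    rw [Set.pi_univ_Icc]
    exact Measure.univ_pi_Ioo_ae_eq_Icc
  have k2 : (Set.univ.pi fun _ : Fin m => Set.Ioo a b) =ᵐ[volume]
      (Set.univ.pi fun _ : Fin m => S) :=
    Filter.EventuallyLE.antisymm
      (LE.le.eventuallyLE (Set.pi_mono fun _ _ => h1))
      ((LE.le.eventuallyLE (Set.pi_mono fun _ _ => h2)).trans key.symm.le)
  have h := (PiLp.volume_preserving_ofLp (Fin m)).quasiMeasurePreserving.preimage_ae_eq k2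
  have e1 : {y : Hor m | ∀ i, a < y i ∧ y i < b}
      = WithLp.ofLp ⁻¹' Set.univ.pi fun _ : Fin m => Set.Ioo a b := by ext; simp
  have e2 : {y : Hor m | ∀ i, y i ∈ S}
      = WithLp.ofLp ⁻¹' Set.univ.pi fun _ : Fin m => S := by ext; simp
  rw [e1, e2]
  exact h

section Torus

local instance : MeasureSpace UnitAddCircle := ⟨AddCircle.haarAddCircle⟩

local instance : IsProbabilityMeasure (volume : Measure UnitAddCircle) :=
  inferInstanceAs (IsProbabilityMeasure AddCircle.haarAddCircle)

/-- The section of the covering `ℝ^m → (ℝ/ℤ)^m` with values in `(-1/2, 1/2]^m`. -/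
def torusSection (t : UnitAddTorus (Fin m)) : Hor m :=
  WithLp.toLp 2 (UnitAddTorus.measurableEquivPiIoc (fun _ => -(1 / 2 : ℝ)) t).1

lemma measurePreserving_torusSection :
    MeasurePreserving (torusSection (m := m)) volume (volI m) := by
  set S : Set (Fin m → ℝ) :=
    {x | ∀ i, x i ∈ Set.Ioc (-(1 / 2 : ℝ)) (-(1 / 2 : ℝ) + 1)} with hSdef
  have hS : MeasurableSet S := MeasurableSet.univ_pi' fun _ => measurableSet_Ioc
  have h1 := UnitAddTorus.measurePreserving_equivPiIoc (fun _ : Fin m => -(1 / 2 : ℝ))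
  have h2 : MeasurePreserving (Subtype.val : S → _) (Measure.comap Subtype.val volume)
      (volume.restrict S) := measurePreserving_subtype_coe hS
  have h3 : MeasurePreserving (WithLp.toLp 2) (volume.restrict S)
      (volume.restrict (WithLp.ofLp ⁻¹' S : Set (Hor m))) := by
    have := (PiLp.volume_preserving_toLp (Fin m)).restrict_preimage
      (s := (WithLp.ofLp ⁻¹' S : Set (Hor m))) (hS.preimage (by fun_prop))
    exact this
  have h4 : volume.restrict (WithLp.ofLp ⁻¹' S : Set (Hor m)) = volI m := by
    refine Measure.restrict_congr_set ?_
    refine (cube_ae_eq (-(1 / 2)) (1 / 2) (Set.Ioc (-(1 / 2)) (-(1 / 2) + 1)) ?_ ?_).symm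
    · intro x hx; exact ⟨hx.1, by linarith [hx.2]⟩
    · intro x hx; exact ⟨hx.1.le, by linarith [hx.2]⟩
  rw [h4] at h3
  exact h3.comp (h2.comp h1)

lemma measurableEmbedding_torusSection : MeasurableEmbedding (torusSection (m := m)) := by
  have hS : MeasurableSet {x : Fin m → ℝ | ∀ i, x i ∈ Set.Ioc (-(1 / 2 : ℝ)) (-(1 / 2 : ℝ) + 1)} :=
    MeasurableSet.univ_pi' fun _ => measurableSet_Ioc
  exact (MeasurableEquiv.toLp 2 (Fin m → ℝ)).measurableEmbedding.comp
    ((MeasurableEmbedding.subtype_coe hS).comp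
      (UnitAddTorus.measurableEquivPiIoc (fun _ => -(1 / 2 : ℝ))).measurableEmbedding)

/-- The characters of the torus are the quasi-periodicity factors; the two sign conventions are
opposite. -/
lemma mFourier_eq_qpFactor (j : Fin m → ℤ) (t : UnitAddTorus (Fin m)) :
    UnitAddTorus.mFourier j t = qpFactor (torusSection t) (-j) := by
  have ht : ∀ i, t i = ((torusSection t i : ℝ) : UnitAddCircle) := fun i => by
    simp only [torusSection, UnitAddTorus.coe_measurableEquivPiIoc_apply]
    exact AddCircle.coe_equivIoc.symm
  simp only [UnitAddTorus.mFourier, ContinuousMap.coe_mk, qpFactor]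
  calc _ = ∏ i, Complex.exp (2 * Real.pi * Complex.I * j i * (torusSection t i : ℝ) / (1 : ℝ)) := by
        refine Finset.prod_congr rfl fun i _ => ?_
        conv_lhs => rw [ht i]
        rw [fourier_coe_apply]
    _ = _ := by
        rw [← Complex.exp_sum, inner_lat]
        congr 1
        push_cast
        rw [Finset.mul_sum, ← Finset.sum_neg_distrib, Finset.sum_mul]
        refine Finset.sum_congr rfl fun i _ => ?_
        simp; ring

lemma integral_mFourier_torusSection (f : Hor m → ℂ) (j : Fin m → ℤ) :
    UnitAddTorus.mFourierCoeff (fun t => f (torusSection t)) j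
      = ∫ α, f α * qpFactor α j ∂(volI m) := by
  rw [← measurePreserving_torusSection.integral_comp measurableEmbedding_torusSection]
  unfold UnitAddTorus.mFourierCoeff
  refine integral_congr_ae (Eventually.of_forall fun t => ?_)
  simp [mFourier_eq_qpFactor, mul_comm]

/-- Parseval's identity for the Fourier series of `L²(I)`. -/
theorem hasSum_fourier_brillouin {f g : Hor m → ℂ} (hf : MemLp f 2 (volI m))
    (hg : MemLp g 2 (volI m)) :
    HasSum (fun j : Fin m → ℤ => (∫ α, f α * qpFactor α j ∂(volI m))
      * conj (∫ α, g α * qpFactor α j ∂(volI m))) (∫ α, f α * conj (g α) ∂(volI m)) := by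
  have hF := hf.comp_measurePreserving measurePreserving_torusSection
  have hG := hg.comp_measurePreserving measurePreserving_torusSection
  have h := UnitAddTorus.hasSum_prod_mFourierCoeff hG.toLp hF.toLp
  have e : ∀ (f : Hor m → ℂ) (hF : MemLp (f ∘ torusSection) 2 volume) (j : Fin m → ℤ),
      UnitAddTorus.mFourierCoeff hF.toLp j = ∫ α, f α * qpFactor α j ∂(volI m) := by
    intro f hF j
    rw [← integral_mFourier_torusSection]
    refine integral_congr_ae ?_
    filter_upwards [hF.coeFn_toLp] with t ht
    rw [ht]; rfl
  convert h using 1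
  · ext j; rw [e, e, mul_comm]
  · rw [← measurePreserving_torusSection.integral_comp measurableEmbedding_torusSection]
    refine integral_congr_ae ?_
    filter_upwards [hF.coeFn_toLp, hG.coeFn_toLp] with t h1 h2
    rw [h1, h2, mul_comm]; rfl

/-- An integrable function on a compact metric space that is orthogonal to a family with dense
linear span in the continuous functions vanishes almost everywhere. -/
lemma ae_eq_zero_of_span_dense {X ι : Type*} [PseudoEMetricSpace X] [CompactSpace X]
    [MeasurableSpace X] [BorelSpace X] {μ : Measure X} {F : X → ℂ} (hF : Integrable F μ)
    (e : ι → C(X, ℂ)) (he : (Submodule.span ℂ (Set.range e)).topologicalClosure = ⊤)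
    (h : ∀ i, ∫ x, e i x * F x ∂μ = 0) : F =ᵐ[μ] 0 := by
  have hint : ∀ g : C(X, ℂ), Integrable (fun x => g x * F x) μ := fun g =>
    hF.bdd_mul (c := ‖g‖) g.continuous.aestronglyMeasurable
      (Eventually.of_forall fun x => g.norm_coe_le_norm x)
  let L : C(X, ℂ) →L[ℂ] ℂ := LinearMap.mkContinuous
    { toFun := fun g => ∫ x, g x * F x ∂μ
      map_add' := fun g g' => by
        simp only [ContinuousMap.add_apply, add_mul]
        exact integral_add (hint g) (hint g')
      map_smul' := fun c g => by
        simp only [ContinuousMap.smul_apply, smul_eq_mul, mul_assoc, RingHom.id_apply]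
        exact integral_const_mul c _ } (∫ x, ‖F x‖ ∂μ) (fun g => by
      refine (norm_integral_le_integral_norm _).trans ?_
      rw [mul_comm, ← integral_const_mul]
      refine integral_mono (hint g).norm (hF.norm.const_mul _) fun x => ?_
      simp only [norm_mul]
      exact mul_le_mul_of_nonneg_right (g.norm_coe_le_norm x) (norm_nonneg _))
  have hL : ∀ g : C(X, ℂ), ∫ x, g x * F x ∂μ = 0 := by
    have : (⊤ : Submodule ℂ C(X, ℂ)) ≤ LinearMap.ker (L : C(X, ℂ) →ₗ[ℂ] ℂ) := by
      rw [← he]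
      refine Submodule.topologicalClosure_minimal _ ?_ L.isClosed_ker
      rw [Submodule.span_le]
      rintro _ ⟨i, rfl⟩
      exact h i
    intro g
    exact this (Submodule.mem_top (x := g))
  refine ae_eq_zero_of_forall_setIntegral_isClosed_eq_zero hF fun s hs => ?_
  -- The indicator of a closed set is a bounded pointwise limit of continuous functions.
  have hδ : ∀ n : ℕ, (0 : ℝ) < 1 / ((n : ℝ) + 1) := fun n => Nat.one_div_pos_of_nat
  have hlim := thickenedIndicator_tendsto_indicator_closure hδ
    tendsto_one_div_add_atTop_nhds_zero_nat s
  rw [hs.closure_eq, tendsto_pi_nhds] at hlim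
  have key : Tendsto (fun n : ℕ => ∫ x, ((thickenedIndicator (hδ n) s x : ℝ) : ℂ) * F x ∂μ) atTop
      (𝓝 (∫ x, s.indicator F x ∂μ)) := by
    refine tendsto_integral_of_dominated_convergence (fun x => ‖F x‖) (fun n => ?_) hF.norm
      (fun n => Eventually.of_forall fun x => ?_) (Eventually.of_forall fun x => ?_)
    · refine AEStronglyMeasurable.mul ?_ hF.1
      exact Continuous.aestronglyMeasurable (by fun_prop)
    · rw [norm_mul]
      refine mul_le_of_le_one_left (norm_nonneg _) ?_
      simp only [Complex.norm_real, Real.norm_eq_abs, NNReal.abs_eq]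
      exact_mod_cast thickenedIndicator_le_one (hδ n) s x
    · have h1 : Tendsto (fun n : ℕ => ((thickenedIndicator (hδ n) s x : ℝ) : ℂ)) atTop
          (𝓝 (((s.indicator (fun _ => (1 : NNReal)) x : NNReal) : ℝ) : ℂ)) :=
        (Complex.continuous_ofReal.tendsto _).comp
          ((NNReal.continuous_coe.tendsto _).comp (hlim x))
      have h2 := h1.mul_const (F x)
      convert h2 using 2
      by_cases hx : x ∈ s <;> simp [hx]
  rw [← integral_indicator hs.measurableSet]
  refine tendsto_nhds_unique key ?_
  have : ∀ n : ℕ, ∫ x, ((thickenedIndicator (hδ n) s x : ℝ) : ℂ) * F x ∂μ = 0 := fun n =>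
    hL ⟨fun x => ((thickenedIndicator (hδ n) s x : ℝ) : ℂ), by fun_prop⟩
  simp_rw [this]
  exact tendsto_const_nhds

/-- An integrable function on `I` is determined by its Fourier coefficients. -/
theorem ae_eq_zero_of_fourier_brillouin {f : Hor m → ℂ} (hf : Integrable f (volI m))
    (h : ∀ j : Fin m → ℤ, ∫ α, f α * qpFactor α j ∂(volI m) = 0) : f =ᵐ[volI m] 0 := by
  have hF : Integrable (fun t => f (torusSection t)) (volume : Measure (UnitAddTorus (Fin m))) :=
    (measurePreserving_torusSection.integrable_comp_emb measurableEmbedding_torusSection).2 hf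
  have h0 := ae_eq_zero_of_span_dense hF (fun j : Fin m → ℤ => UnitAddTorus.mFourier j)
    UnitAddTorus.span_mFourier_closure_eq_top fun j => by
      have := integral_mFourier_torusSection f (-j)
      rw [h (-j)] at this
      simpa [UnitAddTorus.mFourierCoeff] using this
  rw [Filter.EventuallyEq, ← measurePreserving_torusSection.map_eq,
    measurableEmbedding_torusSection.ae_map_iff]
  exact h0

lemma integral_qpFactor (j : Fin m → ℤ) :
    ∫ α, qpFactor α j ∂(volI m) = if j = 0 then 1 else 0 := by
  have h := (orthonormal_iff_ite.1 (UnitAddTorus.orthonormal_mFourier (d := Fin m))) j 0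
  rw [← h]
  have h2 := integral_mFourier_torusSection (fun _ => (1 : ℂ)) j
  simp only [one_mul] at h2
  rw [← h2, UnitAddTorus.mFourierCoeff, ContinuousMap.inner_toLp]
  simp [UnitAddTorus.mFourier_zero, UnitAddTorus.mFourier_neg]

instance : IsProbabilityMeasure (volI m) :=
  ⟨by rw [← measurePreserving_torusSection.measure_preimage nullMeasurableSet_univ]; simp⟩

end Torus

/-! ### Lattice tilings -/

/-- A measure preserving action `s` of `ℤ^m` on `(X, μ)` together with an equivariant measurable
index function `κ`. The sets `κ ⁻¹' {j}` are the translates of the cell `κ ⁻¹' {0}` and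
partition `X`. -/
structure IsTiling {X : Type*} [MeasurableSpace X] (μ : Measure X)
    (s : (Fin m → ℤ) → X → X) (κ : X → Fin m → ℤ) : Prop where
  mp : ∀ j, MeasurePreserving (s j) μ μ
  zero : ∀ x, s 0 x = x
  add : ∀ i j x, s i (s j x) = s (i + j) x
  meas : Measurable κ
  idx : ∀ j x, κ (s j x) = κ x + j

/-- The restriction of `μ` to the cell of a tiling. -/
abbrev cellMeasure {X : Type*} [MeasurableSpace X] (μ : Measure X) (κ : X → Fin m → ℤ) :
    Measure X := μ.restrict (κ ⁻¹' {0})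

lemma iUnion_tile {X : Type*} (κ : X → Fin m → ℤ) : ⋃ j, κ ⁻¹' {j} = Set.univ := by
  ext x; simp

lemma disjoint_tile {X : Type*} (κ : X → Fin m → ℤ) :
    Pairwise (Function.onFun Disjoint fun j => κ ⁻¹' {j}) := fun i j hij => by
  rw [Function.onFun, Set.disjoint_left]
  rintro x rfl h
  exact hij h

section Tiling

variable {X : Type*} [MeasurableSpace X] {μ : Measure X} {s : (Fin m → ℤ) → X → X}
  {κ : X → Fin m → ℤ}

namespace IsTiling

lemma emb (T : IsTiling μ s κ) (j : Fin m → ℤ) : MeasurableEmbedding (s j) :=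
  (⟨⟨s j, s (-j), fun x => by rw [T.add]; simp [T.zero], fun x => by rw [T.add]; simp [T.zero]⟩,
    (T.mp j).measurable, (T.mp (-j)).measurable⟩ : X ≃ᵐ X).measurableEmbedding

lemma measurableSet_tile (T : IsTiling μ s κ) (j : Fin m → ℤ) : MeasurableSet (κ ⁻¹' {j}) :=
  T.meas (measurableSet_singleton j)

lemma mp_tile (T : IsTiling μ s κ) (j : Fin m → ℤ) :
    MeasurePreserving (s j) (cellMeasure μ κ) (μ.restrict (κ ⁻¹' {j})) := by
  have h := (T.mp j).restrict_preimage (T.measurableSet_tile j)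
  have e : s j ⁻¹' (κ ⁻¹' {j}) = κ ⁻¹' {0} := by
    ext x; simp [T.idx]
  rwa [e] at h

/-- An integral over the whole space is the sum over the lattice of integrals over the cell. -/
lemma lintegral_eq_tsum (T : IsTiling μ s κ) (f : X → ℝ≥0∞) :
    ∫⁻ x, f x ∂μ = ∑' j, ∫⁻ x, f (s j x) ∂(cellMeasure μ κ) := by
  rw [← setLIntegral_univ, ← iUnion_tile κ,
    lintegral_iUnion T.measurableSet_tile (disjoint_tile κ)]
  exact tsum_congr fun j => ((T.mp_tile j).lintegral_comp_emb (T.emb j) f).symm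

lemma aemeasurable_comp (T : IsTiling μ s κ) {f : X → ℝ≥0∞} (hf : AEMeasurable f μ)
    (j : Fin m → ℤ) : AEMeasurable (fun x => f (s j x)) (cellMeasure μ κ) :=
  (hf.comp_quasiMeasurePreserving (T.mp j).quasiMeasurePreserving).restrict

lemma lintegral_eq_lintegral_tsum (T : IsTiling μ s κ) {f : X → ℝ≥0∞} (hf : AEMeasurable f μ) :
    ∫⁻ x, f x ∂μ = ∫⁻ x, ∑' j, f (s j x) ∂(cellMeasure μ κ) := by
  rw [T.lintegral_eq_tsum, lintegral_tsum]
  exact fun j => T.aemeasurable_comp hf j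

lemma hasSum_integral (T : IsTiling μ s κ) {f : X → ℂ} (hf : Integrable f μ) :
    HasSum (fun j => ∫ x, f (s j x) ∂(cellMeasure μ κ)) (∫ x, f x ∂μ) := by
  have h := hasSum_integral_iUnion T.measurableSet_tile (disjoint_tile κ)
    (f := f) (μ := μ) (by rw [iUnion_tile]; simpa using hf)
  rw [iUnion_tile, setIntegral_univ] at h
  have e : (fun j => ∫ x, f (s j x) ∂(cellMeasure μ κ)) = fun j => ∫ x in κ ⁻¹' {j}, f x ∂μ :=
    funext fun j => (T.mp_tile j).integral_comp (T.emb j) f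
  rw [e]
  exact h

lemma integral_eq_integral_tsum (T : IsTiling μ s κ) {f : X → ℂ} (hf : Integrable f μ) :
    ∫ x, f x ∂μ = ∫ x, ∑' j, f (s j x) ∂(cellMeasure μ κ) := by
  rw [integral_tsum, (T.hasSum_integral hf).tsum_eq]
  · exact fun j => (hf.1.comp_measurePreserving (T.mp j)).restrict
  · rw [← T.lintegral_eq_tsum fun x => ‖f x‖ₑ]
    exact hf.2.ne

/-- A property that holds at almost every point holds at all translates of almost every point. -/
lemma ae_shift (T : IsTiling μ s κ) {P : X → Prop} (h : ∀ᵐ x ∂μ, P x) :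
    ∀ᵐ x ∂μ, ∀ j, P (s j x) :=
  ae_all_iff.2 fun j => (T.mp j).quasiMeasurePreserving.ae h

lemma ae_of_cell (T : IsTiling μ s κ) {P : X → Prop}
    (h : ∀ j, ∀ᵐ x ∂(cellMeasure μ κ), P (s j x)) : ∀ᵐ x ∂μ, P x := by
  rw [← Measure.restrict_univ (μ := μ), ← iUnion_tile κ, ae_restrict_iUnion_iff]
  intro j
  rw [← (T.mp_tile j).map_eq, (T.emb j).ae_map_iff]
  exact h j

lemma summable_of_integrable (T : IsTiling μ s κ) {f : X → ℂ} (hf : Integrable f μ) :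
    ∀ᵐ x ∂(cellMeasure μ κ), Summable fun j => ‖f (s j x)‖ := by
  have h := T.lintegral_eq_lintegral_tsum hf.1.enorm
  have h2 : ∫⁻ x, ∑' j, ‖f (s j x)‖ₑ ∂(cellMeasure μ κ) ≠ ⊤ := by rw [← h]; exact hf.2.ne
  have h3 := ae_lt_top' (AEMeasurable.tsum fun j => T.aemeasurable_comp hf.1.enorm j) h2
  filter_upwards [h3] with x hx
  have := ENNReal.summable_toReal hx.ne
  simpa using this

lemma integrable_tsum (T : IsTiling μ s κ) {f : X → ℂ} (hf : Integrable f μ) :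
    Integrable (fun x => ∑' j, f (s j x)) (cellMeasure μ κ) := by
  have hm : ∀ j, AEMeasurable (fun x => f (s j x)) (cellMeasure μ κ) := fun j =>
    (hf.1.comp_measurePreserving (T.mp j)).restrict.aemeasurable
  refine ⟨(AEMeasurable.tsum hm).aestronglyMeasurable, ?_⟩
  refine lt_of_le_of_lt (lintegral_mono fun x => enorm_tsum_le_tsum_enorm) ?_
  rw [← T.lintegral_eq_lintegral_tsum hf.1.enorm]
  exact hf.2

/-- The translation of a tiling acts on the second factor of a product. -/
lemma prod (T : IsTiling μ s κ) [SFinite μ] {Y : Type*} [MeasurableSpace Y] (ν : Measure Y)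
    [SFinite ν] :
    IsTiling (ν.prod μ) (fun j (p : Y × X) => (p.1, s j p.2)) (fun p => κ p.2) where
  mp j := (MeasurePreserving.id ν).prod (T.mp j)
  zero p := by simp [T.zero]
  add i j p := by simp [T.add]
  meas := T.meas.comp measurable_snd
  idx j p := T.idx j p.2

end IsTiling

lemma prod_cellMeasure [SFinite μ] {Y : Type*} [MeasurableSpace Y]
    (ν : Measure Y) [SFinite ν] :
    cellMeasure (ν.prod μ) (fun p : Y × X => κ p.2) = ν.prod (cellMeasure μ κ) := by
  have h := Measure.prod_restrict (μ := ν) (ν := μ) Set.univ (κ ⁻¹' {0})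
  rw [Measure.restrict_univ] at h
  rw [h, cellMeasure]
  congr 1
  ext p
  simp

end Tiling

/-! ### Auxiliary measure theory -/

section Aux

variable {X Y : Type*} [MeasurableSpace X] [MeasurableSpace Y] {μ : Measure X} {ν : Measure Y}

lemma ae_prod_eq_of_ae_ae {f g : X × Y → ℂ} [SFinite μ] [SFinite ν]
    (hf : AEStronglyMeasurable f (μ.prod ν)) (hg : AEStronglyMeasurable g (μ.prod ν))
    (h : ∀ᵐ x ∂μ, ∀ᵐ y ∂ν, f (x, y) = g (x, y)) : f =ᵐ[μ.prod ν] g := by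
  have h1 := Measure.ae_ae_of_ae_prod hf.ae_eq_mk
  have h2 := Measure.ae_ae_of_ae_prod hg.ae_eq_mk
  have hms : MeasurableSet {p : X × Y | hf.mk f p = hg.mk g p} :=
    measurableSet_eq_fun hf.stronglyMeasurable_mk.measurable hg.stronglyMeasurable_mk.measurable
  have h3 : ∀ᵐ p ∂(μ.prod ν), hf.mk f p = hg.mk g p := by
    rw [Measure.ae_prod_iff_ae_ae hms]
    filter_upwards [h, h1, h2] with x hx hx1 hx2
    filter_upwards [hx, hx1, hx2] with y hy hy1 hy2
    rw [← hy1, ← hy2, hy]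
  filter_upwards [h3, hf.ae_eq_mk, hg.ae_eq_mk] with p a b c
  rw [b, c, a]

lemma ae_swap [SFinite μ] [SFinite ν] {P : X × Y → Prop} (h : ∀ᵐ p ∂(μ.prod ν), P p) :
    ∀ᵐ y ∂ν, ∀ᵐ x ∂μ, P (x, y) := by
  have := (Measure.measurePreserving_swap (μ := ν) (ν := μ)).quasiMeasurePreserving.ae h
  exact Measure.ae_ae_of_ae_prod this

lemma ae_prod_eq_of_ae_ae' {f g : X × Y → ℂ} [SFinite μ] [SFinite ν]
    (hf : AEStronglyMeasurable f (μ.prod ν)) (hg : AEStronglyMeasurable g (μ.prod ν))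
    (h : ∀ᵐ y ∂ν, ∀ᵐ x ∂μ, f (x, y) = g (x, y)) : f =ᵐ[μ.prod ν] g := by
  have mp := Measure.measurePreserving_swap (μ := μ) (ν := ν)
  have mp' := Measure.measurePreserving_swap (μ := ν) (ν := μ)
  have := ae_prod_eq_of_ae_ae (f := f ∘ Prod.swap) (g := g ∘ Prod.swap)
    (hf.comp_measurePreserving mp') (hg.comp_measurePreserving mp') h
  exact mp.quasiMeasurePreserving.ae this

lemma memLp_two_prod_right [SFinite μ] [SFinite ν] {f : X × Y → ℂ}
    (hf : MemLp f 2 (μ.prod ν)) : ∀ᵐ x ∂μ, MemLp (fun y => f (x, y)) 2 ν := by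
  have h := ((memLp_two_iff_integrable_sq_norm hf.1).1 hf).prod_right_ae
  filter_upwards [h, hf.1.prodMk_left] with x hx hm
  exact (memLp_two_iff_integrable_sq_norm hm).2 hx

lemma memLp_two_prod_left [SFinite μ] [SFinite ν] {f : X × Y → ℂ}
    (hf : MemLp f 2 (μ.prod ν)) : ∀ᵐ y ∂ν, MemLp (fun x => f (x, y)) 2 μ :=
  memLp_two_prod_right (f := f ∘ Prod.swap)
    (hf.comp_measurePreserving Measure.measurePreserving_swap)

lemma eLpNorm_two_sq (f : X → ℂ) : eLpNorm f 2 μ ^ 2 = ∫⁻ x, ‖f x‖ₑ ^ 2 ∂μ := by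
  rw [eLpNorm_eq_lintegral_rpow_enorm_toReal two_ne_zero ENNReal.ofNat_ne_top]
  rw [← ENNReal.rpow_natCast, ← ENNReal.rpow_mul]
  simp

lemma memLp_two_iff_lintegral {f : X → ℂ} (hf : AEStronglyMeasurable f μ) :
    MemLp f 2 μ ↔ ∫⁻ x, ‖f x‖ₑ ^ 2 ∂μ < ⊤ := by
  rw [← eLpNorm_two_sq, MemLp]
  simp [hf, lt_top_iff_ne_top]

/-- Cauchy-Schwarz on a probability space. -/
lemma enorm_integral_sq_le [IsProbabilityMeasure μ] {f : X → ℂ} (hf : AEStronglyMeasurable f μ) :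
    ‖∫ x, f x ∂μ‖ₑ ^ 2 ≤ ∫⁻ x, ‖f x‖ₑ ^ 2 ∂μ := by
  rw [← eLpNorm_two_sq]
  gcongr
  refine (enorm_integral_le_lintegral_enorm f).trans ?_
  rw [← eLpNorm_one_eq_lintegral_enorm]
  exact eLpNorm_le_eLpNorm_of_exponent_le (by norm_num) hf

end Aux

/-! ### The Bloch transform over a lattice tiling -/

lemma measurable_qpFactor :
    Measurable (Function.uncurry (qpFactor : Hor m → (Fin m → ℤ) → ℂ)) :=
  measurable_from_prod_countable_left fun j => (continuous_qpFactor j).measurable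

lemma tsum_enorm_sq_of_hasSum {Y ι : Type*} [MeasurableSpace Y] {ν : Measure Y} {f : Y → ℂ}
    {c : ι → ℂ} (hf : MemLp f 2 ν)
    (h : HasSum (fun j => c j * conj (c j)) (∫ y, f y * conj (f y) ∂ν)) :
    ∑' j, ‖c j‖ₑ ^ 2 = ∫⁻ y, ‖f y‖ₑ ^ 2 ∂ν := by
  have e1 : ∀ z : ℂ, z * conj z = ((‖z‖ ^ 2 : ℝ) : ℂ) := fun z => by
    rw [Complex.mul_conj, Complex.normSq_eq_norm_sq]
  have e2 : ∀ z : ℂ, ‖z‖ₑ ^ 2 = ENNReal.ofReal (‖z‖ ^ 2) := fun z => by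
    rw [ENNReal.ofReal_pow (norm_nonneg _), ofReal_norm]
  simp only [e1] at h
  rw [integral_complex_ofReal, Complex.hasSum_ofReal] at h
  simp only [e2]
  rw [← ofReal_integral_eq_lintegral_ofReal ((memLp_two_iff_integrable_sq_norm hf.1).1 hf)
    (Eventually.of_forall fun y => by positivity), ← h.tsum_eq,
    ENNReal.ofReal_tsum_of_nonneg (fun j => by positivity) h.summable]

lemma integrable_mul_qpFactor {f : Hor m → ℂ} (hf : Integrable f (volI m)) (j : Fin m → ℤ) :
    Integrable (fun α => f α * qpFactor α j) (volI m) :=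
  hf.mul_bdd (c := 1) (continuous_qpFactor j).aestronglyMeasurable
    (Eventually.of_forall fun α => by simp)

/-- A function of `(α, x)` that is integrable in `α` is determined by its Fourier coefficients
with respect to `α`. -/
lemma ae_prod_eq_of_fourier {X : Type*} [MeasurableSpace X] {μ : Measure X} [SFinite μ]
    {w z : Hor m → X → ℂ}
    (hw : AEStronglyMeasurable (Function.uncurry w) ((volI m).prod μ))
    (hz : AEStronglyMeasurable (Function.uncurry z) ((volI m).prod μ))
    (h : ∀ᵐ x ∂μ, Integrable (fun α => w α x) (volI m) ∧ Integrable (fun α => z α x) (volI m) ∧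
      ∀ j, ∫ α, w α x * qpFactor α j ∂(volI m) = ∫ α, z α x * qpFactor α j ∂(volI m)) :
    Function.uncurry w =ᵐ[(volI m).prod μ] Function.uncurry z := by
  refine ae_prod_eq_of_ae_ae' hw hz ?_
  filter_upwards [h] with x ⟨a, b, c⟩
  have := ae_eq_zero_of_fourier_brillouin (a.sub b) fun j => by
    simp only [Pi.sub_apply, sub_mul]
    rw [integral_sub (integrable_mul_qpFactor a j) (integrable_mul_qpFactor b j), c j, sub_self]
  filter_upwards [this] with α hα
  exact sub_eq_zero.1 hα

section Bloch

variable {X : Type*} [MeasurableSpace X]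

/-- An element of the target space of the Bloch transform: a measurable function of `(α, x)`,
`α`-quasi-periodic in `x`, and square integrable over `I` times the cell. -/
structure IsField (μ : Measure X) (s : (Fin m → ℤ) → X → X) (κ : X → Fin m → ℤ)
    (w : Hor m → X → ℂ) : Prop where
  meas : AEStronglyMeasurable (Function.uncurry w) ((volI m).prod μ)
  qp : ∀ j, ∀ᵐ p ∂((volI m).prod μ), w p.1 (s j p.2) = qpFactor p.1 j * w p.1 p.2
  memLp : MemLp (Function.uncurry w) 2 ((volI m).prod (cellMeasure μ κ))

/-- `w` is the Bloch transform of `u`, characterized through the inverse transform: `u` is the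
mean of `w` over the quasi-periodicities. -/
structure IsBT (μ : Measure X) (s : (Fin m → ℤ) → X → X) (κ : X → Fin m → ℤ) (u : X → ℂ)
    (w : Hor m → X → ℂ) : Prop where
  field : IsField μ s κ w
  inv : ∀ᵐ x ∂μ, u x = ∫ α, w α x ∂(volI m)

variable {μ : Measure X} {s : (Fin m → ℤ) → X → X} {κ : X → Fin m → ℤ}

/-- Every field is the Bloch transform of its mean over the quasi-periodicities. -/
lemma IsField.isBT {w : Hor m → X → ℂ} (hw : IsField μ s κ w) :
    IsBT μ s κ (fun x => ∫ α, w α x ∂(volI m)) w :=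
  ⟨hw, Eventually.of_forall fun _ => rfl⟩

/-- The quasi-periodic extension of a function given on the cell. -/
def qpExtend (s : (Fin m → ℤ) → X → X) (κ : X → Fin m → ℤ) (W : Hor m × X → ℂ) (α : Hor m)
    (x : X) : ℂ := qpFactor α (κ x) * W (α, s (-κ x) x)

lemma isField_qpExtend (T : IsTiling μ s κ) {W : Hor m × X → ℂ} (hW : StronglyMeasurable W)
    (hW2 : MemLp W 2 ((volI m).prod (cellMeasure μ κ))) : IsField μ s κ (qpExtend s κ W) where
  meas := by
    have h1 : Measurable fun x : X => s (-κ x) x := by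
      have : Measurable fun p : (Fin m → ℤ) × X => s (-p.1) p.2 :=
        measurable_from_prod_countable_right fun j => (T.mp (-j)).measurable
      exact this.comp (T.meas.prodMk measurable_id)
    have hκ : Measurable fun p : Hor m × X => (p.1, κ p.2) :=
      measurable_fst.prodMk (T.meas.comp measurable_snd)
    have h2 := measurable_qpFactor.comp hκ
    have h3 : Measurable fun p : Hor m × X => W (p.1, s (-κ p.2) p.2) :=
      hW.measurable.comp (measurable_fst.prodMk (h1.comp measurable_snd))
    exact (h2.mul h3).aestronglyMeasurable
  qp j := Eventually.of_forall fun p => by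
    simp only [qpExtend, T.idx, T.add, qpFactor_add]
    rw [show -(κ p.2 + j) + j = -κ p.2 by abel]
    ring
  memLp := by
    refine hW2.ae_eq ?_
    have h1 : ∀ᵐ x ∂(cellMeasure μ κ), κ x = 0 := by
      filter_upwards [ae_restrict_mem (T.measurableSet_tile 0)] with x hx using hx
    have h2 : ∀ᵐ p ∂((volI m).prod (cellMeasure μ κ)), κ p.2 = 0 :=
      Measure.quasiMeasurePreserving_snd.ae h1
    filter_upwards [h2] with p hp
    simp [Function.uncurry, qpExtend, hp, T.zero]

variable [SFinite μ]

/-- Over almost every point, a field is square integrable in `α` and its values along the lattice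
orbit are given by the quasi-periodicity factors. -/
lemma IsField.ae_slice (T : IsTiling μ s κ) {w : Hor m → X → ℂ} (hw : IsField μ s κ w) :
    ∀ᵐ x ∂μ, MemLp (fun α => w α x) 2 (volI m) ∧
      ∀ j, ∀ᵐ α ∂(volI m), w α (s j x) = qpFactor α j * w α x := by
  have h1 : ∀ᵐ x ∂μ, ∀ j, ∀ᵐ α ∂(volI m), w α (s j x) = qpFactor α j * w α x :=
    ae_all_iff.2 fun j => ae_swap (hw.qp j)
  have h2 : ∀ᵐ x ∂μ, MemLp (fun α => w α x) 2 (volI m) := by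
    refine T.ae_of_cell fun j => ?_
    filter_upwards [memLp_two_prod_left hw.memLp, ae_restrict_of_ae h1] with x hx hx1
    refine MemLp.ae_eq (f := fun α => qpFactor α j * w α x) ?_ ?_
    · filter_upwards [hx1 j] with α hα
      exact hα.symm
    · refine MemLp.of_le (f := fun α => qpFactor α j * w α x) hx ?_ ?_
      · exact (continuous_qpFactor j).aestronglyMeasurable.mul hx.1
      · exact Eventually.of_forall fun α => by simp
  filter_upwards [h1, h2] with x a b using ⟨b, a⟩

/-- The values of `u` along a lattice orbit are the Fourier coefficients of its transform. -/
lemma IsBT.coef (T : IsTiling μ s κ) {u : X → ℂ} {w : Hor m → X → ℂ} (h : IsBT μ s κ u w) :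
    ∀ᵐ x ∂μ, ∀ j, u (s j x) = ∫ α, w α x * qpFactor α j ∂(volI m) := by
  filter_upwards [h.field.ae_slice T, T.ae_shift h.inv] with x hx hi j
  rw [hi j]
  refine integral_congr_ae ?_
  filter_upwards [hx.2 j] with α hα
  rw [hα, mul_comm]

/-- Parseval's identity in `α` along the lattice orbit of almost every point. -/
lemma IsBT.hasSum (T : IsTiling μ s κ) {u v : X → ℂ} {w z : Hor m → X → ℂ}
    (h : IsBT μ s κ u w) (h' : IsBT μ s κ v z) :
    ∀ᵐ x ∂μ, HasSum (fun j => u (s j x) * conj (v (s j x)))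
      (∫ α, w α x * conj (z α x) ∂(volI m)) := by
  filter_upwards [h.field.ae_slice T, h'.field.ae_slice T, h.coef T, h'.coef T] with x a b c d
  simp only [c, d]
  exact hasSum_fourier_brillouin a.1 b.1

lemma IsBT.aestronglyMeasurable {u : X → ℂ} {w : Hor m → X → ℂ} (h : IsBT μ s κ u w) :
    AEStronglyMeasurable u μ := by
  have h1 : AEStronglyMeasurable (fun x => ∫ α, w α x ∂(volI m)) μ :=
    (h.field.meas.prod_swap).integral_prod_right'
  exact h1.congr (h.inv.mono fun x hx => hx.symm)

/-- The Bloch transform is isometric. -/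
lemma IsBT.lintegral_sq (T : IsTiling μ s κ) {u : X → ℂ} {w : Hor m → X → ℂ}
    (h : IsBT μ s κ u w) :
    ∫⁻ x, ‖u x‖ₑ ^ 2 ∂μ
      = ∫⁻ p, ‖w p.1 p.2‖ₑ ^ 2 ∂((volI m).prod (cellMeasure μ κ)) := by
  rw [T.lintegral_eq_lintegral_tsum (h.aestronglyMeasurable.enorm.pow_const 2),
    lintegral_prod_symm (fun p : Hor m × X => ‖w p.1 p.2‖ₑ ^ 2)
      (h.field.memLp.1.enorm.pow_const 2)]
  refine lintegral_congr_ae ?_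
  filter_upwards [ae_restrict_of_ae (h.hasSum T h), ae_restrict_of_ae (h.field.ae_slice T)]
    with x hx hs
  exact tsum_enorm_sq_of_hasSum hs.1 hx

lemma IsBT.memLp (T : IsTiling μ s κ) {u : X → ℂ} {w : Hor m → X → ℂ} (h : IsBT μ s κ u w) :
    MemLp u 2 μ := by
  rw [memLp_two_iff_lintegral h.aestronglyMeasurable, h.lintegral_sq T]
  exact (memLp_two_iff_lintegral h.field.memLp.1).1 h.field.memLp

/-- Parseval's identity for the Bloch transform. -/
lemma IsBT.integral_mul_conj (T : IsTiling μ s κ) {u v : X → ℂ} {w z : Hor m → X → ℂ}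
    (h : IsBT μ s κ u w) (h' : IsBT μ s κ v z) :
    Integrable (fun p : Hor m × X => w p.1 p.2 * conj (z p.1 p.2))
        ((volI m).prod (cellMeasure μ κ)) ∧
      ∫ x, u x * conj (v x) ∂μ
        = ∫ α, ∫ x, w α x * conj (z α x) ∂(cellMeasure μ κ) ∂(volI m) := by
  have hi : Integrable (fun p : Hor m × X => w p.1 p.2 * conj (z p.1 p.2))
      ((volI m).prod (cellMeasure μ κ)) :=
    h.field.memLp.integrable_mul (p := 2) (q := 2) h'.field.memLp.star
  refine ⟨hi, ?_⟩
  have hu : Integrable (fun x => u x * conj (v x)) μ :=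
    (h.memLp T).integrable_mul (p := 2) (q := 2) (h'.memLp T).star
  rw [T.integral_eq_integral_tsum hu, integral_integral_swap hi]
  refine integral_congr_ae ?_
  filter_upwards [ae_restrict_of_ae (h.hasSum T h')] with x hx
  exact hx.tsum_eq

/-- The Bloch transform is unique. -/
lemma IsBT.unique (T : IsTiling μ s κ) {u : X → ℂ} {w z : Hor m → X → ℂ}
    (h : IsBT μ s κ u w) (h' : IsBT μ s κ u z) :
    Function.uncurry w =ᵐ[(volI m).prod μ] Function.uncurry z := by
  refine ae_prod_eq_of_fourier h.field.meas h'.field.meas ?_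
  filter_upwards [h.field.ae_slice T, h'.field.ae_slice T, h.coef T, h'.coef T] with x a b c d
  exact ⟨a.1.integrable one_le_two, b.1.integrable one_le_two, fun j => (c j).symm.trans (d j)⟩

lemma IsBT.congr {u v : X → ℂ} {w z : Hor m → X → ℂ} (T : IsTiling μ s κ) (h : IsBT μ s κ u w)
    (huv : u =ᵐ[μ] v)
    (hwz : Function.uncurry w =ᵐ[(volI m).prod μ] Function.uncurry z) : IsBT μ s κ v z where
  field :=
    { meas := h.field.meas.congr hwz
      qp := fun j => by
        filter_upwards [hwz, ((T.prod (volI m)).mp j).quasiMeasurePreserving.ae hwz,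
          h.field.qp j] with p a b c
        simp only [Function.uncurry] at a b
        rw [← a, ← b, c]
      memLp := by
        refine h.field.memLp.ae_eq ?_
        rw [← prod_cellMeasure]
        exact ae_restrict_of_ae hwz }
  inv := by
    filter_upwards [h.inv, huv, ae_swap hwz] with x a b c
    rw [← b, a]
    exact integral_congr_ae c

lemma IsBT.sub {u v : X → ℂ} {w z : Hor m → X → ℂ} (T : IsTiling μ s κ)
    (h : IsBT μ s κ u w) (h' : IsBT μ s κ v z) :
    IsBT μ s κ (fun x => u x - v x) (fun α x => w α x - z α x) where
  field :=
    { meas := h.field.meas.sub h'.field.meas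
      qp := fun j => by
        filter_upwards [h.field.qp j, h'.field.qp j] with p a b
        rw [a, b, mul_sub]
      memLp := h.field.memLp.sub h'.field.memLp }
  inv := by
    filter_upwards [h.inv, h'.inv, h.field.ae_slice T, h'.field.ae_slice T] with x a b c d
    rw [a, b, integral_sub (c.1.integrable one_le_two) (d.1.integrable one_le_two)]

/-- The transform commutes with multiplication by a bounded periodic function. -/
lemma IsBT.mul_periodic {u n : X → ℂ} {w : Hor m → X → ℂ}
    (h : IsBT μ s κ u w) (hn : MemLp n ⊤ μ) (hp : ∀ j, ∀ᵐ x ∂μ, n (s j x) = n x) :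
    IsBT μ s κ (fun x => n x * u x) (fun α x => n x * w α x) where
  field :=
    { meas := (hn.1.comp_snd).mul h.field.meas
      qp := fun j => by
        have h1 : ∀ᵐ p ∂((volI m).prod μ), n (s j p.2) = n p.2 :=
          Measure.quasiMeasurePreserving_snd.ae (hp j)
        filter_upwards [h1, h.field.qp j] with p a b
        rw [a, b]; ring
      memLp := by
        have h1 : MemLp (fun p : Hor m × X => n p.2) ⊤ ((volI m).prod (cellMeasure μ κ)) :=
          (hn.restrict _).comp_snd _
        exact h.field.memLp.mul (p := ⊤) (q := 2) (r := 2) h1 }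
  inv := by
    filter_upwards [h.inv] with x a
    rw [a, integral_const_mul]

/-- A field is square integrable over every finite union of translates of the cell. -/
lemma IsField.memLp_tiles (T : IsTiling μ s κ) {w : Hor m → X → ℂ} (hw : IsField μ s κ w)
    (B : Finset (Fin m → ℤ)) :
    MemLp (Function.uncurry w) 2 ((volI m).prod (μ.restrict (κ ⁻¹' B))) := by
  have e : (volI m).prod (μ.restrict (κ ⁻¹' B))
      = ((volI m).prod μ).restrict (⋃ j ∈ B, (fun p : Hor m × X => κ p.2) ⁻¹' {j}) := by
    have h := Measure.prod_restrict (μ := volI m) (ν := μ) Set.univ (κ ⁻¹' B)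
    rw [Measure.restrict_univ] at h
    rw [h]
    congr 1
    ext p
    simp
  have hm := hw.meas.restrict (s := ⋃ j ∈ B, (fun p : Hor m × X => κ p.2) ⁻¹' {j})
  rw [e, memLp_two_iff_integrable_sq_norm hm]
  refine (integrableOn_finset_iUnion (s := B)
    (t := fun j => (fun p : Hor m × X => κ p.2) ⁻¹' {j})).2 fun j _ => ?_
  have TP := T.prod (volI m)
  have hmp := TP.mp_tile j
  rw [IntegrableOn, ← hmp.integrable_comp_emb (TP.emb j), prod_cellMeasure]
  have h1 := (memLp_two_iff_integrable_sq_norm hw.memLp.1).1 hw.memLp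
  refine h1.congr ?_
  have h2 := hw.qp j
  have h3 : ∀ᵐ p ∂((volI m).prod (cellMeasure μ κ)),
      w p.1 (s j p.2) = qpFactor p.1 j * w p.1 p.2 := by
    rw [← prod_cellMeasure]; exact ae_restrict_of_ae h2
  filter_upwards [h3] with p hp
  simp [Function.uncurry, hp]

/-- Pairing the transform with an `L²` function that is supported in finitely many cells. -/
lemma IsBT.pairing (T : IsTiling μ s κ) {u : X → ℂ} {w : Hor m → X → ℂ} (h : IsBT μ s κ u w)
    {ψ : X → ℂ} (hψ : MemLp ψ 2 μ) {B : Finset (Fin m → ℤ)} (hB : ∀ x, κ x ∉ B → ψ x = 0) :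
    Integrable (fun p : Hor m × X => w p.1 p.2 * ψ p.2) ((volI m).prod μ) ∧
      ∀ j, ∫ α, (∫ x, w α x * ψ x ∂μ) * qpFactor α j ∂(volI m) = ∫ x, u (s j x) * ψ x ∂μ := by
  have h1 : Integrable (fun p : Hor m × X => w p.1 p.2 * ψ p.2)
      ((volI m).prod (μ.restrict (κ ⁻¹' B))) :=
    (h.field.memLp_tiles T B).integrable_mul (p := 2) (q := 2) ((hψ.restrict _).comp_snd _)
  have hBm : MeasurableSet (κ ⁻¹' (B : Set (Fin m → ℤ))) := T.meas (B.measurableSet)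
  have h2 : Integrable (fun p : Hor m × X => w p.1 p.2 * ψ p.2) ((volI m).prod μ) := by
    have e : (volI m).prod (μ.restrict (κ ⁻¹' B))
        = ((volI m).prod μ).restrict (Set.univ ×ˢ (κ ⁻¹' B)) := by
      rw [← Measure.prod_restrict, Measure.restrict_univ]
    rw [e] at h1
    refine IntegrableOn.integrable_of_forall_notMem_eq_zero h1 fun p hp => ?_
    rw [hB p.2 (by simpa using hp), mul_zero]
  refine ⟨h2, fun j => ?_⟩
  have h3 : Integrable (fun p : Hor m × X => w p.1 p.2 * ψ p.2 * qpFactor p.1 j)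
      ((volI m).prod μ) :=
    h2.mul_bdd (c := 1) ((continuous_qpFactor j).measurable.comp measurable_fst).aestronglyMeasurable
      (Eventually.of_forall fun p => by simp)
  simp_rw [← integral_mul_const]
  rw [integral_integral_swap h3]
  refine integral_congr_ae ?_
  filter_upwards [h.coef T] with x hx
  rw [hx j, ← integral_mul_const]
  refine integral_congr_ae (Eventually.of_forall fun α => ?_)
  simp only; ring

/-! ### Existence of the Bloch transform -/

/-- The `j`-th term `u(s_j x) e^{2πi α·j}` of the series defining the Bloch transform. -/
def blochTerm (s : (Fin m → ℤ) → X → X) (u : X → ℂ) (j : Fin m → ℤ) (p : Hor m × X) : ℂ :=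
  u (s j p.2) * qpFactor p.1 (-j)

lemma memLp_blochTerm (T : IsTiling μ s κ) {u : X → ℂ} (hu : MemLp u 2 μ) (j : Fin m → ℤ) :
    MemLp (blochTerm s u j) 2 ((volI m).prod (cellMeasure μ κ)) := by
  have h1 : MemLp (fun p : Hor m × X => u (s j p.2)) 2 ((volI m).prod (cellMeasure μ κ)) :=
    ((hu.comp_measurePreserving (T.mp j)).restrict _).comp_snd _
  refine h1.of_le (h1.1.mul ?_) (Eventually.of_forall fun p => by simp [blochTerm])
  exact ((continuous_qpFactor (-j)).measurable.comp measurable_fst).aestronglyMeasurable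

/-- If the Bloch series of `u` converges to the field `w`, then `w` is the transform of `u`. -/
lemma IsField.isBT_of_tendsto (T : IsTiling μ s κ) {u : X → ℂ} {w : Hor m → X → ℂ}
    (hu : MemLp u 2 μ) (hw : IsField μ s κ w)
    (h : Tendsto (fun S : Finset (Fin m → ℤ) => eLpNorm
      (fun p : Hor m × X => (∑ j ∈ S, blochTerm s u j p) - w p.1 p.2) 2
      ((volI m).prod (cellMeasure μ κ))) atTop (𝓝 0)) : IsBT μ s κ u w := by
  refine ⟨hw, T.ae_of_cell fun i => ?_⟩
  have hq : ∀ f : Hor m → ℂ, MemLp f 2 (volI m) →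
      Integrable (fun α => f α * qpFactor α i) (volI m) := fun f hf =>
    integrable_mul_qpFactor (hf.integrable one_le_two) i
  have hdm : AEStronglyMeasurable
      (fun x => u (s i x) - ∫ α, w α x * qpFactor α i ∂(volI m)) (cellMeasure μ κ) := by
    refine (hu.comp_measurePreserving (T.mp i)).1.restrict.sub ?_
    have h1 : AEStronglyMeasurable (fun p : Hor m × X => w p.1 p.2 * qpFactor p.1 i)
        ((volI m).prod (cellMeasure μ κ)) := hw.memLp.1.mul
      ((continuous_qpFactor i).measurable.comp measurable_fst).aestronglyMeasurable
    exact h1.prod_swap.integral_prod_right'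
  -- Once `i ∈ S`, the `i`-th Fourier coefficient of the partial sum is `u(s_i x)`.
  have hD : ∀ S : Finset (Fin m → ℤ), i ∈ S →
      ∫⁻ x, ‖u (s i x) - ∫ α, w α x * qpFactor α i ∂(volI m)‖ₑ ^ 2 ∂(cellMeasure μ κ)
        ≤ eLpNorm (fun p : Hor m × X => (∑ j ∈ S, blochTerm s u j p) - w p.1 p.2) 2
          ((volI m).prod (cellMeasure μ κ)) ^ 2 := by
    intro S hS
    have hm : MemLp (fun p : Hor m × X => (∑ j ∈ S, blochTerm s u j p) - w p.1 p.2) 2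
        ((volI m).prod (cellMeasure μ κ)) :=
      (memLp_finsetSum S fun j _ => memLp_blochTerm T hu j).sub hw.memLp
    rw [eLpNorm_two_sq, lintegral_prod_symm _ (hm.1.enorm.pow_const 2)]
    refine lintegral_mono_ae ?_
    filter_upwards [memLp_two_prod_left hm, memLp_two_prod_left hw.memLp] with x hx hwx
    have e : u (s i x) - ∫ α, w α x * qpFactor α i ∂(volI m)
        = ∫ α, ((∑ j ∈ S, blochTerm s u j (α, x)) - w α x) * qpFactor α i ∂(volI m) := by
      simp_rw [sub_mul]
      have hsum : ∀ α, (∑ j ∈ S, blochTerm s u j (α, x)) * qpFactor α i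
          = ∑ j ∈ S, u (s j x) * qpFactor α (i - j) := fun α => by
        rw [Finset.sum_mul]
        refine Finset.sum_congr rfl fun j _ => ?_
        rw [blochTerm, mul_assoc, ← qpFactor_add, neg_add_eq_sub]
      have hqi : ∀ j ∈ S, Integrable (fun α => u (s j x) * qpFactor α (i - j)) (volI m) :=
        fun j _ => (Integrable.of_bound (continuous_qpFactor _).aestronglyMeasurable 1
          (Eventually.of_forall fun α => by simp)).const_mul _
      simp_rw [hsum]
      rw [integral_sub (integrable_finsetSum S hqi) (hq (fun α => w α x) hwx), integral_finsetSum S hqi]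
      simp_rw [integral_const_mul, integral_qpFactor, sub_eq_zero]
      simp [hS]
    rw [e]
    refine (enorm_integral_sq_le (hx.1.mul
      (continuous_qpFactor i).aestronglyMeasurable)).trans (le_of_eq ?_)
    refine lintegral_congr fun α => ?_
    simp only [Pi.mul_apply, enorm_mul]
    rw [show ‖qpFactor α i‖ₑ = 1 by simp [enorm_eq_nnnorm, ← NNReal.coe_inj], mul_one]
  have h0 : ∫⁻ x, ‖u (s i x) - ∫ α, w α x * qpFactor α i ∂(volI m)‖ₑ ^ 2 ∂(cellMeasure μ κ) = 0 := by
    have h2 : Tendsto (fun S : Finset (Fin m → ℤ) => eLpNorm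
      (fun p : Hor m × X => (∑ j ∈ S, blochTerm s u j p) - w p.1 p.2) 2
      ((volI m).prod (cellMeasure μ κ)) ^ 2) atTop (𝓝 0) := by
      simpa using ENNReal.Tendsto.pow (n := 2) h
    refine le_antisymm (ge_of_tendsto h2 ?_) zero_le
    filter_upwards [eventually_ge_atTop {i}] with S hS
    exact hD S (hS (Finset.mem_singleton_self i))
  rw [lintegral_eq_zero_iff' (hdm.enorm.pow_const 2)] at h0
  filter_upwards [h0, ae_restrict_of_ae (hw.ae_slice T)] with x hx hq
  have hx' : u (s i x) - ∫ α, w α x * qpFactor α i ∂(volI m) = 0 := by simpa using hx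
  rw [sub_eq_zero.1 hx']
  refine integral_congr_ae ?_
  filter_upwards [hq.2 i] with α hα
  rw [hα, mul_comm]

/-- The Bloch series of an `L²` function converges in `L²(I × cell)`. -/
lemma exists_tendsto_blochSeries (T : IsTiling μ s κ) {u : X → ℂ} (hu : MemLp u 2 μ) :
    ∃ W : Hor m × X → ℂ, StronglyMeasurable W ∧ MemLp W 2 ((volI m).prod (cellMeasure μ κ)) ∧
      Tendsto (fun S : Finset (Fin m → ℤ) => eLpNorm
        (fun p : Hor m × X => (∑ j ∈ S, blochTerm s u j p) - W p) 2
        ((volI m).prod (cellMeasure μ κ))) atTop (𝓝 0) := by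
  set g : (Fin m → ℤ) → Lp ℂ 2 ((volI m).prod (cellMeasure μ κ)) := fun j =>
    (memLp_blochTerm T hu j).toLp with hg
  have hgc : ∀ j, g j =ᵐ[(volI m).prod (cellMeasure μ κ)] blochTerm s u j := fun j =>
    (memLp_blochTerm T hu j).coeFn_toLp
  -- The terms of the series are orthogonal, and their square norms add up to that of `u`.
  have horth : ∀ i j, i ≠ j → inner ℂ (g i) (g j) = 0 := by
    intro i j hij
    have hi : Integrable (fun p => conj (blochTerm s u i p) * blochTerm s u j p)
        ((volI m).prod (cellMeasure μ κ)) :=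
      (memLp_blochTerm T hu i).star.integrable_mul (p := 2) (q := 2) (memLp_blochTerm T hu j)
    have e : inner ℂ (g i) (g j)
        = ∫ p, conj (blochTerm s u i p) * blochTerm s u j p ∂((volI m).prod (cellMeasure μ κ)) := by
      rw [L2.inner_def]
      refine integral_congr_ae ?_
      filter_upwards [hgc i, hgc j] with p a b
      rw [a, b, RCLike.inner_apply, mul_comm]
    rw [e, integral_prod_symm _ hi]
    have e2 : ∀ x α, conj (blochTerm s u i (α, x)) * blochTerm s u j (α, x)
        = conj (u (s i x)) * u (s j x) * qpFactor α (i - j) := fun x α => by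
      simp only [blochTerm, map_mul, conj_qpFactor, neg_neg, sub_eq_add_neg, qpFactor_add]
      ring
    simp_rw [e2, integral_const_mul, integral_qpFactor, sub_eq_zero, if_neg hij]
    simp
  have hnorm : Summable fun j => ‖g j‖ ^ 2 := by
    have hfin : ∑' j, ‖g j‖ₑ ^ 2 ≠ ⊤ := by
      have h1 : ∀ j, ‖g j‖ₑ ^ 2 = ∫⁻ x, ‖u (s j x)‖ₑ ^ 2 ∂(cellMeasure μ κ) := by
        intro j
        rw [Lp.enorm_toLp, eLpNorm_two_sq,
          lintegral_prod_symm _ ((memLp_blochTerm T hu j).1.enorm.pow_const 2)]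
        refine lintegral_congr fun x => ?_
        have : ∀ α, ‖blochTerm s u j (α, x)‖ₑ ^ 2 = ‖u (s j x)‖ₑ ^ 2 := fun α => by
          rw [blochTerm, enorm_mul,
            show ‖qpFactor α (-j)‖ₑ = 1 by simp [enorm_eq_nnnorm, ← NNReal.coe_inj], mul_one]
        simp [this]
      simp_rw [h1]
      rw [← T.lintegral_eq_tsum fun x => ‖u x‖ₑ ^ 2]
      exact ((memLp_two_iff_lintegral hu.1).1 hu).ne
    have := ENNReal.summable_toReal hfin
    simpa using this
  have hsum : Summable g := by
    have hV : OrthogonalFamily ℂ (fun j => (Submodule.span ℂ {g j} : Submodule ℂ _))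
        fun j => (Submodule.span ℂ {g j}).subtypeₗᵢ := by
      refine OrthogonalFamily.of_pairwise fun i j hij => ?_
      rw [Function.onFun, Submodule.isOrtho_span]
      rintro a rfl b rfl
      exact horth i j hij
    have := (hV.summable_iff_norm_sq_summable
      fun j => ⟨g j, Submodule.mem_span_singleton_self _⟩).2 (by simpa using hnorm)
    simpa using this
  obtain ⟨W, hW⟩ := hsum
  refine ⟨W, Lp.stronglyMeasurable W, Lp.memLp W, ?_⟩
  have h1 := (Lp.tendsto_Lp_iff_tendsto_eLpNorm' _ _).1 hW
  refine h1.congr fun S => ?_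
  refine eLpNorm_congr_ae ?_
  have h2 : ∀ᵐ p ∂((volI m).prod (cellMeasure μ κ)), ∀ j, g j p = blochTerm s u j p :=
    ae_all_iff.2 hgc
  filter_upwards [h2, Lp.coeFn_finsetSum S g] with p a b
  simp only [Pi.sub_apply]
  rw [b]
  simp [a]

/-- Every `L²` function has a Bloch transform, and its Bloch series converges to it. -/
theorem exists_isBT (T : IsTiling μ s κ) {u : X → ℂ} (hu : MemLp u 2 μ) :
    ∃ w, IsBT μ s κ u w ∧ Tendsto (fun S : Finset (Fin m → ℤ) => eLpNorm
      (fun p : Hor m × X => (∑ j ∈ S, blochTerm s u j p) - w p.1 p.2) 2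
      ((volI m).prod (cellMeasure μ κ))) atTop (𝓝 0) := by
  obtain ⟨W, hW, hW2, hlim⟩ := exists_tendsto_blochSeries T hu
  have hF := isField_qpExtend T hW hW2
  have h1 : ∀ᵐ x ∂(cellMeasure μ κ), κ x = 0 := by
    filter_upwards [ae_restrict_mem (T.measurableSet_tile 0)] with x hx using hx
  have h2 : ∀ᵐ p ∂((volI m).prod (cellMeasure μ κ)), κ p.2 = 0 :=
    Measure.quasiMeasurePreserving_snd.ae h1
  have hlim' : Tendsto (fun S : Finset (Fin m → ℤ) => eLpNorm
      (fun p : Hor m × X => (∑ j ∈ S, blochTerm s u j p) - qpExtend s κ W p.1 p.2) 2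
      ((volI m).prod (cellMeasure μ κ))) atTop (𝓝 0) := by
    refine hlim.congr fun S => eLpNorm_congr_ae ?_
    filter_upwards [h2] with p hp
    simp [qpExtend, hp, T.zero]
  exact ⟨_, hF.isBT_of_tendsto T hu hlim', hlim'⟩

/-- The Bloch series of `u` converges to any transform of `u`. -/
lemma IsBT.tendsto (T : IsTiling μ s κ) {u : X → ℂ} {w : Hor m → X → ℂ} (h : IsBT μ s κ u w) :
    Tendsto (fun S : Finset (Fin m → ℤ) => eLpNorm
      (fun p : Hor m × X => (∑ j ∈ S, blochTerm s u j p) - w p.1 p.2) 2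
      ((volI m).prod (cellMeasure μ κ))) atTop (𝓝 0) := by
  obtain ⟨z, hz, hlim⟩ := exists_isBT T (h.memLp T)
  have hu := h.unique T hz
  have hu' : Function.uncurry w =ᵐ[(volI m).prod (cellMeasure μ κ)] Function.uncurry z := by
    rw [← prod_cellMeasure]; exact ae_restrict_of_ae hu
  refine hlim.congr fun S => eLpNorm_congr_ae ?_
  filter_upwards [hu'] with p hp
  simp only [Function.uncurry] at hp
  rw [hp]

end Bloch

/-! ### The tilings of `ℝ^m` and of the strip -/

/-- The index `j` of the cube `L (j + [-1/2, 1/2)^m)` that contains `y`. -/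
def horIdx (L : ℝ) (y : Hor m) : Fin m → ℤ := fun i => ⌊y i / L + 1 / 2⌋

/-- Translation by the lattice vector `L j`. -/
def horShift (L : ℝ) (j : Fin m → ℤ) (y : Hor m) : Hor m := y + L • lat j

lemma isTiling_hor {L : ℝ} (hL : 0 < L) :
    IsTiling (volume : Measure (Hor m)) (horShift L) (horIdx L) where
  mp j := measurePreserving_add_right volume (L • lat j)
  zero x := by simp [horShift]
  add i j x := by simp only [horShift, lat_add, smul_add]; abel
  meas := by
    refine measurable_pi_lambda _ fun i => ?_
    refine Int.measurable_floor.comp (Measurable.add_const (Measurable.div_const ?_ _) _)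
    fun_prop
  idx j x := by
    ext i
    simp only [horIdx, horShift, lat, PiLp.add_apply, PiLp.smul_apply, smul_eq_mul, Pi.add_apply]
    rw [← Int.floor_add_intCast]
    congr 1
    field_simp
    ring

lemma cellMeasure_hor {L : ℝ} (hL : 0 < L) : cellMeasure (volume : Measure (Hor m)) (horIdx L)
    = volume.restrict {y | ∀ i, -(L / 2) < y i ∧ y i < L / 2} := by
  refine Measure.restrict_congr_set ?_
  have e : horIdx L ⁻¹' {(0 : Fin m → ℤ)} = {y | ∀ i, y i ∈ Set.Ico (-(L / 2)) (L / 2)} := by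
    ext y
    simp only [Set.mem_preimage, Set.mem_singleton_iff, funext_iff, horIdx, Pi.zero_apply,
      Int.floor_eq_zero_iff, Set.mem_Ico, Set.mem_ofPred_eq]
    refine forall_congr' fun i => ?_
    constructor
    · rintro ⟨h1, h2⟩
      have e1 : y i = L * (y i / L) := by field_simp
      constructor <;> rw [e1] <;> nlinarith
    · rintro ⟨h1, h2⟩
      rw [← sub_le_iff_le_add, ← lt_sub_iff_add_lt, le_div_iff₀ hL, div_lt_iff₀ hL]
      constructor <;> linarith
  rw [e]
  exact (cube_ae_eq _ _ _ Set.Ioo_subset_Ico_self Set.Ico_subset_Icc_self).symm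

lemma cellMeasure_unit : cellMeasure (volume : Measure (Hor m)) (horIdx 1) = volI m :=
  cellMeasure_hor one_pos

/-- Lebesgue measure on the periodicity cell. -/
abbrev volCell (m : ℕ) : Measure (Hor m) := volume.restrict (cell m)

lemma cellMeasure_twoPi :
    cellMeasure (volume : Measure (Hor m)) (horIdx (2 * Real.pi)) = volCell m := by
  rw [cellMeasure_hor Real.two_pi_pos]
  congr 1
  simp [cell]

/-- Lebesgue measure on the strip. -/
abbrev volStrip (m : ℕ) (R : ℝ) : Measure (Pt m) := volume.restrict (strip m R)

lemma strip_eq (R : ℝ) : strip m R = Set.univ ×ˢ Set.Ioo 0 R := by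
  ext; simp [strip]

lemma volStrip_eq (R : ℝ) :
    volStrip m R = (volume : Measure (Hor m)).prod (volume.restrict (Set.Ioo 0 R)) := by
  rw [volStrip, strip_eq, Measure.volume_eq_prod, ← Measure.prod_restrict, Measure.restrict_univ]

lemma measurableSet_strip (R : ℝ) : MeasurableSet (strip m R) := by
  rw [strip_eq]; exact MeasurableSet.univ.prod measurableSet_Ioo

/-- The index of the translate of the periodicity cell above which a point lies. -/
def stripIdx (x : Pt m) : Fin m → ℤ := horIdx (2 * Real.pi) x.1

lemma isTiling_strip (R : ℝ) : IsTiling (volStrip m R) shift stripIdx where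
  mp j := by
    rw [volStrip_eq]
    exact ((isTiling_hor Real.two_pi_pos).mp j).prod (MeasurePreserving.id _)
  zero x := by simp [shift]
  add i j x := Prod.ext ((isTiling_hor Real.two_pi_pos).add i j x.1) rfl
  meas := (isTiling_hor Real.two_pi_pos).meas.comp measurable_fst
  idx j x := (isTiling_hor Real.two_pi_pos).idx j x.1

lemma cellMeasure_strip_prod (R : ℝ) :
    cellMeasure (volStrip m R) stripIdx = (volCell m).prod (volume.restrict (Set.Ioo 0 R)) := by
  have h := Measure.prod_restrict (μ := (volume : Measure (Hor m)))
    (ν := volume.restrict (Set.Ioo 0 R)) (horIdx (2 * Real.pi) ⁻¹' {0}) Set.univ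
  rw [Measure.restrict_univ, ← volStrip_eq, ← cellMeasure, cellMeasure_twoPi] at h
  rw [h, cellMeasure]
  congr 1
  ext x
  simp [stripIdx]

lemma volume_restrict_cellStrip (R : ℝ) :
    volume.restrict (cellStrip m R) = (volCell m).prod (volume.restrict (Set.Ioo 0 R)) := by
  rw [volCell, Measure.prod_restrict, ← Measure.volume_eq_prod]
  rfl

lemma cellMeasure_strip (R : ℝ) :
    cellMeasure (volStrip m R) stripIdx = volume.restrict (cellStrip m R) := by
  rw [cellMeasure_strip_prod, volume_restrict_cellStrip]

/-- The Bloch transform over the strip, in the form of a mean over the quasi-periodicities. -/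
abbrev StripBT (R : ℝ) (u : Pt m → ℂ) (w : Hor m → Pt m → ℂ) : Prop :=
  IsBT (volStrip m R) shift stripIdx u w

/-- The Bloch transform over the boundary `Γ^R`, identified with `ℝ^m`. -/
abbrev HorBT (t : Hor m → ℂ) (z : Hor m → Hor m → ℂ) : Prop :=
  IsBT volume (horShift (2 * Real.pi)) (horIdx (2 * Real.pi)) t z

lemma qpFactor_neg_eq (α : Hor m) (j : Fin m → ℤ) : qpFactor α (-j)
    = Complex.exp ((2 * Real.pi * (inner ℝ α (lat j) : ℝ)) * Complex.I) := by
  simp [qpFactor, lat_neg]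

/-- Convergence of the Bloch series yields the inversion formula. -/
lemma IsBlochTransform.stripBT {R : ℝ} {u : Pt m → ℂ} {w : Hor m → Pt m → ℂ}
    (h : IsBlochTransform R u w) (hu : MemLp u 2 (volStrip m R)) : StripBT R u w := by
  have T := isTiling_strip (m := m) R
  have hlim : Tendsto (fun S : Finset (Fin m → ℤ) => eLpNorm
      (fun p : Hor m × Pt m => (∑ j ∈ S, blochTerm shift u j p) - w p.1 p.2) 2
      ((volI m).prod (cellMeasure (volStrip m R) stripIdx))) atTop (𝓝 0) := by
    have := h.series
    rw [← cellMeasure_strip] at this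
    simpa only [blochTerm, qpFactor_neg_eq] using this
  refine IsField.isBT_of_tendsto T hu ⟨h.meas, fun j => ?_, ?_⟩ hlim
  · refine ae_prod_eq_of_ae_ae (f := fun p : Hor m × Pt m => w p.1 (shift j p.2))
      (g := fun p : Hor m × Pt m => qpFactor p.1 j * w p.1 p.2)
      (h.meas.comp_measurePreserving ((T.prod (volI m)).mp j)) ?_ ?_
    · exact ((continuous_qpFactor j).measurable.comp measurable_fst).aestronglyMeasurable.mul
        h.meas
    · filter_upwards [h.qp] with α hα
      exact hα j
  · have h1 : ∀ᶠ S in atTop, eLpNorm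
        (fun p : Hor m × Pt m => (∑ j ∈ S, blochTerm shift u j p) - w p.1 p.2) 2
        ((volI m).prod (cellMeasure (volStrip m R) stripIdx)) < 1 :=
      hlim.eventually_lt_const one_pos
    obtain ⟨S, hS⟩ := h1.exists
    have hsum : MemLp (fun p : Hor m × Pt m => ∑ j ∈ S, blochTerm shift u j p) 2
        ((volI m).prod (cellMeasure (volStrip m R) stripIdx)) :=
      memLp_finsetSum S fun j _ => memLp_blochTerm T hu j
    have hw : AEStronglyMeasurable (Function.uncurry w)
        ((volI m).prod (cellMeasure (volStrip m R) stripIdx)) := by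
      rw [← prod_cellMeasure]; exact h.meas.restrict
    have h2 : MemLp (fun p : Hor m × Pt m => (∑ j ∈ S, blochTerm shift u j p) - w p.1 p.2) 2
        ((volI m).prod (cellMeasure (volStrip m R) stripIdx)) :=
      ⟨hsum.1.sub hw, hS.trans ENNReal.one_lt_top⟩
    convert hsum.sub h2 using 1
    ext p
    simp [Function.uncurry]

lemma IsField.ae_isQP {R : ℝ} {w : Hor m → Pt m → ℂ}
    (h : IsField (volStrip m R) shift stripIdx w) : ∀ᵐ α ∂(volI m), IsQP R α (w α) :=
  ae_all_iff.2 fun j => Measure.ae_ae_of_ae_prod (h.qp j)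

/-- The inversion formula yields convergence of the Bloch series. -/
lemma IsBT.isBlochTransform {R : ℝ} {u : Pt m → ℂ} {w : Hor m → Pt m → ℂ}
    (h : StripBT R u w) : IsBlochTransform R u w where
  meas := h.field.meas
  qp := h.field.ae_isQP
  series := by
    have := h.tendsto (isTiling_strip R)
    rw [cellMeasure_strip] at this
    simpa only [blochTerm, qpFactor_neg_eq] using this

/-- The transform is defined on all of `L²(Ω^R)`. -/
theorem exists_isBlochTransform {R : ℝ} {g : Pt m → ℂ} (hg : MemLp g 2 (volStrip m R)) :
    ∃ w, IsBlochTransform R g w := by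
  obtain ⟨w, hw, -⟩ := exists_isBT (isTiling_strip R) hg
  exact ⟨w, hw.isBlochTransform⟩

/-! ### Fourier series on the periodicity cell -/

lemma measurable_fourierHat (τ : Hor m → ℂ) : Measurable (fourierHat τ) := by
  unfold fourierHat
  split_ifs with h
  · exact ((Lp.stronglyMeasurable _).measurable.comp (measurable_const_smul _)).const_mul _
  · exact measurable_const

lemma nrm_pos : 0 < nrm m := Real.rpow_pos_of_pos Real.two_pi_pos _

lemma nrm_sq : nrm m ^ 2 * (2 * Real.pi) ^ m = 1 := by
  rw [nrm, ← Real.rpow_natCast, ← Real.rpow_natCast, ← Real.rpow_mul Real.two_pi_pos.le,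
    ← Real.rpow_add Real.two_pi_pos]
  norm_num

/-- The dilation `α ↦ 2πα` maps Lebesgue measure to its multiple by `(2π)^{-m}`. -/
lemma map_dilation : Measure.map (fun α : Hor m => (2 * Real.pi) • α) volume
    = ENNReal.ofReal (nrm m ^ 2) • (volume : Measure (Hor m)) := by
  rw [Measure.map_addHaar_smul volume Real.two_pi_pos.ne', finrank_euclideanSpace_fin,
    abs_of_pos (inv_pos.2 (pow_pos Real.two_pi_pos m))]
  congr 2
  exact (eq_inv_of_mul_eq_one_left nrm_sq).symm

lemma measurableEmbedding_dilation :
    MeasurableEmbedding fun α : Hor m => (2 * Real.pi) • α :=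
  (Homeomorph.smulOfNeZero _ Real.two_pi_pos.ne').measurableEmbedding

lemma map_dilation_brillouin : Measure.map (fun α : Hor m => (2 * Real.pi) • α) (volI m)
    = ENNReal.ofReal (nrm m ^ 2) • volCell m := by
  have e : brillouin m = (fun α : Hor m => (2 * Real.pi) • α) ⁻¹' (cell m) := by
    ext α
    simp only [brillouin, cell, Set.mem_ofPred_eq, Set.mem_preimage, PiLp.smul_apply, smul_eq_mul]
    refine forall_congr' fun i => and_congr ?_ ?_
    · constructor <;> intro h <;> nlinarith [Real.pi_pos]
    · constructor <;> intro h <;> nlinarith [Real.pi_pos]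
  rw [volI, e, ← measurableEmbedding_dilation.restrict_map, map_dilation, Measure.restrict_smul]

/-- The character `e^{i ξ·y}`. -/
def expo (ξ y : Hor m) : ℂ := Complex.exp (((inner ℝ ξ y : ℝ) : ℂ) * Complex.I)

@[simp] lemma norm_expo (ξ y : Hor m) : ‖expo ξ y‖ = 1 := Complex.norm_exp_ofReal_mul_I _

lemma expo_add_left (ξ η y : Hor m) : expo (ξ + η) y = expo ξ y * expo η y := by
  simp only [expo, inner_add_left, ← Complex.exp_add]
  congr 1; push_cast; ring

lemma expo_add_right (ξ y z : Hor m) : expo ξ (y + z) = expo ξ y * expo ξ z := by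
  simp only [expo, inner_add_right, ← Complex.exp_add]
  congr 1; push_cast; ring

lemma continuous_expo : Continuous fun p : Hor m × Hor m => expo p.1 p.2 := by
  unfold expo; fun_prop

/-- Characters at dilated points, in terms of the characters on the Brillouin zone. -/
lemma expo_lat_dilation (j : Fin m → ℤ) (β : Hor m) :
    expo (lat j) ((2 * Real.pi) • β) = qpFactor β (-j) := by
  rw [qpFactor_neg_eq, expo, inner_smul_right, real_inner_comm]
  push_cast; rfl

lemma expo_lat_lat (i j : Fin m → ℤ) : expo (lat i) ((2 * Real.pi) • lat j) = 1 := by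
  rw [expo, inner_smul_right, inner_lat, Complex.exp_eq_one_iff]
  refine ⟨∑ l, i l * j l, ?_⟩
  simp only [lat]
  push_cast; ring

lemma expo_neg_shift (α : Hor m) (j l : Fin m → ℤ) (y : Hor m) :
    expo (-(α + lat j)) (y + (2 * Real.pi) • lat l)
      = qpFactor α l * expo (-(α + lat j)) y := by
  rw [expo_add_right, neg_add, expo_add_left (-α) (-lat j) (_ • _), ← lat_neg, expo_lat_lat,
    mul_one, mul_comm]
  congr 1
  rw [expo, qpFactor, inner_smul_right, inner_neg_left]
  push_cast; congr 1; ring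

lemma integral_dilation (f : Hor m → ℂ) :
    ∫ α, f ((2 * Real.pi) • α) ∂(volI m) = (nrm m : ℂ) ^ 2 * ∫ y, f y ∂(volCell m) := by
  rw [← measurableEmbedding_dilation.integral_map, map_dilation_brillouin,
    integral_smul_measure, ENNReal.toReal_ofReal (by positivity)]
  simp

lemma lintegral_dilation (f : Hor m → ℝ≥0∞) :
    ∫⁻ α, f ((2 * Real.pi) • α) ∂(volI m)
      = ENNReal.ofReal (nrm m ^ 2) * ∫⁻ y, f y ∂(volCell m) := by
  rw [← measurableEmbedding_dilation.lintegral_map, map_dilation_brillouin,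
    lintegral_smul_measure, smul_eq_mul]

lemma ofReal_nrm_sq_ne_zero : ENNReal.ofReal (nrm m ^ 2) ≠ 0 := by
  simpa using nrm_pos.ne'

instance : IsFiniteMeasure (volCell m) := by
  constructor
  have h := lintegral_dilation (m := m) fun _ => 1
  simp only [lintegral_const, one_mul, measure_univ] at h
  by_contra hc
  rw [not_lt, top_le_iff] at hc
  rw [hc, ENNReal.mul_top ofReal_nrm_sq_ne_zero] at h
  exact ENNReal.one_ne_top h

lemma coeff_eq (α : Hor m) (τ : Hor m → ℂ) (j : Fin m → ℤ) :
    coeff α τ j = nrm m * ∫ y, τ y * expo (α + lat j) y ∂(volCell m) := by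
  rw [coeff, ← integral_const_mul]
  refine integral_congr_ae (Eventually.of_forall fun y => ?_)
  simp only [expo_add_left, psi, map_mul, ← Complex.exp_conj, Complex.conj_ofReal, map_neg,
    Complex.conj_I]
  simp only [expo]
  ring_nf

/-- The quasi-periodic Fourier coefficients as coefficients on the Brillouin zone. -/
lemma coeff_eq_fourier (α : Hor m) (τ : Hor m → ℂ) (j : Fin m → ℤ) :
    ∫ β, (τ ((2 * Real.pi) • β) * expo α ((2 * Real.pi) • β)) * qpFactor β (-j) ∂(volI m)
      = nrm m * coeff α τ j := by
  have h := integral_dilation fun y : Hor m => τ y * expo (α + lat j) y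
  rw [coeff_eq, ← mul_assoc, ← pow_two, ← h]
  refine integral_congr_ae (Eventually.of_forall fun β => ?_)
  simp only [expo_add_left, expo_lat_dilation]
  ring

lemma integrable_comp_dilation {f : Hor m → ℂ} (hf : Integrable f (volCell m)) :
    Integrable (fun β => f ((2 * Real.pi) • β)) (volI m) := by
  rw [← Function.comp_def f, ← measurableEmbedding_dilation.integrable_map_iff,
    map_dilation_brillouin]
  exact hf.smul_measure ENNReal.ofReal_ne_top

lemma ae_comp_dilation {P : Hor m → Prop} (h : ∀ᵐ β ∂(volI m), P ((2 * Real.pi) • β)) :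
    ∀ᵐ y ∂(volCell m), P y := by
  rw [← measurableEmbedding_dilation.ae_map_iff (p := P), map_dilation_brillouin] at h
  exact (Measure.ae_ennreal_smul_measure_iff ofReal_nrm_sq_ne_zero).1 h

lemma integrable_mul_expo {f : Hor m → ℂ} {μ : Measure (Hor m)} (hf : Integrable f μ)
    (ξ : Hor m) : Integrable (fun y => f y * expo ξ y) μ :=
  hf.mul_bdd (c := 1)
    (continuous_expo.comp (continuous_const.prodMk continuous_id)).aestronglyMeasurable
    (Eventually.of_forall fun y => by simp)

/-- Parseval's identity for quasi-periodic functions on the cell. -/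
lemma tsum_enorm_coeff (α : Hor m) {τ : Hor m → ℂ} (hτ : MemLp τ 2 (volCell m)) :
    ∑' j, ‖coeff α τ j‖ₑ ^ 2 = ∫⁻ y, ‖τ y‖ₑ ^ 2 ∂(volCell m) := by
  have hm : AEStronglyMeasurable (fun y => τ y * expo α y) (volCell m) := hτ.1.mul
    (continuous_expo.comp (continuous_const.prodMk continuous_id)).aestronglyMeasurable
  have hn : ∀ y, ‖τ y * expo α y‖ₑ = ‖τ y‖ₑ := fun y => by
    rw [enorm_mul, show ‖expo α y‖ₑ = 1 by simp [enorm_eq_nnnorm, ← NNReal.coe_inj], mul_one]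
  have hf : MemLp (fun β => τ ((2 * Real.pi) • β) * expo α ((2 * Real.pi) • β)) 2 (volI m) := by
    have h1 := (measurableEmbedding_dilation (m := m)).aestronglyMeasurable_map_iff
      (μ := volI m) (g := fun y => τ y * expo α y)
    rw [map_dilation_brillouin] at h1
    have h2 : AEStronglyMeasurable
        (fun β => τ ((2 * Real.pi) • β) * expo α ((2 * Real.pi) • β)) (volI m) :=
      h1.1 (hm.mono_ac Measure.smul_absolutelyContinuous)
    rw [memLp_two_iff_lintegral h2, lintegral_dilation fun y => ‖τ y * expo α y‖ₑ ^ 2]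
    simp_rw [hn]
    exact ENNReal.mul_lt_top ENNReal.ofReal_lt_top ((memLp_two_iff_lintegral hτ.1).1 hτ)
  have h := tsum_enorm_sq_of_hasSum hf (hasSum_fourier_brillouin hf hf)
  rw [lintegral_dilation fun y => ‖τ y * expo α y‖ₑ ^ 2] at h
  simp_rw [hn] at h
  rw [← (Equiv.neg (Fin m → ℤ)).tsum_eq] at h
  simp only [Equiv.neg_apply, coeff_eq_fourier, enorm_mul, mul_pow] at h
  rw [ENNReal.tsum_mul_left] at h
  have e : ‖(nrm m : ℂ)‖ₑ ^ 2 = ENNReal.ofReal (nrm m ^ 2) := by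
    rw [ENNReal.ofReal_pow nrm_pos.le, ← ofReal_norm, Complex.norm_real, Real.norm_eq_abs,
      abs_of_pos nrm_pos]
  rw [e] at h
  exact (ENNReal.mul_right_inj ofReal_nrm_sq_ne_zero ENNReal.ofReal_ne_top).1 h

/-- An integrable function on the cell is determined by its Fourier coefficients. -/
lemma ae_eq_zero_of_coeff (α : Hor m) {τ : Hor m → ℂ} (hτ : Integrable τ (volCell m))
    (h : ∀ j, coeff α τ j = 0) : τ =ᵐ[volCell m] 0 := by
  have h1 := ae_eq_zero_of_fourier_brillouin
    (integrable_comp_dilation (integrable_mul_expo hτ α)) fun j => by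
      have := coeff_eq_fourier α τ (-j)
      rwa [h, neg_neg, mul_zero] at this
  have h2 := ae_comp_dilation (P := fun y => τ y * expo α y = 0) h1
  filter_upwards [h2] with y hy
  have : expo α y ≠ 0 := by simp [expo]
  simpa [this] using hy

lemma coeff_sub (α : Hor m) {τ σ : Hor m → ℂ} (hτ : Integrable τ (volCell m))
    (hσ : Integrable σ (volCell m)) (j : Fin m → ℤ) :
    coeff α (fun y => τ y - σ y) j = coeff α τ j - coeff α σ j := by
  simp only [coeff_eq, sub_mul]
  rw [integral_sub (integrable_mul_expo hτ _) (integrable_mul_expo hσ _), mul_sub]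

lemma coeff_congr (α : Hor m) {τ σ : Hor m → ℂ} (h : τ =ᵐ[volCell m] σ) (j : Fin m → ℤ) :
    coeff α τ j = coeff α σ j := by
  simp only [coeff_eq]
  congr 1
  refine integral_congr_ae ?_
  filter_upwards [h] with y hy
  rw [hy]

lemma integral_expo_cell (α : Hor m) (i j : Fin m → ℤ) :
    ∫ y, expo (-(α + lat i)) y * expo (α + lat j) y ∂(volCell m)
      = if i = j then ((nrm m : ℂ) ^ 2)⁻¹ else 0 := by
  have h := integral_dilation fun y : Hor m => expo (-(α + lat i)) y * expo (α + lat j) y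
  have e : ∀ y : Hor m, expo (-(α + lat i)) y * expo (α + lat j) y = expo (lat (j - i)) y :=
    fun y => by
      rw [← expo_add_left]; congr 1; rw [sub_eq_add_neg, lat_add, lat_neg]; abel
  simp only [e, expo_lat_dilation, integral_qpFactor] at h
  have hn : (nrm m : ℂ) ^ 2 ≠ 0 := pow_ne_zero _ (Complex.ofReal_ne_zero.2 nrm_pos.ne')
  simp only [e]
  rw [← mul_right_inj' hn, ← h]
  by_cases hij : i = j
  · simp [hij, hn]
  · simp [hij, sub_eq_zero]

/-- The quasi-periodic function with Fourier coefficients `a`. -/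
def fiberSeries (α : Hor m) (a : (Fin m → ℤ) → ℂ) (y : Hor m) : ℂ :=
  nrm m * ∑' j, a j * expo (-(α + lat j)) y

/-- The `j`-th Fourier coefficient of an absolutely convergent series is its `j`-th term. -/
lemma coeff_fiberSeries (α : Hor m) {a : (Fin m → ℤ) → ℂ} (ha : Summable fun j => ‖a j‖)
    (j : Fin m → ℤ) : coeff α (fiberSeries α a) j = a j := by
  have hc : ∀ ξ : Hor m, Continuous (expo ξ) := fun ξ =>
    continuous_expo.comp (continuous_const.prodMk continuous_id)
  have e : ∀ y, fiberSeries α a y * expo (α + lat j) y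
      = nrm m * ∑' i, a i * (expo (-(α + lat i)) y * expo (α + lat j) y) := fun y => by
    rw [fiberSeries, mul_assoc, ← tsum_mul_right]
    simp_rw [mul_assoc]
  have hs := hasSum_integral_of_summable_integral_norm (μ := volCell m)
    (F := fun i y => a i * (expo (-(α + lat i)) y * expo (α + lat j) y))
    (fun i => (Integrable.of_bound ((hc _).mul (hc _)).aestronglyMeasurable 1
      (Eventually.of_forall fun y => by simp)).const_mul _)
    (by simpa using ha.mul_left _)
  rw [coeff_eq]
  simp_rw [e]
  rw [integral_const_mul, ← hs.tsum_eq]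
  simp_rw [integral_const_mul, integral_expo_cell]
  rw [tsum_eq_single j (fun i hi => by simp [hi])]
  have hn : (nrm m : ℂ) ≠ 0 := Complex.ofReal_ne_zero.2 nrm_pos.ne'
  simp only [if_true]
  field_simp

/-! ### Synthesis from the Fourier side -/

lemma fiberSeries_shift (α : Hor m) (a : (Fin m → ℤ) → ℂ) (l : Fin m → ℤ) (y : Hor m) :
    fiberSeries α a (y + (2 * Real.pi) • lat l) = qpFactor α l * fiberSeries α a y := by
  simp only [fiberSeries, expo_neg_shift]
  simp_rw [mul_left_comm _ (qpFactor α l)]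
  rw [tsum_mul_left]
  ring

/-- The points `-(α + j)`, with `α ∈ I` and `j` a lattice point, exhaust `ℝ^m`. -/
lemma ae_neg_lattice {P : Hor m → Prop} (h : ∀ᵐ ξ : Hor m, P ξ) :
    ∀ᵐ α ∂(volI m), ∀ j, P (-(α + lat j)) := by
  have h1 := (Measure.measurePreserving_neg (volume : Measure (Hor m))).quasiMeasurePreserving.ae h
  have h2 := (isTiling_hor (m := m) one_pos).ae_shift h1
  have h3 := ae_restrict_of_ae (s := brillouin m) h2
  simpa [horShift] using h3

lemma lintegral_neg_lattice {f : Hor m → ℝ≥0∞} (hf : AEMeasurable f volume) :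
    ∫⁻ ξ, f ξ = ∫⁻ α, ∑' j, f (-(α + lat j)) ∂(volI m) := by
  have hn := Measure.measurePreserving_neg (volume : Measure (Hor m))
  have h1 := (isTiling_hor (m := m) one_pos).lintegral_eq_lintegral_tsum
    (f := fun ξ => f (-ξ)) (hf.comp_quasiMeasurePreserving hn.quasiMeasurePreserving)
  rw [cellMeasure_unit, hn.lintegral_comp_emb (MeasurableEquiv.neg _).measurableEmbedding f] at h1
  simpa [horShift] using h1

/-- An integral over `ℝ^m` as a lattice sum integrated over the Brillouin zone. -/
lemma integral_neg_lattice {f : Hor m → ℂ} (hf : Integrable f) :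
    Integrable (fun α => ∑' j, f (-(α + lat j))) (volI m) ∧
      (∀ᵐ α ∂(volI m), Summable fun j => ‖f (-(α + lat j))‖) ∧
      ∫ ξ, f ξ = ∫ α, ∑' j, f (-(α + lat j)) ∂(volI m) := by
  have T := isTiling_hor (m := m) one_pos
  have h0 := T.integrable_tsum hf.comp_neg
  have h1 := T.integral_eq_integral_tsum hf.comp_neg
  have h2 := T.summable_of_integrable hf.comp_neg
  rw [cellMeasure_unit] at h0 h1 h2
  rw [integral_neg_eq_self] at h1
  simp only [horShift, one_smul] at h0 h1 h2
  exact ⟨h0, h2, h1⟩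

/-- The field whose fibre at `α` has the Fourier coefficients `s(-(α + j))`. -/
def blochSynth (s : Hor m → ℂ) (α y : Hor m) : ℂ := fiberSeries α (fun j => s (-(α + lat j))) y

lemma measurable_blochSynth {s : Hor m → ℂ} (hs : Measurable s) :
    Measurable (Function.uncurry (blochSynth s)) := by
  have h : ∀ j : Fin m → ℤ, Measurable fun p : Hor m × Hor m =>
      s (-(p.1 + lat j)) * expo (-(p.1 + lat j)) p.2 := fun j => by
    have h1 : Measurable fun p : Hor m × Hor m => -(p.1 + lat j) := by fun_prop
    have h2 := hs.comp h1
    have h3 := (continuous_expo (m := m)).measurable.comp (h1.prodMk measurable_snd)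
    exact h2.mul h3
  exact (Measurable.tsum h).const_mul _

/-- The mean of the synthesized field over `I` is the inverse Fourier transform of `s`. -/
lemma integral_blochSynth {s : Hor m → ℂ} (hs : Integrable s) (y : Hor m) :
    Integrable (fun α => blochSynth s α y) (volI m) ∧
      ∫ α, blochSynth s α y ∂(volI m) = nrm m * ∫ ξ, s ξ * expo ξ y := by
  have hi : Integrable fun ξ => s ξ * expo ξ y :=
    hs.mul_bdd (c := 1)
      (continuous_expo.comp (continuous_id.prodMk continuous_const)).aestronglyMeasurable
      (Eventually.of_forall fun y => by simp)
  obtain ⟨h1, -, h3⟩ := integral_neg_lattice hi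
  unfold blochSynth fiberSeries
  exact ⟨h1.const_mul _, by rw [integral_const_mul, h3]⟩

lemma integral_blochSynth_mul_qpFactor {s : Hor m → ℂ} (hs : Integrable s) (y : Hor m)
    (j : Fin m → ℤ) : ∫ α, blochSynth s α y * qpFactor α j ∂(volI m)
      = nrm m * ∫ ξ, s ξ * expo ξ (y + (2 * Real.pi) • lat j) := by
  rw [← (integral_blochSynth hs _).2]
  refine integral_congr_ae (Eventually.of_forall fun α => ?_)
  simp only [blochSynth]
  rw [fiberSeries_shift, mul_comm]

/-! ### The unitary Fourier transform and the Bloch transform on the boundary -/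

lemma map_contraction : Measure.map (fun ξ : Hor m => (2 * Real.pi)⁻¹ • ξ) volume
    = ENNReal.ofReal ((2 * Real.pi) ^ m) • (volume : Measure (Hor m)) := by
  rw [Measure.map_addHaar_smul volume (inv_ne_zero Real.two_pi_pos.ne'),
    finrank_euclideanSpace_fin, ← inv_pow, inv_inv, abs_of_pos (pow_pos Real.two_pi_pos m)]

lemma measurableEmbedding_contraction :
    MeasurableEmbedding fun ξ : Hor m => (2 * Real.pi)⁻¹ • ξ :=
  (Homeomorph.smulOfNeZero _ (inv_ne_zero Real.two_pi_pos.ne')).measurableEmbedding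

lemma ae_contraction {P : Hor m → Prop} (h : ∀ᵐ η : Hor m, P η) :
    ∀ᵐ ξ : Hor m, P ((2 * Real.pi)⁻¹ • ξ) := by
  rw [← measurableEmbedding_contraction.ae_map_iff (p := P), map_contraction]
  exact Measure.ae_smul_measure h _

lemma lintegral_contraction (f : Hor m → ℝ≥0∞) :
    ∫⁻ ξ, f ((2 * Real.pi)⁻¹ • ξ) = ENNReal.ofReal ((2 * Real.pi) ^ m) * ∫⁻ η, f η := by
  rw [← measurableEmbedding_contraction.lintegral_map, map_contraction,
    lintegral_smul_measure, smul_eq_mul]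

lemma enorm_nrm_sq : ‖(nrm m : ℂ)‖ₑ ^ 2 = ENNReal.ofReal (nrm m ^ 2) := by
  rw [ENNReal.ofReal_pow nrm_pos.le, ← ofReal_norm, Complex.norm_real, Real.norm_eq_abs,
    abs_of_pos nrm_pos]

lemma lintegral_nrm_contraction (f : Hor m → ℂ) :
    ∫⁻ ξ, ‖nrm m * f ((2 * Real.pi)⁻¹ • ξ)‖ₑ ^ 2 = ∫⁻ η, ‖f η‖ₑ ^ 2 := by
  simp_rw [enorm_mul, mul_pow, enorm_nrm_sq]
  rw [lintegral_const_mul' _ _ ENNReal.ofReal_ne_top,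
    lintegral_contraction fun η => ‖f η‖ₑ ^ 2, ← mul_assoc,
    ← ENNReal.ofReal_mul (by positivity), nrm_sq, ENNReal.ofReal_one, one_mul]

lemma fourierHat_of_memLp {τ : Hor m → ℂ} (h : MemLp τ 2 (volume : Measure (Hor m))) (ξ : Hor m) :
    fourierHat τ ξ = nrm m * (𝓕 (h.toLp τ) : Lp ℂ 2 (volume : Measure (Hor m)))
      ((2 * Real.pi)⁻¹ • ξ) := by
  rw [fourierHat, dif_pos h]

/-- Plancherel's identity. -/
lemma lintegral_fourierHat {τ : Hor m → ℂ} (h : MemLp τ 2 (volume : Measure (Hor m))) :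
    ∫⁻ ξ, ‖fourierHat τ ξ‖ₑ ^ 2 = ∫⁻ y, ‖τ y‖ₑ ^ 2 := by
  simp_rw [fourierHat_of_memLp h]
  rw [lintegral_nrm_contraction, ← eLpNorm_two_sq, ← eLpNorm_two_sq, ← Lp.enorm_def,
    ← Lp.enorm_toLp h]
  have := Lp.norm_fourier_eq (h.toLp τ)
  rw [← ofReal_norm, ← ofReal_norm, this]

lemma fourierHat_sub {τ σ : Hor m → ℂ} (h : MemLp τ 2 (volume : Measure (Hor m)))
    (h' : MemLp σ 2 (volume : Measure (Hor m))) :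
    ∀ᵐ ξ, fourierHat (fun y => τ y - σ y) ξ = fourierHat τ ξ - fourierHat σ ξ := by
  have e : (h.sub h').toLp (fun y => τ y - σ y) = h.toLp τ - h'.toLp σ := rfl
  have e2 : 𝓕 (h.toLp τ - h'.toLp σ) = 𝓕 (h.toLp τ) - 𝓕 (h'.toLp σ) :=
    map_sub (Lp.fourierTransformₗᵢ (Hor m) ℂ) _ _
  filter_upwards [ae_contraction (Lp.coeFn_sub (𝓕 (h.toLp τ)) (𝓕 (h'.toLp σ)))] with ξ hξ
  have h3 := fourierHat_of_memLp (τ := fun y => τ y - σ y) (h.sub h') ξ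
  rw [fourierHat_of_memLp h, fourierHat_of_memLp h', h3, e, e2, hξ, Pi.sub_apply, mul_sub]

/-- The Fourier transform is onto. -/
lemma exists_fourierHat_eq {s : Hor m → ℂ} (hs : MemLp s 2 (volume : Measure (Hor m))) :
    ∃ t, MemLp t 2 (volume : Measure (Hor m)) ∧ fourierHat t =ᵐ[volume] s := by
  have hn : (nrm m : ℂ) ≠ 0 := Complex.ofReal_ne_zero.2 nrm_pos.ne'
  have hm : AEStronglyMeasurable (fun η => (nrm m : ℂ)⁻¹ * s ((2 * Real.pi) • η)) volume := by
    refine AEStronglyMeasurable.const_mul ?_ _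
    refine (measurableEmbedding_dilation.aestronglyMeasurable_map_iff (g := s)).1 ?_
    rw [map_dilation]
    exact hs.1.mono_ac Measure.smul_absolutelyContinuous
  have h2 : MemLp (fun η => (nrm m : ℂ)⁻¹ * s ((2 * Real.pi) • η)) 2 volume := by
    rw [memLp_two_iff_lintegral hm, ← lintegral_nrm_contraction]
    simpa only [smul_inv_smul₀ Real.two_pi_pos.ne', mul_inv_cancel_left₀ hn] using
      (memLp_two_iff_lintegral hs.1).1 hs
  set S := h2.toLp with hS
  set F : Lp ℂ 2 (volume : Measure (Hor m)) := 𝓕⁻ S with hF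
  refine ⟨F, Lp.memLp F, ?_⟩
  have e : (Lp.memLp F).toLp F = F := Lp.toLp_coeFn F _
  filter_upwards [ae_contraction h2.coeFn_toLp] with ξ hξ
  rw [fourierHat_of_memLp (Lp.memLp F), e, hF, FourierTransform.fourier_fourierInv_eq, hξ,
    smul_inv_smul₀ Real.two_pi_pos.ne', mul_inv_cancel_left₀ hn]

/-- The Fourier transform of a Schwartz function, and Fourier inversion. -/
lemma fourierHat_schwartz (g : SchwartzMap (Hor m) ℂ) :
    ∃ s : Hor m → ℂ, Measurable s ∧ Integrable s ∧ fourierHat g =ᵐ[volume] s ∧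
      ∀ y, g y = nrm m * ∫ ξ, s ξ * expo ξ y := by
  refine ⟨fun ξ => nrm m * (𝓕 g) ((2 * Real.pi)⁻¹ • ξ), ?_, ?_, ?_, fun y => ?_⟩
  · exact ((𝓕 g).continuous.measurable.comp (measurable_const_smul _)).const_mul _
  · exact ((𝓕 g).integrable.comp_smul (inv_ne_zero Real.two_pi_pos.ne')).const_mul _
  · have h : MemLp (g : Hor m → ℂ) 2 volume := g.memLp 2
    have e : 𝓕 (h.toLp g) = (𝓕 g).toLp 2 := SchwartzMap.toLp_fourier_eq g
    filter_upwards [ae_contraction ((𝓕 g).coeFn_toLp 2 volume)] with ξ hξ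
    rw [fourierHat_of_memLp h, e, hξ]
  · have h1 : ∫ ξ, nrm m * (𝓕 g) ((2 * Real.pi)⁻¹ • ξ) * expo ξ y
        = (2 * Real.pi) ^ m • ∫ η, nrm m * (𝓕 g) η * expo ((2 * Real.pi) • η) y := by
      have := Measure.integral_comp_smul (volume : Measure (Hor m))
        (fun η => nrm m * (𝓕 g) η * expo ((2 * Real.pi) • η) y) (2 * Real.pi)⁻¹
      rw [finrank_euclideanSpace_fin, ← inv_pow, inv_inv,
        abs_of_pos (pow_pos Real.two_pi_pos m)] at this
      rw [← this]
      simp only [smul_inv_smul₀ Real.two_pi_pos.ne']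
    have h2 : g y = (𝓕⁻ (𝓕 g)) y := by rw [FourierTransform.fourierInv_fourier_eq]
    rw [h1, h2, SchwartzMap.fourierInv_coe, Real.fourierInv_eq']
    simp_rw [mul_assoc (nrm m : ℂ)]
    rw [integral_const_mul, Complex.real_smul]
    have h3 : (nrm m : ℂ) * ((((2 * Real.pi) ^ m : ℝ) : ℂ) * (nrm m * ∫ η, 𝓕 g η * expo ((2 * Real.pi) • η) y))
        = ((nrm m ^ 2 * (2 * Real.pi) ^ m : ℝ) : ℂ) * ∫ η, 𝓕 g η * expo ((2 * Real.pi) • η) y := by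
      push_cast; ring
    rw [h3, nrm_sq, Complex.ofReal_one, one_mul]
    refine integral_congr_ae (Eventually.of_forall fun η => ?_)
    simp only [expo, inner_smul_left, smul_eq_mul, SchwartzMap.fourier_coe]
    rw [mul_comm]
    congr 2

lemma isTiling_twoPi : IsTiling (volume : Measure (Hor m)) (horShift (2 * Real.pi))
    (horIdx (2 * Real.pi)) := isTiling_hor Real.two_pi_pos

/-- If `t` is the absolutely convergent inverse Fourier integral of `s`, then the transform of `t`
is synthesized from `s`. -/
lemma IsBT.eq_blochSynth {t : Hor m → ℂ} {z : Hor m → Hor m → ℂ} (h : HorBT t z)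
    {s : Hor m → ℂ} (hsm : Measurable s) (hs : Integrable s)
    (ht : ∀ y, t y = nrm m * ∫ ξ, s ξ * expo ξ y) :
    Function.uncurry z =ᵐ[(volI m).prod volume] Function.uncurry (blochSynth s) := by
  refine ae_prod_eq_of_fourier h.field.meas (measurable_blochSynth hsm).aestronglyMeasurable ?_
  filter_upwards [h.field.ae_slice isTiling_twoPi, h.coef isTiling_twoPi] with y h1 h2
  refine ⟨h1.1.integrable one_le_two, (integral_blochSynth hs y).1, fun j => ?_⟩
  rw [integral_blochSynth_mul_qpFactor hs, ← h2 j, ht]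
  rfl

lemma aestronglyMeasurable_coeff {z : Hor m → Hor m → ℂ}
    (h : AEStronglyMeasurable (Function.uncurry z) ((volI m).prod (volCell m))) (j : Fin m → ℤ) :
    AEStronglyMeasurable (fun α => coeff α (z α) j) (volI m) := by
  simp_rw [coeff_eq]
  refine AEStronglyMeasurable.const_mul ?_ _
  refine AEStronglyMeasurable.integral_prod_right'
    (f := fun p : Hor m × Hor m => z p.1 p.2 * expo (p.1 + lat j) p.2) (h.mul ?_)
  exact (continuous_expo.comp (f := fun p : Hor m × Hor m => (p.1 + lat j, p.2))
    (by fun_prop)).aestronglyMeasurable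

lemma IsField.memLp_volCell {z : Hor m → Hor m → ℂ}
    (h : IsField volume (horShift (2 * Real.pi)) (horIdx (2 * Real.pi)) z) :
    MemLp (Function.uncurry z) 2 ((volI m).prod (volCell m)) := by
  rw [← cellMeasure_twoPi]; exact h.memLp

/-- The fibre coefficients of the Bloch transform are values of the Fourier transform: the case of
Schwartz functions. -/
lemma coeff_eq_fourierHat_schwartz (g : SchwartzMap (Hor m) ℂ) {z : Hor m → Hor m → ℂ}
    (h : HorBT (g : Hor m → ℂ) z) :
    ∀ᵐ α ∂(volI m), ∀ j, coeff α (z α) j = fourierHat g (-(α + lat j)) := by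
  obtain ⟨s, hsm, hs, hgs, hg⟩ := fourierHat_schwartz g
  filter_upwards [ae_neg_lattice hgs, Measure.ae_ae_of_ae_prod (h.eq_blochSynth hsm hs hg),
    (integral_neg_lattice hs).2.1] with α h1 h2 h3 j
  rw [h1 j, coeff_congr α (τ := z α) (σ := blochSynth s α) (ae_restrict_of_ae h2)]
  exact coeff_fiberSeries α h3 j

/-- The Fourier coefficients of the fibres of the boundary Bloch transform of `t` are the values
of the Fourier transform of `t` at the points `-(α + j)`. -/
theorem IsBT.coeff_eq_fourierHat {t : Hor m → ℂ} {z : Hor m → Hor m → ℂ} (h : HorBT t z) :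
    ∀ᵐ α ∂(volI m), ∀ j, coeff α (z α) j = fourierHat t (-(α + lat j)) := by
  rw [ae_all_iff]
  intro j
  have ht := h.memLp isTiling_twoPi
  have hmeas : ∀ f : Hor m → ℂ, AEStronglyMeasurable (fun α => fourierHat f (-(α + lat j))) (volI m) :=
    fun f => ((measurable_fourierHat f).comp (by fun_prop)).aestronglyMeasurable
  have hz := h.field.memLp_volCell
  have hDm : AEStronglyMeasurable
      (fun α => coeff α (z α) j - fourierHat t (-(α + lat j))) (volI m) :=
    (aestronglyMeasurable_coeff hz.1 j).sub (hmeas t)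
  have key : ∀ ε : ℝ, 0 < ε →
      eLpNorm (fun α => coeff α (z α) j - fourierHat t (-(α + lat j))) 2 (volI m)
        ≤ ENNReal.ofReal ε + ENNReal.ofReal ε := by
    intro ε hε
    obtain ⟨g, hg⟩ : ∃ g : SchwartzMap (Hor m) ℂ,
        eLpNorm (fun y => t y - g y) 2 volume ≤ ENNReal.ofReal ε := by
      obtain ⟨g, hg₁, hg₂, hg₃⟩ :=
        MemLp.exist_eLpNorm_sub_le ENNReal.ofNat_ne_top one_le_two ht hε
      exact ⟨hg₁.toSchwartzMap hg₂, hg₃⟩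
    obtain ⟨zg, hzg, -⟩ := exists_isBT isTiling_twoPi (g.memLp 2 (μ := volume))
    have hsub := h.sub isTiling_twoPi hzg
    have hzg2 := hzg.field.memLp_volCell
    have hs2 := hsub.field.memLp_volCell
    have hgm : MemLp (g : Hor m → ℂ) 2 volume := g.memLp 2
    -- the coefficient part, by Bessel's inequality on the fibres and the isometry property
    have b1 : eLpNorm (fun α => coeff α (fun y => z α y - zg α y) j) 2 (volI m)
        ≤ ENNReal.ofReal ε := by
      refine le_trans ?_ hg
      rw [← ENNReal.pow_le_pow_left_iff two_ne_zero, eLpNorm_two_sq, eLpNorm_two_sq,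
        hsub.lintegral_sq isTiling_twoPi, cellMeasure_twoPi,
        lintegral_prod (fun p : Hor m × Hor m => ‖z p.1 p.2 - zg p.1 p.2‖ₑ ^ 2)
          (hs2.1.enorm.pow_const 2)]
      refine lintegral_mono_ae ?_
      filter_upwards [memLp_two_prod_right hs2] with α hα
      have := tsum_enorm_coeff α hα
      simp only [Function.uncurry] at this
      rw [← this]
      exact ENNReal.le_tsum j
    -- the Fourier part, by Plancherel
    have b2 : eLpNorm (fun α => fourierHat (fun y => t y - g y) (-(α + lat j))) 2 (volI m)
        ≤ ENNReal.ofReal ε := by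
      refine le_trans ?_ hg
      rw [← ENNReal.pow_le_pow_left_iff two_ne_zero, eLpNorm_two_sq, eLpNorm_two_sq,
        ← lintegral_fourierHat (τ := fun y => t y - g y) (ht.sub hgm),
        lintegral_neg_lattice ((measurable_fourierHat _).enorm.pow_const 2).aemeasurable]
      exact lintegral_mono fun α =>
        ENNReal.le_tsum (f := fun j => ‖fourierHat (fun y => t y - g y) (-(α + lat j))‖ₑ ^ 2) j
    have e : (fun α => coeff α (z α) j - fourierHat t (-(α + lat j))) =ᵐ[volI m]
        (fun α => coeff α (fun y => z α y - zg α y) j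
          - fourierHat (fun y => t y - g y) (-(α + lat j))) := by
      filter_upwards [memLp_two_prod_right hz, memLp_two_prod_right hzg2,
        coeff_eq_fourierHat_schwartz g hzg, ae_neg_lattice (fourierHat_sub ht hgm)]
        with α c1 c2 c3 c4
      rw [coeff_sub α (τ := z α) (σ := zg α) (c1.integrable one_le_two)
        (c2.integrable one_le_two), c3 j, c4 j]
      ring
    rw [eLpNorm_congr_ae e]
    refine (eLpNorm_sub_le (aestronglyMeasurable_coeff hs2.1 j) (hmeas _)
      one_le_two).trans (add_le_add b1 b2)
  have h0 : eLpNorm (fun α => coeff α (z α) j - fourierHat t (-(α + lat j))) 2 (volI m) = 0 := by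
    refine le_antisymm (ENNReal.le_of_forall_pos_le_add fun ε hε _ => ?_) zero_le
    refine (key (ε / 2) (by positivity)).trans (le_of_eq ?_)
    rw [← ENNReal.ofReal_add (by positivity) (by positivity), add_halves, zero_add,
      ENNReal.ofReal_coe_nnreal]
  rw [eLpNorm_eq_zero_iff hDm two_ne_zero] at h0
  filter_upwards [h0] with α hα
  exact sub_eq_zero.1 hα

/-! ### Weak relations and their fibres -/

/-- A property that holds almost surely for each parameter holds almost surely for all
parameters, provided that it is closed in a second countable space through which the parameters
enter. -/
lemma ae_forall_of_forall_ae {Ω A M : Type*} [MeasurableSpace Ω] {P : Measure Ω}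
    [TopologicalSpace M] [SecondCountableTopology M] (p : A → M) (Ψ : Ω → M → ℂ)
    (hΨ : ∀ᵐ o ∂P, Continuous (Ψ o)) (h : ∀ a, ∀ᵐ o ∂P, Ψ o (p a) = 0) :
    ∀ᵐ o ∂P, ∀ a, Ψ o (p a) = 0 := by
  obtain ⟨S, hS, hd⟩ := TopologicalSpace.exists_countable_dense (Set.range p)
  have h1 : ∀ᵐ o ∂P, ∀ x ∈ S, Ψ o (x : M) = 0 := by
    rw [ae_ball_iff hS]
    rintro ⟨_, a, rfl⟩ -
    exact h a
  filter_upwards [hΨ, h1] with o hc hz a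
  have hcl : IsClosed {x : Set.range p | Ψ o x = 0} :=
    isClosed_eq (hc.comp continuous_subtype_val) continuous_const
  have hsub : closure S ⊆ {x : Set.range p | Ψ o x = 0} := hcl.closure_subset_iff.2 hz
  exact hsub (hd ⟨p a, a, rfl⟩)

section Relations

variable {X : Type*} [MeasurableSpace X]

/-- `f` is square integrable over every finite union of tiles. -/
def LocSq (μ : Measure X) (κ : X → Fin m → ℤ) (f : X → ℂ) : Prop :=
  ∀ B : Finset (Fin m → ℤ), MemLp f 2 (μ.restrict (κ ⁻¹' B))

/-- `ψ` is square integrable and vanishes outside the tiles with index in `B`. -/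
structure IsTileTest (μ : Measure X) (κ : X → Fin m → ℤ) (B : Finset (Fin m → ℤ)) (ψ : X → ℂ) :
    Prop where
  memLp : MemLp ψ 2 μ
  supp : ∀ x, κ x ∉ B → ψ x = 0

variable {μ : Measure X} {s : (Fin m → ℤ) → X → X} {κ : X → Fin m → ℤ}

lemma _root_.MeasureTheory.MemLp.locSq {f : X → ℂ} (hf : MemLp f 2 μ) (κ : X → Fin m → ℤ) :
    LocSq μ κ f := fun _ => hf.restrict _

lemma LocSq.integrable_mul {f ψ : X → ℂ} (hf : LocSq μ κ f)
    {B : Finset (Fin m → ℤ)} (hψ : IsTileTest μ κ B ψ) : Integrable (fun x => f x * ψ x) μ := by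
  have h1 : IntegrableOn (fun x => f x * ψ x) (κ ⁻¹' B) μ :=
    (hf B).integrable_mul (p := 2) (q := 2) (hψ.memLp.restrict _)
  exact h1.integrable_of_forall_notMem_eq_zero fun x hx => by rw [hψ.supp x hx, mul_zero]

lemma LocSq.integral_mul {f ψ : X → ℂ} {B : Finset (Fin m → ℤ)} (hψ : IsTileTest μ κ B ψ) :
    ∫ x, f x * ψ x ∂μ = ∫ x in κ ⁻¹' B, f x * ψ x ∂μ :=
  (setIntegral_eq_integral_of_forall_compl_eq_zero fun x hx => by
    rw [hψ.supp x hx, mul_zero]).symm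

lemma LocSq.continuous_pairing {f : X → ℂ} (hκ : Measurable κ) (hf : LocSq μ κ f)
    (B : Finset (Fin m → ℤ)) :
    Continuous fun p : Lp ℂ 2 μ => ∫ x in κ ⁻¹' B, f x * p x ∂μ := by
  have hB : MeasurableSet (κ ⁻¹' (B : Set (Fin m → ℤ))) := hκ B.measurableSet
  have h1 : MemLp (fun x => conj ((κ ⁻¹' (B : Set (Fin m → ℤ))).indicator f x)) 2 μ :=
    ((memLp_indicator_iff_restrict hB).2 (hf B)).star
  have e : (fun p : Lp ℂ 2 μ => ∫ x in κ ⁻¹' B, f x * p x ∂μ)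
      = fun p => inner ℂ h1.toLp p := by
    ext p
    rw [L2.inner_def, ← integral_indicator hB]
    refine integral_congr_ae ?_
    filter_upwards [h1.coeFn_toLp] with x hx
    rw [hx, RCLike.inner_apply, Complex.conj_conj, mul_comm]
    by_cases hxB : x ∈ κ ⁻¹' (B : Set (Fin m → ℤ)) <;> simp [hxB]
  rw [e]
  exact continuous_const.inner continuous_id

lemma IsField.ae_locSq [SFinite μ] (T : IsTiling μ s κ) {w : Hor m → X → ℂ}
    (h : IsField μ s κ w) : ∀ᵐ α ∂(volI m), LocSq μ κ (w α) :=
  ae_all_iff.2 fun B => memLp_two_prod_right (h.memLp_tiles T B)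

variable {Y : Type*} [MeasurableSpace Y] {ν : Measure Y} {r : (Fin m → ℤ) → Y → Y}
  {ι : Y → Fin m → ℤ}

/-- A family of linear relations `∫ (g ψ₁ + u ψ₂) dμ = ∫ t ψ₃ dν`, with test functions that form a
translation invariant family, holds for `(u, g, t)` if and only if it holds for almost every fibre
of the Bloch transforms. -/
theorem relation_iff_ae [SFinite μ] [SFinite ν] [MeasurableSpace.CountablyGenerated X]
    [MeasurableSpace.CountablyGenerated Y] (T : IsTiling μ s κ) (T' : IsTiling ν r ι)
    {u g : X → ℂ} {t : Y → ℂ} {w W : Hor m → X → ℂ} {z : Hor m → Y → ℂ}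
    (hu : IsBT μ s κ u w) (hg : IsBT μ s κ g W) (ht : IsBT ν r ι t z)
    {A : Type*} (ψ₁ ψ₂ : A → X → ℂ) (ψ₃ : A → Y → ℂ)
    (hψ : ∀ a, ∃ B, IsTileTest μ κ B (ψ₁ a) ∧ IsTileTest μ κ B (ψ₂ a) ∧ IsTileTest ν ι B (ψ₃ a))
    (hs : ∀ a j, ∃ a', (∀ x, ψ₁ a' (s j x) = ψ₁ a x) ∧ (∀ x, ψ₂ a' (s j x) = ψ₂ a x) ∧
      ∀ y, ψ₃ a' (r j y) = ψ₃ a y) :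
    (∀ a, ∫ x, (g x * ψ₁ a x + u x * ψ₂ a x) ∂μ = ∫ y, t y * ψ₃ a y ∂ν) ↔
      ∀ᵐ α ∂(volI m), ∀ a,
        ∫ x, (W α x * ψ₁ a x + w α x * ψ₂ a x) ∂μ = ∫ y, z α y * ψ₃ a y ∂ν := by
  have hloc := hu.field.ae_locSq T
  have hloc' := hg.field.ae_locSq T
  have hloc'' := ht.field.ae_locSq T'
  have hsplit : ∀ a, ∀ᵐ α ∂(volI m), ∫ x, (W α x * ψ₁ a x + w α x * ψ₂ a x) ∂μ
      = ∫ x, W α x * ψ₁ a x ∂μ + ∫ x, w α x * ψ₂ a x ∂μ := by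
    intro a
    obtain ⟨B, h1, h2, h3⟩ := hψ a
    filter_upwards [hloc, hloc'] with α hα hα'
    exact integral_add (hα'.integrable_mul h1) (hα.integrable_mul h2)
  -- The `j`-th Fourier coefficient in `α` of the defect of the fibre relation is the defect of the
  -- global relation for the test function translated by `j`.
  have hcoef : ∀ a j, ∫ α, (∫ x, W α x * ψ₁ a x ∂μ + ∫ x, w α x * ψ₂ a x ∂μ
        - ∫ y, z α y * ψ₃ a y ∂ν) * qpFactor α j ∂(volI m)
      = ∫ x, (g (s j x) * ψ₁ a x + u (s j x) * ψ₂ a x) ∂μ - ∫ y, t (r j y) * ψ₃ a y ∂ν := by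
    intro a j
    obtain ⟨B, h1, h2, h3⟩ := hψ a
    obtain ⟨i1, c1⟩ := hg.pairing T h1.memLp h1.supp
    obtain ⟨i2, c2⟩ := hu.pairing T h2.memLp h2.supp
    obtain ⟨i3, c3⟩ := ht.pairing T' h3.memLp h3.supp
    have j1 : Integrable (fun α => (∫ x, W α x * ψ₁ a x ∂μ) * qpFactor α j) (volI m) :=
      integrable_mul_qpFactor i1.integral_prod_left j
    have j2 : Integrable (fun α => (∫ x, w α x * ψ₂ a x ∂μ) * qpFactor α j) (volI m) :=
      integrable_mul_qpFactor i2.integral_prod_left j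
    have j3 : Integrable (fun α => (∫ y, z α y * ψ₃ a y ∂ν) * qpFactor α j) (volI m) :=
      integrable_mul_qpFactor i3.integral_prod_left j
    have j12 : Integrable (fun α => (∫ x, W α x * ψ₁ a x ∂μ) * qpFactor α j
        + (∫ x, w α x * ψ₂ a x ∂μ) * qpFactor α j) (volI m) := j1.add j2
    simp only [sub_mul, add_mul]
    rw [integral_sub j12 j3, integral_add j1 j2, c1, c2, c3, integral_add]
    · exact LocSq.integrable_mul
        (((hg.memLp T).comp_measurePreserving (T.mp j)).locSq κ) h1
    · exact LocSq.integrable_mul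
        (((hu.memLp T).comp_measurePreserving (T.mp j)).locSq κ) h2
  constructor
  · intro h
    -- For a single test function all Fourier coefficients in `α` vanish.
    have hae : ∀ a, ∀ᵐ α ∂(volI m), ∫ x, W α x * ψ₁ a x ∂μ + ∫ x, w α x * ψ₂ a x ∂μ
        - ∫ y, z α y * ψ₃ a y ∂ν = 0 := by
      intro a
      obtain ⟨B, h1, h2, h3⟩ := hψ a
      obtain ⟨i1, -⟩ := hg.pairing T h1.memLp h1.supp
      obtain ⟨i2, -⟩ := hu.pairing T h2.memLp h2.supp
      obtain ⟨i3, -⟩ := ht.pairing T' h3.memLp h3.supp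
      have k1 : Integrable (fun α => ∫ x, W α x * ψ₁ a x ∂μ) (volI m) := i1.integral_prod_left
      have k2 : Integrable (fun α => ∫ x, w α x * ψ₂ a x ∂μ) (volI m) := i2.integral_prod_left
      have k3 : Integrable (fun α => ∫ y, z α y * ψ₃ a y ∂ν) (volI m) := i3.integral_prod_left
      refine ae_eq_zero_of_fourier_brillouin ((k1.add k2).sub k3) fun j => ?_
      refine (hcoef a j).trans ?_
      obtain ⟨a', e1, e2, e3⟩ := hs a j
      rw [sub_eq_zero]
      have := h a'
      rw [← (T.mp j).integral_comp (T.emb j), ← (T'.mp j).integral_comp (T'.emb j)] at this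
      simpa only [e1, e2, e3] using this
    -- The null set can be chosen uniformly among the tests supported in a given set of tiles.
    have hB : ∀ B : Finset (Fin m → ℤ), ∀ᵐ α ∂(volI m), ∀ a : {a : A // IsTileTest μ κ B (ψ₁ a) ∧
        IsTileTest μ κ B (ψ₂ a) ∧ IsTileTest ν ι B (ψ₃ a)},
        ∫ x, W α x * ψ₁ a x ∂μ + ∫ x, w α x * ψ₂ a x ∂μ - ∫ y, z α y * ψ₃ a y ∂ν = 0 := by
      intro B
      have e : ∀ α, ∀ a : {a : A // IsTileTest μ κ B (ψ₁ a) ∧ IsTileTest μ κ B (ψ₂ a) ∧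
          IsTileTest ν ι B (ψ₃ a)},
          ∫ x in κ ⁻¹' B, W α x * a.2.1.memLp.toLp (ψ₁ a) x ∂μ
            + ∫ x in κ ⁻¹' B, w α x * a.2.2.1.memLp.toLp (ψ₂ a) x ∂μ
            - ∫ y in ι ⁻¹' B, z α y * a.2.2.2.memLp.toLp (ψ₃ a) y ∂ν
          = ∫ x, W α x * ψ₁ a x ∂μ + ∫ x, w α x * ψ₂ a x ∂μ - ∫ y, z α y * ψ₃ a y ∂ν := by
        intro α a
        rw [LocSq.integral_mul a.2.1, LocSq.integral_mul a.2.2.1, LocSq.integral_mul a.2.2.2]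
        have q1 : ∫ x in κ ⁻¹' B, W α x * a.2.1.memLp.toLp (ψ₁ a) x ∂μ
            = ∫ x in κ ⁻¹' B, W α x * ψ₁ a x ∂μ := by
          refine integral_congr_ae ?_
          filter_upwards [ae_restrict_of_ae a.2.1.memLp.coeFn_toLp] with x hx
          rw [hx]
        have q2 : ∫ x in κ ⁻¹' B, w α x * a.2.2.1.memLp.toLp (ψ₂ a) x ∂μ
            = ∫ x in κ ⁻¹' B, w α x * ψ₂ a x ∂μ := by
          refine integral_congr_ae ?_
          filter_upwards [ae_restrict_of_ae a.2.2.1.memLp.coeFn_toLp] with x hx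
          rw [hx]
        have q3 : ∫ y in ι ⁻¹' B, z α y * a.2.2.2.memLp.toLp (ψ₃ a) y ∂ν
            = ∫ y in ι ⁻¹' B, z α y * ψ₃ a y ∂ν := by
          refine integral_congr_ae ?_
          filter_upwards [ae_restrict_of_ae a.2.2.2.memLp.coeFn_toLp] with x hx
          rw [hx]
        rw [q1, q2, q3]
      have : Fact ((2 : ℝ≥0∞) ≠ ⊤) := ⟨ENNReal.ofNat_ne_top⟩
      have := ae_forall_of_forall_ae (P := volI m)
        (p := fun a : {a : A // IsTileTest μ κ B (ψ₁ a) ∧ IsTileTest μ κ B (ψ₂ a) ∧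
          IsTileTest ν ι B (ψ₃ a)} =>
          (a.2.1.memLp.toLp (ψ₁ a), a.2.2.1.memLp.toLp (ψ₂ a), a.2.2.2.memLp.toLp (ψ₃ a)))
        (Ψ := fun α (q : Lp ℂ 2 μ × Lp ℂ 2 μ × Lp ℂ 2 ν) =>
          ∫ x in κ ⁻¹' B, W α x * q.1 x ∂μ + ∫ x in κ ⁻¹' B, w α x * q.2.1 x ∂μ
            - ∫ y in ι ⁻¹' B, z α y * q.2.2 y ∂ν) ?_ ?_
      · filter_upwards [this] with α hα a
        rw [← e]; exact hα a
      · filter_upwards [hloc, hloc', hloc''] with α c1 c2 c3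
        exact (((c2.continuous_pairing T.meas B).comp continuous_fst).add
          ((c1.continuous_pairing T.meas B).comp (continuous_fst.comp continuous_snd))).sub
          ((c3.continuous_pairing T'.meas B).comp (continuous_snd.comp continuous_snd))
      · intro a
        filter_upwards [hae a] with α hα
        rw [← hα, ← e]
    filter_upwards [ae_all_iff.2 hB, hloc, hloc'] with α hα c1 c2 a
    obtain ⟨B, h1, h2, h3⟩ := hψ a
    rw [integral_add (c2.integrable_mul h1) (c1.integrable_mul h2)]
    exact sub_eq_zero.1 (hα B ⟨a, h1, h2, h3⟩)
  · intro h a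
    have h0 := hcoef a 0
    simp only [T.zero, T'.zero, qpFactor_zero, mul_one] at h0
    rw [← sub_eq_zero, ← h0]
    refine integral_eq_zero_of_ae ?_
    filter_upwards [h, hsplit a] with α hα hsp
    rw [← hsp, hα a, sub_self]
    rfl

end Relations

/-! ### Weak derivatives and traces of the fibres -/

lemma shift_eq_add (j : Fin m → ℤ) (x : Pt m) :
    shift j x = x + ((2 * Real.pi) • lat j, (0 : ℝ)) := by
  ext <;> simp [shift]

lemma shift_neg_shift (j : Fin m → ℤ) (x : Pt m) : shift (-j) (shift j x) = x := by
  have T := isTiling_strip (m := m) 1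
  rw [T.add, neg_add_cancel, T.zero]

lemma fderiv_comp_shift (φ : Pt m → ℂ) (j : Fin m → ℤ) (x : Pt m) :
    fderiv ℝ (fun x => φ (shift j x)) x = fderiv ℝ φ (shift j x) := by
  simp only [shift_eq_add]
  exact fderiv_comp_add_right _

lemma IsTest.comp_shift {U : Set (Pt m)} (hU : ∀ j x, shift j x ∈ U → x ∈ U) {φ : Pt m → ℂ}
    (h : IsTest U φ) (j : Fin m → ℤ) : IsTest U (fun x => φ (shift j x)) := by
  have e : (fun x => φ (shift j x))
      = φ ∘ Homeomorph.addRight (((2 * Real.pi) • lat j, (0 : ℝ)) : Pt m) := by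
    ext x; simp [shift_eq_add]
  refine ⟨?_, ?_, ?_⟩
  · simp only [shift_eq_add]
    exact h.smooth.comp (contDiff_id.add contDiff_const)
  · rw [e]; exact h.compact.comp_homeomorph _
  · rw [e, tsupport_comp_eq_preimage]
    intro x hx
    refine hU j x (h.supp ?_)
    rw [shift_eq_add]; exact hx

/-- A compact set meets finitely many translates of the periodicity cell. -/
lemma exists_finset_stripIdx {K : Set (Pt m)} (hK : IsCompact K) :
    ∃ B : Finset (Fin m → ℤ), ∀ x ∈ K, stripIdx x ∈ B := by
  obtain ⟨C, hC⟩ := (hK.image continuous_fst).isBounded.exists_norm_le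
  refine ⟨Fintype.piFinset fun _ => Finset.Icc ⌊-C / (2 * Real.pi) + 1 / 2⌋
    ⌊C / (2 * Real.pi) + 1 / 2⌋, fun x hx => ?_⟩
  rw [Fintype.mem_piFinset]
  intro i
  have h1 : |x.1 i| ≤ C := (PiLp.norm_apply_le x.1 i).trans (hC _ ⟨x, hx, rfl⟩)
  obtain ⟨h2, h3⟩ := abs_le.1 h1
  have hp := Real.two_pi_pos
  rw [Finset.mem_Icc]
  constructor <;> refine Int.floor_le_floor ?_ <;> gcongr

lemma IsTest.continuous_fderiv {U : Set (Pt m)} {φ : Pt m → ℂ} (h : IsTest U φ) (v : Pt m) :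
    Continuous fun x => fderiv ℝ φ x v :=
  (h.smooth.continuous_fderiv (by simp)).clm_apply continuous_const

lemma IsTest.compact_fderiv {U : Set (Pt m)} {φ : Pt m → ℂ} (h : IsTest U φ) (v : Pt m) :
    HasCompactSupport fun x => fderiv ℝ φ x v := h.compact.fderiv_apply ℝ v

lemma isClosedEmbedding_slice (R : ℝ) : IsClosedEmbedding fun y : Hor m => ((y, R) : Pt m) := by
  refine Topology.IsClosedEmbedding.of_continuous_injective_isClosedMap (by fun_prop)
    (fun a b h => (Prod.ext_iff.1 h).1) fun K hK => ?_
  have : (fun y : Hor m => ((y, R) : Pt m)) '' K = K ×ˢ {R} := by ext; aesop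
  rw [this]
  exact hK.prod isClosed_singleton

/-- A test function, its derivatives and its boundary values are supported in finitely many
tiles. -/
lemma IsTest.exists_isTileTest {U : Set (Pt m)} {φ : Pt m → ℂ} (h : IsTest U φ) (R : ℝ)
    (v : Pt m) : ∃ B, IsTileTest (volStrip m R) stripIdx B φ ∧
      IsTileTest (volStrip m R) stripIdx B (fun x => fderiv ℝ φ x v) ∧
      IsTileTest volume (horIdx (2 * Real.pi)) B (fun y => φ (y, R)) := by
  obtain ⟨B, hB⟩ := exists_finset_stripIdx h.compact
  have h0 : ∀ x, stripIdx x ∉ B → φ x = 0 := fun x hx => by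
    by_contra hne
    exact hx (hB x (subset_tsupport φ hne))
  refine ⟨B, ⟨?_, h0⟩, ⟨?_, fun x hx => ?_⟩, ⟨?_, fun y hy => h0 (y, R) hy⟩⟩
  · exact (h.smooth.continuous.memLp_of_hasCompactSupport h.compact).restrict _
  · exact ((h.continuous_fderiv v).memLp_of_hasCompactSupport (h.compact_fderiv v)).restrict _
  · by_contra hne
    refine hx (hB x (support_fderiv_subset ℝ (f := φ) ?_))
    intro h1
    simp [h1] at hne
  · exact (h.smooth.continuous.comp (by fun_prop)).memLp_of_hasCompactSupport
      (h.compact.comp_isClosedEmbedding (isClosedEmbedding_slice R))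

/-- Green's formula in a horizontally invariant set holds for `u` if and only if it holds for
almost all fibres of its Bloch transform. -/
theorem green_iff_ae {R : ℝ} {U : Set (Pt m)} (hU : ∀ j x, shift j x ∈ U → x ∈ U) (v : Pt m)
    {u g : Pt m → ℂ} {t : Hor m → ℂ} {w W : Hor m → Pt m → ℂ} {z : Hor m → Hor m → ℂ}
    (hu : StripBT R u w) (hg : StripBT R g W) (ht : HorBT t z) :
    (∀ φ : Pt m → ℂ, IsTest U φ →
      ∫ x in strip m R, (g x * φ x + u x * fderiv ℝ φ x v) = ∫ y, t y * φ (y, R)) ↔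
    ∀ᵐ α ∂(volI m), ∀ φ : Pt m → ℂ, IsTest U φ →
      ∫ x in strip m R, (W α x * φ x + w α x * fderiv ℝ φ x v) = ∫ y, z α y * φ (y, R) := by
  have := relation_iff_ae (isTiling_strip R) isTiling_twoPi hu hg ht
    (A := {φ : Pt m → ℂ // IsTest U φ}) (fun a => a.1) (fun a x => fderiv ℝ a.1 x v)
    (fun a y => a.1 (y, R)) (fun a => a.2.exists_isTileTest R v) (fun a j => by
      refine ⟨⟨fun x => a.1 (shift (-j) x), a.2.comp_shift hU (-j)⟩, fun x => ?_, fun x => ?_,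
        fun y => ?_⟩
      · simp only [shift_neg_shift]
      · simp only [fderiv_comp_shift, shift_neg_shift]
      · exact congrArg a.1 (shift_neg_shift j (y, R)))
  simpa only [Subtype.forall] using this

/-- The zero function serves as boundary data in relations without a boundary term. -/
lemma isBT_zero {X : Type*} [MeasurableSpace X] {μ : Measure X} {s : (Fin m → ℤ) → X → X}
    {κ : X → Fin m → ℤ} : IsBT μ s κ (fun _ => 0) (fun _ _ => 0) :=
  ⟨⟨aestronglyMeasurable_const, fun j => Eventually.of_forall fun p => by simp, MemLp.zero⟩,
    Eventually.of_forall fun x => by simp⟩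

lemma shift_mem_strip {R : ℝ} (j : Fin m → ℤ) (x : Pt m) (h : shift j x ∈ strip m R) :
    x ∈ strip m R := h

lemma isWeakPartial_iff {R : ℝ} (i : Dir m) {u g : Pt m → ℂ}
    (hu : LocSq (volStrip m R) stripIdx u) (hg : LocSq (volStrip m R) stripIdx g) :
    IsWeakPartial R i u g ↔ ∀ φ : Pt m → ℂ, IsTest (strip m R) φ →
      ∫ x in strip m R, (g x * φ x + u x * fderiv ℝ φ x (dirVec i)) = 0 := by
  refine forall₂_congr fun φ hφ => ?_
  obtain ⟨B, h1, h2, -⟩ := hφ.exists_isTileTest R (dirVec i)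
  rw [integral_add (hg.integrable_mul h1) (hu.integrable_mul h2), add_comm, eq_neg_iff_add_eq_zero]

theorem isWeakPartial_iff_ae {R : ℝ} (i : Dir m) {u g : Pt m → ℂ} {w W : Hor m → Pt m → ℂ}
    (hu : StripBT R u w) (hg : StripBT R g W) :
    IsWeakPartial R i u g ↔ ∀ᵐ α ∂(volI m), IsWeakPartial R i (w α) (W α) := by
  have T := isTiling_strip (m := m) R
  rw [isWeakPartial_iff i ((hu.memLp T).locSq _) ((hg.memLp T).locSq _)]
  have h := green_iff_ae (shift_mem_strip (R := R)) (dirVec i) hu hg isBT_zero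
  simp only [zero_mul, integral_zero] at h
  rw [h]
  refine ⟨fun h => ?_, fun h => ?_⟩
  · filter_upwards [h, hu.field.ae_locSq T, hg.field.ae_locSq T] with α h1 h2 h3
    exact (isWeakPartial_iff i h2 h3).2 h1
  · filter_upwards [h, hu.field.ae_locSq T, hg.field.ae_locSq T] with α h1 h2 h3
    exact (isWeakPartial_iff i h2 h3).1 h1

theorem hasZeroLowerTrace_iff_ae {R : ℝ} {u g : Pt m → ℂ} {w W : Hor m → Pt m → ℂ}
    (hu : StripBT R u w) (hg : StripBT R g W) :
    HasZeroLowerTrace R u g ↔ ∀ᵐ α ∂(volI m), HasZeroLowerTrace R (w α) (W α) := by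
  have h := green_iff_ae (R := R) (U := {x : Pt m | x.2 < R}) (fun _ _ h => h) (dirVec vert) hu hg
    isBT_zero
  simp only [zero_mul, integral_zero] at h
  exact h

theorem hasUpperTrace_iff_ae {R : ℝ} {u g : Pt m → ℂ} {t : Hor m → ℂ} {w W : Hor m → Pt m → ℂ}
    {z : Hor m → Hor m → ℂ} (hu : StripBT R u w) (hg : StripBT R g W) (ht : HorBT t z) :
    HasUpperTrace R u g t ↔ ∀ᵐ α ∂(volI m), HasUpperTrace R (w α) (W α) (z α) :=
  green_iff_ae (R := R) (U := {x : Pt m | 0 < x.2}) (fun _ _ h => h) (dirVec vert) hu hg ht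

/-- `u ∈ H̃¹(Ω^R)` with gradient `G` if and only if the Bloch transform is in
`L²(I; H̃¹_α(Ω_0^R))`, its gradient being the transform of `G`. -/
theorem isH1_iff {R : ℝ} {u : Pt m → ℂ} {G : Dir m → Pt m → ℂ} {w : Hor m → Pt m → ℂ}
    {W : Hor m → Dir m → Pt m → ℂ} (hu : StripBT R u w)
    (hG : ∀ i, StripBT R (G i) (fun α x => W α i x)) : IsH1 R u G ↔ IsL2H1 R w W := by
  have T := isTiling_strip (m := m) R
  have slice : ∀ {v : Hor m → Pt m → ℂ}, IsField (volStrip m R) shift stripIdx v →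
      MemLp (Function.uncurry v) 2 ((volI m).prod (volume.restrict (cellStrip m R))) :=
    fun h => by rw [← cellMeasure_strip]; exact h.memLp
  constructor
  · intro h
    refine ⟨hu.field.meas, slice hu.field, fun i => (hG i).field.meas,
      fun i => slice (hG i).field, ?_⟩
    have a1 := ae_all_iff.2 fun i => (hG i).field.meas.prodMk_left
    have a2 := ae_all_iff.2 fun i => (hG i).field.ae_isQP
    have a3 := ae_all_iff.2 fun i => memLp_two_prod_right (slice (hG i).field)
    have a4 := ae_all_iff.2 fun i => (isWeakPartial_iff_ae i hu (hG i)).1 (h.weak i)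
    filter_upwards [hu.field.meas.prodMk_left, hu.field.ae_isQP,
      memLp_two_prod_right (slice hu.field), a1, a2, a3, a4,
      (hasZeroLowerTrace_iff_ae hu (hG vert)).1 h.lower] with α b1 b2 b3 b4 b5 b6 b7 b8
    exact ⟨b1, b2, b3, b4, b5, b6, b7, b8⟩
  · intro h
    refine ⟨hu.memLp T, fun i => (hG i).memLp T, fun i => ?_, ?_⟩
    · exact (isWeakPartial_iff_ae i hu (hG i)).2 (h.fiber.mono fun α hα => hα.weak i)
    · exact (hasZeroLowerTrace_iff_ae hu (hG vert)).2 (h.fiber.mono fun α hα => hα.lower)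

/-- Quasi-periodicity may be tested fibre by fibre, as both sides are measurable in `(α, x)`. -/
lemma isField_of_fiber {R : ℝ} {w : Hor m → Pt m → ℂ}
    (h1 : AEStronglyMeasurable (Function.uncurry w) ((volI m).prod (volStrip m R)))
    (h2 : MemLp (Function.uncurry w) 2 ((volI m).prod (volume.restrict (cellStrip m R))))
    (h3 : ∀ᵐ α ∂(volI m), IsQP R α (w α)) : IsField (volStrip m R) shift stripIdx w where
  meas := h1
  qp j := by
    refine ae_prod_eq_of_ae_ae (f := fun p : Hor m × Pt m => w p.1 (shift j p.2))
      (g := fun p : Hor m × Pt m => qpFactor p.1 j * w p.1 p.2)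
      (h1.comp_measurePreserving (((isTiling_strip R).prod (volI m)).mp j)) ?_ ?_
    · exact ((continuous_qpFactor j).measurable.comp measurable_fst).aestronglyMeasurable.mul h1
    · filter_upwards [h3] with α hα
      exact hα j
  memLp := by rw [cellMeasure_strip]; exact h2

lemma IsL2H1.isField {R : ℝ} {w : Hor m → Pt m → ℂ} {W : Hor m → Dir m → Pt m → ℂ}
    (h : IsL2H1 R w W) : IsField (volStrip m R) shift stripIdx w :=
  isField_of_fiber h.meas h.memLp (h.fiber.mono fun _ hα => hα.qp)

lemma IsL2H1.isField_grad {R : ℝ} {w : Hor m → Pt m → ℂ} {W : Hor m → Dir m → Pt m → ℂ}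
    (h : IsL2H1 R w W) (i : Dir m) :
    IsField (volStrip m R) shift stripIdx (fun α x => W α i x) :=
  isField_of_fiber (h.grad_meas i) (h.grad_memLp i) (h.fiber.mono fun _ hα => hα.grad_qp i)

/-! ### The boundary spaces -/

/-- The weight `(1 + |ξ|²)^{1/2}` of `H^{1/2}`. -/
def halfWeight (ξ : Hor m) : ℝ := (1 + ‖ξ‖ ^ 2) ^ (1 / 2 : ℝ)

lemma halfWeight_pos (ξ : Hor m) : 0 < halfWeight ξ := by unfold halfWeight; positivity

lemma one_le_halfWeight (ξ : Hor m) : 1 ≤ halfWeight ξ :=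
  Real.one_le_rpow (by nlinarith [sq_nonneg ‖ξ‖]) (by norm_num)

lemma continuous_halfWeight : Continuous (halfWeight : Hor m → ℝ) := by
  unfold halfWeight
  exact Continuous.rpow_const (by fun_prop) fun ξ => Or.inr (by norm_num)

lemma halfWeight_neg (ξ : Hor m) : halfWeight (-ξ) = halfWeight ξ := by simp [halfWeight]

/-- The `H^{1/2}` norm of `t` in terms of the fibres. -/
lemma lintegral_halfWeight {t : Hor m → ℂ} {z : Hor m → Hor m → ℂ} (ht : HorBT t z) :
    ∫⁻ ξ, ENNReal.ofReal (halfWeight ξ * ‖fourierHat t ξ‖ ^ 2)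
      = ∫⁻ α, ∑' j, ENNReal.ofReal (halfWeight (α + lat j) * ‖coeff α (z α) j‖ ^ 2)
        ∂(volI m) := by
  have hm : Measurable fun ξ : Hor m => ENNReal.ofReal (halfWeight ξ * ‖fourierHat t ξ‖ ^ 2) :=
    (continuous_halfWeight.measurable.mul ((measurable_fourierHat t).norm.pow_const 2)).ennreal_ofReal
  rw [lintegral_neg_lattice hm.aemeasurable]
  refine lintegral_congr_ae ?_
  filter_upwards [ht.coeff_eq_fourierHat] with α hα
  simp_rw [hα, halfWeight_neg]

lemma memHalf_iff {t : Hor m → ℂ} (ht : MemLp t 2 (volume : Measure (Hor m))) : MemHalf t ↔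
    ∫⁻ ξ, ENNReal.ofReal (halfWeight ξ * ‖fourierHat t ξ‖ ^ 2) < ⊤ := by
  have hm : Measurable fun ξ : Hor m => halfWeight ξ * ‖fourierHat t ξ‖ ^ 2 :=
    continuous_halfWeight.measurable.mul ((measurable_fourierHat t).norm.pow_const 2)
  have e : ∀ ξ : Hor m, ‖halfWeight ξ * ‖fourierHat t ξ‖ ^ 2‖ₑ
      = ENNReal.ofReal (halfWeight ξ * ‖fourierHat t ξ‖ ^ 2) := fun ξ =>
    Real.enorm_of_nonneg (mul_nonneg (halfWeight_pos ξ).le (sq_nonneg _))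
  constructor
  · intro h
    simp_rw [← e]
    exact h.weighted.2
  · intro h
    refine ⟨ht, hm.aestronglyMeasurable, ?_⟩
    simp_rw [← e] at h
    exact h

lemma summable_of_tsum_ofReal {ι : Type*} {f : ι → ℝ} (hf : ∀ i, 0 ≤ f i)
    (h : ∑' i, ENNReal.ofReal (f i) ≠ ⊤) : Summable f := by
  have := ENNReal.summable_toReal h
  simpa only [ENNReal.toReal_ofReal (hf _)] using this

/-- `t` is the trace of `u` if and only if its Bloch transform is the field of the traces of the
fibres. The `H^{1/2}` norms agree since the fibre coefficients are values of `t̂`. -/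
theorem isTrace_iff {R : ℝ} {u : Pt m → ℂ} {G : Dir m → Pt m → ℂ} {w : Hor m → Pt m → ℂ}
    {W : Hor m → Dir m → Pt m → ℂ} {t : Hor m → ℂ} {z : Hor m → Hor m → ℂ}
    (hu : StripBT R u w) (hG : StripBT R (G vert) (fun α x => W α vert x)) (ht : HorBT t z) :
    IsTrace R u G t ↔ IsTraceField R w W z := by
  have T := isTiling_twoPi (m := m)
  have hgreen := hasUpperTrace_iff_ae hu hG ht
  constructor
  · intro h
    have hfin := (memHalf_iff (ht.memLp T)).1 h.half
    rw [lintegral_halfWeight ht] at hfin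
    refine ⟨ht.field.meas, ?_, hfin⟩
    have hm : AEMeasurable (fun α => ∑' j, ENNReal.ofReal
        (halfWeight (α + lat j) * ‖coeff α (z α) j‖ ^ 2)) (volI m) := by
      refine AEMeasurable.tsum fun j => AEMeasurable.ennreal_ofReal ?_
      refine AEMeasurable.mul ?_ ?_
      · exact (continuous_halfWeight.comp (continuous_id.add continuous_const)).aemeasurable
      · exact (aestronglyMeasurable_coeff ht.field.memLp_volCell.1 j).norm.aemeasurable.pow_const 2
    filter_upwards [hgreen.1 h.green, ht.field.meas.prodMk_left,
      memLp_two_prod_right ht.field.memLp_volCell, ae_lt_top' hm hfin.ne,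
      ae_all_iff.2 fun j => Measure.ae_ae_of_ae_prod (ht.field.qp j)] with α a1 a2 a3 a4 a5
    refine ⟨⟨a2, a5, a3, ?_⟩, a1⟩
    exact summable_of_tsum_ofReal
      (fun j => mul_nonneg (halfWeight_pos (α + lat j)).le (sq_nonneg _)) a4.ne
  · intro h
    refine ⟨(memHalf_iff (ht.memLp T)).2 ?_, hgreen.2 (h.fiber.mono fun α hα => hα.green)⟩
    rw [lintegral_halfWeight ht]
    exact h.half

lemma IsTraceField.isField {R : ℝ} {w : Hor m → Pt m → ℂ}
    {W : Hor m → Dir m → Pt m → ℂ} {z : Hor m → Hor m → ℂ} (h : IsTraceField R w W z) :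
    IsField volume (horShift (2 * Real.pi)) (horIdx (2 * Real.pi)) z where
  meas := h.meas
  qp j := by
    refine ae_prod_eq_of_ae_ae (f := fun p : Hor m × Hor m => z p.1 (horShift (2 * Real.pi) j p.2))
      (g := fun p : Hor m × Hor m => qpFactor p.1 j * z p.1 p.2)
      (h.meas.comp_measurePreserving ((isTiling_twoPi.prod (volI m)).mp j)) ?_ ?_
    · exact ((continuous_qpFactor j).measurable.comp measurable_fst).aestronglyMeasurable.mul
        h.meas
    · filter_upwards [h.fiber] with α hα
      exact hα.half.qp j
  memLp := by
    rw [cellMeasure_twoPi]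
    have hm : AEStronglyMeasurable (Function.uncurry z) ((volI m).prod (volCell m)) := by
      rw [← cellMeasure_twoPi, ← prod_cellMeasure]; exact h.meas.restrict
    rw [memLp_two_iff_lintegral hm, lintegral_prod _ (hm.enorm.pow_const 2)]
    refine lt_of_le_of_lt (lintegral_mono_ae ?_) h.half
    filter_upwards [h.fiber] with α hα
    simp only [Function.uncurry]
    -- The weight is at least one, so the `L²` norm is controlled by the `H^{1/2}` norm.
    rw [← tsum_enorm_coeff α hα.half.memLp]
    refine ENNReal.tsum_le_tsum fun j => ?_
    rw [← ofReal_norm, ← ENNReal.ofReal_pow (norm_nonneg _)]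
    refine ENNReal.ofReal_le_ofReal ?_
    exact le_mul_of_one_le_left (sq_nonneg _) (one_le_halfWeight _)

/-! ### The sesquilinear forms -/

lemma IsPeriodicIndex.memLp_strip {R₀ : ℝ} {n2 : Pt m → ℂ} (h : IsPeriodicIndex R₀ n2) (R : ℝ) :
    MemLp n2 ⊤ (volStrip m R) :=
  h.memLp.mono_measure (Measure.restrict_mono (fun _ hx => hx.1) le_rfl)

lemma IsPeriodicIndex.periodic_strip {R₀ : ℝ} {n2 : Pt m → ℂ} (h : IsPeriodicIndex R₀ n2) (R : ℝ)
    (j : Fin m → ℤ) : ∀ᵐ x ∂(volStrip m R), n2 (shift j x) = n2 x :=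
  ae_mono (Measure.restrict_mono (fun _ hx => hx.1) le_rfl) (h.periodic j)

/-- The volume form is the mean of the volume forms of the fibres, by Parseval's identity. -/
lemma integral_volIntegrand (k : ℝ) {R₀ R : ℝ} {n2 : Pt m → ℂ} (hn : IsPeriodicIndex R₀ n2)
    {u v : Pt m → ℂ} {G H : Dir m → Pt m → ℂ} {w y : Hor m → Pt m → ℂ}
    {W Y : Hor m → Dir m → Pt m → ℂ} (hu : StripBT R u w)
    (hG : ∀ i, StripBT R (G i) (fun α x => W α i x)) (hv : StripBT R v y)
    (hH : ∀ i, StripBT R (H i) (fun α x => Y α i x)) :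
    Integrable (fun α => ∫ x in cellStrip m R, volIntegrand k n2 (w α) (W α) (y α) (Y α) x)
        (volI m) ∧
      ∫ x in strip m R, volIntegrand k n2 u G v H x
        = ∫ α, (∫ x in cellStrip m R, volIntegrand k n2 (w α) (W α) (y α) (Y α) x) ∂(volI m) := by
  have T := isTiling_strip (m := m) R
  have hnu := hu.mul_periodic (hn.memLp_strip R) (hn.periodic_strip R)
  obtain ⟨i0, e0⟩ := hnu.integral_mul_conj T hv
  have i1 := fun i => ((hG i).integral_mul_conj T (hH i)).1
  have e1 := fun i => ((hG i).integral_mul_conj T (hH i)).2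
  rw [cellMeasure_strip] at i0 e0 i1 e1
  have q0 : Integrable (fun x => n2 x * u x * conj (v x)) (volStrip m R) :=
    (hnu.memLp T).integrable_mul (p := 2) (q := 2) (hv.memLp T).star
  have q1 : ∀ i, Integrable (fun x => G i x * conj (H i x)) (volStrip m R) := fun i =>
    ((hG i).memLp T).integrable_mul (p := 2) (q := 2) ((hH i).memLp T).star
  have key : ∀ {X : Type _} [MeasurableSpace X] (μ : Measure X) (a : Dir m → X → ℂ) (b : X → ℂ),
      (∀ i, Integrable (a i) μ) → Integrable b μ →
      Integrable (fun x => (∑ i, a i x) - (k : ℂ) ^ 2 * b x) μ ∧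
      ∫ x, ((∑ i, a i x) - (k : ℂ) ^ 2 * b x) ∂μ
        = (∑ i, ∫ x, a i x ∂μ) - (k : ℂ) ^ 2 * ∫ x, b x ∂μ := by
    intro X _ μ a b ha hb
    have h1 : Integrable (fun x => ∑ i, a i x) μ := integrable_finsetSum _ fun i _ => ha i
    refine ⟨h1.sub (hb.const_mul _), ?_⟩
    rw [integral_sub h1 (hb.const_mul _), integral_finsetSum _ fun i _ => ha i,
      integral_const_mul]
  have r := key (volStrip m R) (fun i x => G i x * conj (H i x)) _ q1 q0
  have s := key (volI m)
    (fun i α => ∫ x in cellStrip m R, W α i x * conj (Y α i x))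
    (fun α => ∫ x in cellStrip m R, n2 x * w α x * conj (y α x))
    (fun i => (i1 i).integral_prod_left) i0.integral_prod_left
  have hfib : ∀ᵐ α ∂(volI m),
      ∫ x in cellStrip m R, volIntegrand k n2 (w α) (W α) (y α) (Y α) x
        = (∑ i, ∫ x in cellStrip m R, W α i x * conj (Y α i x))
          - (k : ℂ) ^ 2 * ∫ x in cellStrip m R, n2 x * w α x * conj (y α x) := by
    filter_upwards [i0.prod_right_ae, ae_all_iff.2 fun i => (i1 i).prod_right_ae] with α c0 c1
    rw [← (key (volume.restrict (cellStrip m R)) (fun i x => W α i x * conj (Y α i x)) _ c1 c0).2]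
    refine integral_congr_ae (Eventually.of_forall fun x => ?_)
    simp only [volIntegrand]
    ring
  refine ⟨s.1.congr (hfib.mono fun α h => h.symm), ?_⟩
  rw [integral_congr_ae hfib, s.2, ← e0]
  simp only [← e1]
  rw [← r.2]
  refine integral_congr_ae (Eventually.of_forall fun x => ?_)
  simp only [volIntegrand]
  ring

lemma norm_sqrtBranch (s : ℝ) : ‖sqrtBranch s‖ = √|s| := by
  unfold sqrtBranch
  split_ifs with h
  · rw [Complex.norm_real, Real.norm_of_nonneg (Real.sqrt_nonneg _), abs_of_nonneg h]
  · rw [norm_mul, Complex.norm_I, one_mul, Complex.norm_real,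
      Real.norm_of_nonneg (Real.sqrt_nonneg _), abs_of_neg (not_le.1 h)]

lemma measurable_sqrtBranch : Measurable sqrtBranch :=
  Measurable.ite measurableSet_Ici (by fun_prop) (by fun_prop)

/-- The symbol of the Dirichlet-to-Neumann operator has order one. -/
lemma norm_sqrtBranch_le (k : ℝ) (ξ : Hor m) :
    ‖sqrtBranch (k ^ 2 - ‖ξ‖ ^ 2)‖ ≤ √(1 + k ^ 2) * halfWeight ξ := by
  rw [norm_sqrtBranch, halfWeight, ← Real.sqrt_eq_rpow, ← Real.sqrt_mul (by positivity)]
  refine Real.sqrt_le_sqrt ?_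
  rw [abs_le]
  constructor <;> nlinarith [sq_nonneg k, sq_nonneg ‖ξ‖, mul_nonneg (sq_nonneg k) (sq_nonneg ‖ξ‖)]

lemma integrable_dtn (k : ℝ) {t σ : Hor m → ℂ} (ht : MemHalf t) (hσ : MemHalf σ) :
    Integrable fun ξ => dtnHat k t ξ * conj (fourierHat σ ξ) := by
  have h1 : Integrable fun ξ : Hor m => √(1 + k ^ 2) *
      (halfWeight ξ * ‖fourierHat t ξ‖ ^ 2 + halfWeight ξ * ‖fourierHat σ ξ‖ ^ 2) :=
    (ht.weighted.add hσ.weighted).const_mul _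
  refine h1.mono' ?_ (Eventually.of_forall fun ξ => ?_)
  · have hb : Measurable fun ξ : Hor m => sqrtBranch (k ^ 2 - ‖ξ‖ ^ 2) :=
      measurable_sqrtBranch.comp (by fun_prop)
    exact (((hb.const_mul _).mul (measurable_fourierHat t)).mul
      (Complex.continuous_conj.measurable.comp (measurable_fourierHat σ))).aestronglyMeasurable
  · rw [norm_mul, dtnHat, norm_mul, norm_mul, Complex.norm_I, one_mul, RCLike.norm_conj]
    have h2 := norm_sqrtBranch_le k ξ
    have h3 : ‖fourierHat t ξ‖ * ‖fourierHat σ ξ‖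
        ≤ ‖fourierHat t ξ‖ ^ 2 + ‖fourierHat σ ξ‖ ^ 2 := by
      nlinarith [sq_nonneg (‖fourierHat t ξ‖ - ‖fourierHat σ ξ‖), sq_nonneg ‖fourierHat t ξ‖,
        sq_nonneg ‖fourierHat σ ξ‖]
    have h4 : 0 ≤ √(1 + k ^ 2) * halfWeight ξ :=
      mul_nonneg (Real.sqrt_nonneg _) (halfWeight_pos ξ).le
    calc _ ≤ (√(1 + k ^ 2) * halfWeight ξ) * (‖fourierHat t ξ‖ * ‖fourierHat σ ξ‖) := by
          rw [mul_assoc]; gcongr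
      _ ≤ (√(1 + k ^ 2) * halfWeight ξ) * (‖fourierHat t ξ‖ ^ 2 + ‖fourierHat σ ξ‖ ^ 2) := by
          gcongr
      _ = _ := by ring

/-- The boundary form is the mean of the boundary forms of the fibres: the integral over `ξ` is cut
into the cells `-(α + j)`, where `t̂` takes the fibre coefficients as values. -/
lemma dtnForm_eq (k : ℝ) {t σ : Hor m → ℂ} {z s : Hor m → Hor m → ℂ} (ht : HorBT t z)
    (hσ : HorBT σ s) (ht' : MemHalf t) (hσ' : MemHalf σ) :
    Integrable (fun α => dtnFormQP k α (z α) (s α)) (volI m) ∧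
      dtnForm k t σ = ∫ α, dtnFormQP k α (z α) (s α) ∂(volI m) := by
  obtain ⟨h1, -, h3⟩ := integral_neg_lattice (integrable_dtn k ht' hσ')
  have e : (fun α => ∑' j, dtnHat k t (-(α + lat j)) * conj (fourierHat σ (-(α + lat j))))
      =ᵐ[volI m] fun α => dtnFormQP k α (z α) (s α) := by
    filter_upwards [ht.coeff_eq_fourierHat, hσ.coeff_eq_fourierHat] with α a b
    refine tsum_congr fun j => ?_
    rw [dtnCoeff, a, b, dtnHat, beta, norm_neg]
  exact ⟨h1.congr e, by rw [dtnForm, h3, integral_congr_ae e]⟩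

/-- The variational equations for a function and for its fibres coincide, for each test function
and its Bloch transform. -/
lemma form_eq_iff (k : ℝ) {R₀ R : ℝ} {n2 : Pt m → ℂ} (hn : IsPeriodicIndex R₀ n2)
    {f u v : Pt m → ℂ} {G H : Dir m → Pt m → ℂ} {F w y : Hor m → Pt m → ℂ}
    {W Y : Hor m → Dir m → Pt m → ℂ} {t σ : Hor m → ℂ} {z s : Hor m → Hor m → ℂ}
    (hf : StripBT R f F) (hu : StripBT R u w) (hG : ∀ i, StripBT R (G i) (fun α x => W α i x))
    (hv : StripBT R v y) (hH : ∀ i, StripBT R (H i) (fun α x => Y α i x))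
    (ht : HorBT t z) (hσ : HorBT σ s) (ht' : MemHalf t) (hσ' : MemHalf σ) :
    ((∫ x in strip m R, volIntegrand k n2 u G v H x) - dtnForm k t σ
        = ∫ x in strip m R, f x * conj (v x)) ↔
    (∫ α in brillouin m,
        ((∫ x in cellStrip m R, volIntegrand k n2 (w α) (W α) (y α) (Y α) x)
          - dtnFormQP k α (z α) (s α)))
        = ∫ α in brillouin m, ∫ x in cellStrip m R, F α x * conj (y α x) := by
  obtain ⟨a1, a2⟩ := integral_volIntegrand k hn hu hG hv hH
  obtain ⟨b1, b2⟩ := dtnForm_eq k ht hσ ht' hσ'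
  have c := (hf.integral_mul_conj (isTiling_strip R) hv).2
  rw [cellMeasure_strip] at c
  rw [integral_sub a1 b1, a2, b2, c]

/-! ### The variational problems -/

lemma exists_fields {R : ℝ} {u : Pt m → ℂ} {G : Dir m → Pt m → ℂ} (h : IsH1 R u G) :
    ∃ W : Hor m → Dir m → Pt m → ℂ, ∀ i, StripBT R (G i) (fun α x => W α i x) := by
  choose W hW using fun i => exists_isBT (isTiling_strip R) (h.grad_memLp i)
  exact ⟨fun α i x => W i α x, fun i => (hW i).1⟩

/-- The gradient of either side is obtained from the gradient of the other by the transform or its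
inverse. -/
theorem memH1_iff {R : ℝ} {u : Pt m → ℂ} {w : Hor m → Pt m → ℂ} (hu : StripBT R u w) :
    MemH1 R u ↔ MemL2H1 R w := by
  constructor
  · rintro ⟨G, h⟩
    obtain ⟨W, hW⟩ := exists_fields h
    exact ⟨W, (isH1_iff hu hW).1 h⟩
  · rintro ⟨W, h⟩
    exact ⟨_, (isH1_iff hu fun i => (h.isField_grad i).isBT).2 h⟩

/-- The two variational problems are equivalent: the Bloch transform is a bijection between the test
functions, and it preserves both sides of the equation. -/
theorem isStripSolution_iff (k : ℝ) {R₀ R : ℝ} {n2 : Pt m → ℂ} (hn : IsPeriodicIndex R₀ n2)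
    {f u : Pt m → ℂ} {F w : Hor m → Pt m → ℂ} (hf : StripBT R f F) (hu : StripBT R u w) :
    IsStripSolution k R n2 f u ↔ IsBlochSolution k R n2 F w := by
  constructor
  · rintro ⟨G, t, hG, ht, heq⟩
    obtain ⟨W, hW⟩ := exists_fields hG
    obtain ⟨z, hz, -⟩ := exists_isBT isTiling_twoPi ht.half.memLp
    refine ⟨W, z, (isH1_iff hu hW).1 hG, (isTrace_iff hu (hW vert) hz).1 ht, ?_⟩
    intro y Y s hY hs
    have hv := hY.isField.isBT
    have hH := fun i => (hY.isField_grad i).isBT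
    have hσ := hs.isField.isBT
    have hσ' := (isTrace_iff (G := fun i x => ∫ α, Y α i x ∂(volI m)) hv (hH vert) hσ).2 hs
    refine (form_eq_iff k hn hf hu hW hv hH hz hσ ht.half hσ'.half).1 ?_
    exact heq _ _ _ ((isH1_iff hv hH).2 hY) hσ'
  · rintro ⟨W, z, hW, hz, heq⟩
    have hG := fun i => (hW.isField_grad i).isBT
    have ht := hz.isField.isBT
    have ht' := (isTrace_iff (G := fun i x => ∫ α, W α i x ∂(volI m)) hu (hG vert) ht).2 hz
    refine ⟨_, _, (isH1_iff hu hG).2 hW, ht', ?_⟩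
    intro v H σ hH hσ
    obtain ⟨y, hy, -⟩ := exists_isBT (isTiling_strip R) hH.memLp
    obtain ⟨Y, hY⟩ := exists_fields hH
    obtain ⟨s, hs, -⟩ := exists_isBT isTiling_twoPi hσ.half.memLp
    refine (form_eq_iff k hn hf hu hG hy hY ht hs ht'.half hσ.half).2 ?_
    exact heq _ _ _ ((isH1_iff hy hY).1 hH) ((isTrace_iff hy (hY vert) hs).1 hσ)

/-! ### Transforms over the half space -/

lemma prod_restrict_univ {X Y : Type*} [MeasurableSpace X] [MeasurableSpace Y] (μ : Measure X)
    (ν : Measure Y) [SFinite μ] [SFinite ν] (S : Set Y) :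
    μ.prod (ν.restrict S) = (μ.prod ν).restrict (Set.univ ×ˢ S) := by
  rw [← Measure.prod_restrict, Measure.restrict_univ]

lemma ae_prod_strip_iff {R : ℝ} {P : Hor m × Pt m → Prop} :
    (∀ᵐ p ∂((volI m).prod (volStrip m R)), P p) ↔
      ∀ᵐ p ∂((volI m).prod volume), p.2 ∈ strip m R → P p := by
  rw [volStrip, prod_restrict_univ, ae_restrict_iff' (MeasurableSet.univ.prod
    (measurableSet_strip R))]
  simp

lemma prod_restrict_mono {X Y : Type*} [MeasurableSpace X] [MeasurableSpace Y] (μ : Measure X)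
    (ν : Measure Y) [SFinite μ] [SFinite ν] {S S' : Set Y} (h : S ⊆ S') :
    μ.prod (ν.restrict S) ≤ μ.prod (ν.restrict S') := by
  rw [prod_restrict_univ, prod_restrict_univ]
  exact Measure.restrict_mono (Set.prod_mono le_rfl h) le_rfl

lemma strip_mono {R R' : ℝ} (h : R ≤ R') : strip m R ⊆ strip m R' := fun _ hx =>
  ⟨hx.1, hx.2.trans_le h⟩

lemma IsBT.mono_strip {R R' : ℝ} (h : R ≤ R') {u : Pt m → ℂ} {w : Hor m → Pt m → ℂ}
    (hu : StripBT R' u w) : StripBT R u w where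
  field :=
    { meas := hu.field.meas.mono_measure (prod_restrict_mono _ _ (strip_mono h))
      qp := fun j => ae_mono (prod_restrict_mono _ _ (strip_mono h)) (hu.field.qp j)
      memLp := by
        have := hu.field.memLp
        rw [cellMeasure_strip] at this ⊢
        exact this.mono_measure
          (prod_restrict_mono _ _ (S := cellStrip m R) (S' := cellStrip m R')
            fun x hx => ⟨hx.1, hx.2.1, hx.2.2.trans_le h⟩) }
  inv := ae_mono (Measure.restrict_mono (strip_mono h) le_rfl) hu.inv

/-- A function that is square integrable in every strip has one Bloch transform in the half
space. -/
theorem exists_transform_halfSpace {R₀ : ℝ} {u : Pt m → ℂ}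
    (hu : ∀ R', R₀ < R' → MemLp u 2 (volStrip m R')) :
    ∃ w : Hor m → Pt m → ℂ, ∀ R', StripBT R' u w := by
  have hu' : ∀ n : ℕ, MemLp u 2 (volStrip m ((n : ℝ) + 1)) := fun n =>
    (hu (max (n + 1) (R₀ + 1)) (lt_max_of_lt_right (lt_add_one _))).mono_measure
      (Measure.restrict_mono (strip_mono (le_max_left _ _)) le_rfl)
  choose v hv using fun n : ℕ => exists_isBT (isTiling_strip ((n : ℝ) + 1)) (hu' n)
  -- In the slab `n ≤ x_d < n + 1` the transform over the strip of height `n + 1` is used.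
  refine ⟨fun α x => v ⌊x.2⌋₊ α x, fun R' => ?_⟩
  obtain ⟨N, hN⟩ := exists_nat_ge R'
  refine IsBT.mono_strip (hN.trans (lt_add_one _).le) (R' := (N : ℝ) + 1) ?_
  refine (hv N).1.congr (isTiling_strip _) EventuallyEq.rfl ?_
  have key : ∀ n : ℕ, ∀ᵐ p ∂((volI m).prod (volStrip m ((N : ℝ) + 1))),
      p.2.2 < (n : ℝ) + 1 → v N p.1 p.2 = v n p.1 p.2 := by
    intro n
    have h1 := (IsBT.mono_strip (min_le_left _ _) (hv N).1).unique
      (isTiling_strip (min ((N : ℝ) + 1) ((n : ℝ) + 1)))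
      (IsBT.mono_strip (min_le_right _ _) (hv n).1)
    have h2 := ae_prod_strip_iff.1 h1
    refine ae_prod_strip_iff.2 ?_
    filter_upwards [h2] with p hp hs hn
    exact hp ⟨hs.1, lt_min hs.2 hn⟩
  filter_upwards [ae_all_iff.2 key] with p hp
  exact hp _ (Nat.lt_floor_add_one _)

/-! ### Outgoing waves -/

/-- The factor `e^{i √(k² - |ξ|²) h}` by which the Fourier mode `ξ` changes over the height `h`. -/
def propagator (k h : ℝ) (ξ : Hor m) : ℂ :=
  Complex.exp (Complex.I * sqrtBranch (k ^ 2 - ‖ξ‖ ^ 2) * (h : ℂ))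

lemma norm_exp_sqrtBranch (s h : ℝ) :
    ‖Complex.exp (Complex.I * sqrtBranch s * (h : ℂ))‖ = Real.exp (-(√(-s) * h)) := by
  rw [Complex.norm_exp]
  congr 1
  unfold sqrtBranch
  split_ifs with hs
  · simp [Real.sqrt_eq_zero_of_nonpos (neg_nonpos.2 hs)]
  · simp

lemma norm_propagator (k h : ℝ) (ξ : Hor m) :
    ‖propagator k h ξ‖ = Real.exp (-(√(‖ξ‖ ^ 2 - k ^ 2) * h)) := by
  rw [propagator, norm_exp_sqrtBranch, neg_sub]

lemma propagator_neg (k h : ℝ) (ξ : Hor m) : propagator k h (-ξ) = propagator k h ξ := by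
  simp [propagator]

lemma measurable_propagator (k : ℝ) :
    Measurable fun p : ℝ × Hor m => propagator k p.1 p.2 := by
  unfold propagator
  have : Measurable fun p : ℝ × Hor m => sqrtBranch (k ^ 2 - ‖p.2‖ ^ 2) :=
    measurable_sqrtBranch.comp (by fun_prop)
  fun_prop

lemma norm_propagator_anti (k : ℝ) {h h' : ℝ} (hh : h ≤ h') (ξ : Hor m) :
    ‖propagator k h' ξ‖ ≤ ‖propagator k h ξ‖ := by
  rw [norm_propagator, norm_propagator]
  gcongr

/-- At positive height the propagator decays exponentially in `|ξ|`. -/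
lemma integrable_propagator {k h : ℝ} (hk : 0 < k) (hh : 0 < h) :
    Integrable (propagator k h : Hor m → ℂ) := by
  have h1 : Integrable fun ξ : Hor m => (Real.exp (h * k + h) * (m + 1).factorial / h ^ (m + 1)) *
      (1 + ‖ξ‖) ^ (-((m + 1 : ℕ) : ℝ)) :=
    (integrable_one_add_norm (by simp)).const_mul _
  refine h1.mono' ((measurable_propagator k).comp
    (measurable_const.prodMk measurable_id)).aestronglyMeasurable (Eventually.of_forall fun ξ => ?_)
  have hle : ‖ξ‖ - k ≤ √(‖ξ‖ ^ 2 - k ^ 2) := by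
    by_cases hc : k ≤ ‖ξ‖
    · exact Real.le_sqrt_of_sq_le (by nlinarith)
    · exact (by linarith : ‖ξ‖ - k ≤ 0).trans (Real.sqrt_nonneg _)
  -- The exponential `e^{-X}` is dominated by the power `X^{-(m+1)}`, which is integrable.
  set X : ℝ := h * (1 + ‖ξ‖) with hX
  have hX0 : 0 < X := by positivity
  have h2 : Real.exp (-X) ≤ (m + 1).factorial / X ^ (m + 1) := by
    have := Real.pow_div_factorial_le_exp X hX0.le (m + 1)
    rw [Real.exp_neg, ← inv_div]
    exact inv_anti₀ (by positivity) this
  calc ‖propagator k h ξ‖ ≤ Real.exp (h * k + h) * Real.exp (-X) := by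
        rw [norm_propagator, ← Real.exp_add]
        refine Real.exp_le_exp.2 ?_
        rw [hX]
        nlinarith
    _ ≤ Real.exp (h * k + h) * ((m + 1).factorial / X ^ (m + 1)) := by gcongr
    _ = _ := by
        rw [Real.rpow_neg (by positivity), Real.rpow_natCast, hX, mul_pow]
        field_simp

lemma memLp_propagator {k h : ℝ} (hk : 0 < k) (hh : 0 < h) :
    MemLp (propagator k h : Hor m → ℂ) 2 volume := by
  have hm : AEStronglyMeasurable (propagator k h : Hor m → ℂ) volume :=
    ((measurable_propagator k).comp (measurable_const.prodMk measurable_id)).aestronglyMeasurable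
  rw [memLp_two_iff_integrable_sq_norm hm]
  refine (integrable_propagator (m := m) hk (mul_pos two_pos hh)).norm.congr
    (Eventually.of_forall fun ξ => ?_)
  simp only [norm_propagator]
  rw [← Real.exp_nat_mul]
  push_cast
  ring_nf

/-- The Fourier transform at height `h` of the outgoing wave with boundary values `t`. -/
def outgoing (k : ℝ) (t : Hor m → ℂ) (h : ℝ) (ξ : Hor m) : ℂ := fourierHat t ξ * propagator k h ξ

lemma measurable_outgoing (k : ℝ) (t : Hor m → ℂ) :
    Measurable fun p : ℝ × Hor m => outgoing k t p.1 p.2 :=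
  ((measurable_fourierHat t).comp measurable_snd).mul (measurable_propagator k)

lemma memLp_fourierHat {t : Hor m → ℂ} (ht : MemLp t 2 (volume : Measure (Hor m))) :
    MemLp (fourierHat t) 2 volume := by
  rw [memLp_two_iff_lintegral (measurable_fourierHat t).aestronglyMeasurable,
    lintegral_fourierHat ht]
  exact (memLp_two_iff_lintegral ht.1).1 ht

lemma integrable_outgoing {k : ℝ} (hk : 0 < k) {t : Hor m → ℂ}
    (ht : MemLp t 2 (volume : Measure (Hor m))) {h : ℝ} (hh : 0 < h) :
    Integrable (outgoing k t h) :=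
  (memLp_fourierHat ht).integrable_mul (p := 2) (q := 2) (memLp_propagator hk hh)

lemma measurable_blochSynth_outgoing (k R : ℝ) (t : Hor m → ℂ) :
    Measurable fun p : Hor m × Pt m => blochSynth (outgoing k t (p.2.2 - R)) p.1 p.2.1 := by
  have h : ∀ j : Fin m → ℤ, Measurable fun p : Hor m × Pt m =>
      outgoing k t (p.2.2 - R) (-(p.1 + lat j)) * expo (-(p.1 + lat j)) p.2.1 := fun j => by
    have h1 : Measurable fun p : Hor m × Pt m => -(p.1 + lat j) := by fun_prop
    have h0 : Measurable fun p : Hor m × Pt m => p.2.2 - R := by fun_prop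
    have h2 := (measurable_outgoing k t).comp (h0.prodMk h1)
    have h3 := (continuous_expo (m := m)).measurable.comp
      (h1.prodMk (measurable_fst.comp measurable_snd))
    exact h2.mul h3
  exact (Measurable.tsum h).const_mul _

/-- The angular spectrum representation as an inverse Fourier integral. -/
lemma angular_eq (k R : ℝ) (t : Hor m → ℂ) (x : Pt m) :
    nrm m * ∫ ξ : Hor m, Complex.exp (Complex.I * (inner ℝ x.1 ξ : ℝ)
        + Complex.I * sqrtBranch (k ^ 2 - ‖ξ‖ ^ 2) * ((x.2 - R : ℝ) : ℂ)) * fourierHat t ξ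
      = nrm m * ∫ ξ, outgoing k t (x.2 - R) ξ * expo ξ x.1 := by
  congr 1
  refine integral_congr_ae (Eventually.of_forall fun ξ => ?_)
  simp only [outgoing, propagator, expo, Complex.exp_add, real_inner_comm]
  rw [mul_comm Complex.I ((inner ℝ ξ x.1 : ℝ) : ℂ)]
  ring

/-- The Rayleigh expansion as a quasi-periodic Fourier series. -/
lemma rayleigh_eq (k R : ℝ) (α : Hor m) (a : (Fin m → ℤ) → ℂ) (x : Pt m) :
    nrm m * ∑' j : Fin m → ℤ, a j * Complex.exp (-(Complex.I * (inner ℝ (α + lat j) x.1 : ℝ))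
        + Complex.I * beta k α j * ((x.2 - R : ℝ) : ℂ))
      = fiberSeries α (fun j => a j * propagator k (x.2 - R) (α + lat j)) x.1 := by
  rw [fiberSeries]
  congr 1
  refine tsum_congr fun j => ?_
  rw [Complex.exp_add, propagator, beta, expo, inner_neg_left]
  push_cast
  rw [mul_comm Complex.I ((inner ℝ (α + lat j) x.1 : ℝ) : ℂ), neg_mul]
  ring

lemma rayleigh_eq_blochSynth (k R : ℝ) {α : Hor m} {a : (Fin m → ℤ) → ℂ} {t : Hor m → ℂ}
    (ha : ∀ j, a j = fourierHat t (-(α + lat j))) (x : Pt m) :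
    nrm m * ∑' j : Fin m → ℤ, a j * Complex.exp (-(Complex.I * (inner ℝ (α + lat j) x.1 : ℝ))
        + Complex.I * beta k α j * ((x.2 - R : ℝ) : ℂ))
      = blochSynth (outgoing k t (x.2 - R)) α x.1 := by
  rw [rayleigh_eq, blochSynth]
  simp only [outgoing, ha, propagator_neg]

lemma ae_of_forall_strip {P : Pt m → Prop} {R : ℝ} (hR : 0 ≤ R)
    (h : ∀ n : ℕ, ∀ᵐ x ∂(volStrip m n), R < x.2 → P x) : ∀ᵐ x : Pt m, R < x.2 → P x := by
  have h1 : ∀ n : ℕ, ∀ᵐ x : Pt m, x ∈ strip m n → R < x.2 → P x := fun n =>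
    (ae_restrict_iff' (measurableSet_strip _)).1 (h n)
  filter_upwards [ae_all_iff.2 h1] with x hx hR'
  obtain ⟨n, hn⟩ := exists_nat_gt x.2
  exact hx n ⟨hR.trans_lt hR', hn⟩ hR'

/-- The angular spectrum representation of `u` is equivalent to the Rayleigh expansion of its
Bloch transform, the coefficients of which are the values of the Fourier transform of `t`. -/
theorem angular_iff {k R : ℝ} (hk : 0 < k) (hR : 0 < R) {u : Pt m → ℂ} {w : Hor m → Pt m → ℂ}
    (hu : ∀ R', StripBT R' u w) {t : Hor m → ℂ} (ht : MemLp t 2 (volume : Measure (Hor m))) :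
    (∀ᵐ x : Pt m, R < x.2 → u x = nrm m * ∫ ξ, outgoing k t (x.2 - R) ξ * expo ξ x.1) ↔
      ∀ᵐ α ∂(volI m), ∀ᵐ x : Pt m, R < x.2 →
        w α x = blochSynth (outgoing k t (x.2 - R)) α x.1 := by
  -- Above `Γ^R` the Fourier integral converges absolutely, and the transform can be inverted.
  have hmS : MeasurableSet {x : Pt m | R < x.2} := measurableSet_lt measurable_const measurable_snd
  have hint : ∀ x : Pt m, R < x.2 → Integrable (outgoing k t (x.2 - R)) := fun x hx =>
    integrable_outgoing hk ht (sub_pos.2 hx)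
  constructor
  · intro h
    have key : ∀ n : ℕ, ∀ᵐ α ∂(volI m), ∀ᵐ x ∂(volStrip m n), R < x.2 →
        w α x = blochSynth (outgoing k t (x.2 - R)) α x.1 := by
      intro n
      have T := isTiling_strip (m := m) n
      have h' : ∀ᵐ x ∂(volStrip m n), R < x.2 →
        u x = nrm m * ∫ ξ, outgoing k t (x.2 - R) ξ * expo ξ x.1 := ae_restrict_of_ae h
      have h1 : Function.uncurry w =ᵐ[(volI m).prod ((volStrip m n).restrict {x | R < x.2})]
          Function.uncurry fun α x => blochSynth (outgoing k t (x.2 - R)) α x.1 := by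
        refine ae_prod_eq_of_fourier ?_
          (measurable_blochSynth_outgoing k R t).aestronglyMeasurable ?_
        · refine (hu n).field.meas.mono_measure ?_
          rw [prod_restrict_univ]
          exact Measure.restrict_le_self
        · rw [ae_restrict_iff' hmS]
          filter_upwards [(hu n).field.ae_slice T, (hu n).coef T, T.ae_shift h'] with x a b c hx
          refine ⟨a.1.integrable one_le_two, (integral_blochSynth (hint x hx) _).1, fun j => ?_⟩
          rw [← b j, integral_blochSynth_mul_qpFactor (hint x hx), c j hx]
          rfl
      filter_upwards [Measure.ae_ae_of_ae_prod h1] with α hα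
      rwa [ae_restrict_iff' hmS] at hα
    filter_upwards [ae_all_iff.2 key] with α hα
    exact ae_of_forall_strip hR.le hα
  · intro h
    refine ae_of_forall_strip hR.le fun n => ?_
    refine (ae_restrict_iff' hmS).1 ?_
    have h1 : Function.uncurry w =ᵐ[(volI m).prod ((volStrip m n).restrict {x | R < x.2})]
        Function.uncurry fun α x => blochSynth (outgoing k t (x.2 - R)) α x.1 := by
      refine ae_prod_eq_of_ae_ae ?_
        (measurable_blochSynth_outgoing k R t).aestronglyMeasurable ?_
      · refine (hu n).field.meas.mono_measure ?_
        rw [prod_restrict_univ]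
        exact Measure.restrict_le_self
      · filter_upwards [h] with α hα
        rw [ae_restrict_iff' hmS]
        exact ae_restrict_of_ae hα
    filter_upwards [ae_swap h1, ae_restrict_of_ae (hu n).inv, ae_restrict_mem hmS]
      with x a b hx
    rw [b, ← (integral_blochSynth (hint x hx) x.1).2]
    exact integral_congr_ae a

/-! ### Weak vertical derivatives of quasi-periodic functions -/

/-- A quasi-periodic function that is square integrable over the cell is square integrable over
finite unions of tiles. -/
lemma locSq_of_qp {X : Type*} [MeasurableSpace X] {μ : Measure X} {s : (Fin m → ℤ) → X → X}
    {κ : X → Fin m → ℤ} (T : IsTiling μ s κ) {f : X → ℂ} {α : Hor m}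
    (hm : AEStronglyMeasurable f μ) (hqp : ∀ j, ∀ᵐ x ∂μ, f (s j x) = qpFactor α j * f x)
    (h2 : MemLp f 2 (cellMeasure μ κ)) : LocSq μ κ f := by
  intro B
  have e : κ ⁻¹' (B : Set (Fin m → ℤ)) = ⋃ j ∈ B, κ ⁻¹' {j} := by ext; simp
  rw [memLp_two_iff_integrable_sq_norm hm.restrict, e]
  refine (integrableOn_finset_iUnion (s := B) (t := fun j => κ ⁻¹' {j})).2 fun j _ => ?_
  rw [IntegrableOn, ← (T.mp_tile j).integrable_comp_emb (T.emb j)]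
  refine ((memLp_two_iff_integrable_sq_norm h2.1).1 h2).congr ?_
  filter_upwards [ae_restrict_of_ae (hqp j)] with x hx
  simp [hx]

lemma isFiniteMeasure_slab (K : Set (Hor m)) (hK : IsCompact K) (R : ℝ) :
    IsFiniteMeasure ((volume.restrict K).prod (volume.restrict (Set.Ioo 0 R))) := by
  have : IsFiniteMeasure ((volume : Measure (Hor m)).restrict K) :=
    isFiniteMeasure_restrict.2 hK.measure_lt_top.ne
  infer_instance

lemma LocSq.integrable_slab {R : ℝ} {f : Pt m → ℂ} (hf : LocSq (volStrip m R) stripIdx f)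
    {K : Set (Hor m)} (hK : IsCompact K) :
    Integrable f ((volume.restrict K).prod (volume.restrict (Set.Ioo 0 R))) := by
  have := isFiniteMeasure_slab K hK R
  obtain ⟨B, hB⟩ := exists_finset_stripIdx (hK.prod (isCompact_singleton (x := (0 : ℝ))))
  have hle : (volume.restrict K).prod (volume.restrict (Set.Ioo 0 R))
      ≤ (volStrip m R).restrict (stripIdx ⁻¹' B) := by
    have h := Measure.prod_restrict (μ := (volume : Measure (Hor m)))
      (ν := volume.restrict (Set.Ioo 0 R)) K Set.univ
    rw [Measure.restrict_univ, ← volStrip_eq] at h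
    rw [h]
    exact Measure.restrict_mono (fun x hx => hB (x.1, 0) ⟨hx.1, rfl⟩) le_rfl
  exact ((hf B).mono_measure hle).integrable one_le_two

lemma LocSq.memLp_cell {R : ℝ} {f : Pt m → ℂ} (hf : LocSq (volStrip m R) stripIdx f) :
    MemLp f 2 ((volCell m).prod (volume.restrict (Set.Ioo 0 R))) := by
  rw [← cellMeasure_strip_prod, cellMeasure]
  simpa using hf {0}

lemma LocSq.locallyIntegrableOn {R : ℝ} {f : Pt m → ℂ} (hf : LocSq (volStrip m R) stripIdx f)
    (S : Set (Pt m)) : LocallyIntegrableOn f S (volStrip m R) := by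
  refine LocallyIntegrable.locallyIntegrableOn ?_ S
  rw [locallyIntegrable_iff]
  intro K hK
  have h := hf.integrable_slab (hK.image continuous_fst)
  refine h.mono_measure ?_
  have h' := Measure.prod_restrict (μ := (volume : Measure (Hor m)))
    (ν := volume.restrict (Set.Ioo 0 R)) (Prod.fst '' K) Set.univ
  rw [Measure.restrict_univ, ← volStrip_eq] at h'
  rw [h']
  exact Measure.restrict_mono 
    (fun x hx => (⟨⟨x, hx, rfl⟩, trivial⟩ : x ∈ (Prod.fst '' K) ×ˢ Set.univ)) le_rfl

lemma isTest_ofReal {U : Set (Pt m)} {p : Pt m → ℝ} (h1 : ContDiff ℝ ∞ p)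
    (h2 : HasCompactSupport p) (h3 : tsupport p ⊆ U) : IsTest U (fun x => (p x : ℂ)) where
  smooth := Complex.ofRealCLM.contDiff.comp h1
  compact := h2.comp_left (g := fun s : ℝ => (s : ℂ)) Complex.ofReal_zero
  supp := (tsupport_comp_subset (g := fun s : ℝ => (s : ℂ)) Complex.ofReal_zero p).trans h3

lemma isOpen_strip (R : ℝ) : IsOpen (strip m R) := by
  rw [strip_eq]; exact isOpen_univ.prod isOpen_Ioo

/-- Weak derivatives are unique. -/
lemma IsWeakPartial.unique {R : ℝ} {i : Dir m} {u g g' : Pt m → ℂ} (h : IsWeakPartial R i u g)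
    (h' : IsWeakPartial R i u g') (hg : LocSq (volStrip m R) stripIdx g)
    (hg' : LocSq (volStrip m R) stripIdx g') : g =ᵐ[volStrip m R] g' := by
  have key := (isOpen_strip R).ae_eq_zero_of_integral_contDiff_smul_eq_zero (μ := volStrip m R)
    (f := fun x => g x - g' x)
    ((hg.locallyIntegrableOn _).sub (hg'.locallyIntegrableOn _)) fun p h1 h2 h3 => by
      have ht := isTest_ofReal h1 h2 h3
      obtain ⟨B, hB, -⟩ := ht.exists_isTileTest R (dirVec i)
      have e : ∀ x, p x • (g x - g' x) = g x * (p x : ℂ) - g' x * (p x : ℂ) := fun x => by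
        rw [Complex.real_smul]; ring
      simp only [e]
      rw [integral_sub (hg.integrable_mul hB) (hg'.integrable_mul hB), sub_eq_zero]
      exact neg_injective ((h _ ht).symm.trans (h' _ ht))
  filter_upwards [key, ae_restrict_mem (measurableSet_strip R)] with x hx hxs
  exact sub_eq_zero.1 (hx hxs)

lemma isTest_mul {R : ℝ} {p : Hor m → ℝ} {η : ℝ → ℝ} (hp : ContDiff ℝ ∞ p)
    (hpc : HasCompactSupport p) (hη : ContDiff ℝ ∞ η) (hηc : HasCompactSupport η)
    (hηs : tsupport η ⊆ Set.Ioo 0 R) :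
    IsTest (strip m R) (fun x => ((p x.1 * η x.2 : ℝ) : ℂ)) := by
  have hsub : tsupport (fun x : Pt m => p x.1 * η x.2) ⊆ tsupport p ×ˢ tsupport η := by
    refine closure_minimal (fun x hx => ?_) ((isClosed_tsupport p).prod (isClosed_tsupport η))
    have hx' : p x.1 * η x.2 ≠ 0 := hx
    exact ⟨subset_tsupport _ (left_ne_zero_of_mul hx'), subset_tsupport _ (right_ne_zero_of_mul hx')⟩
  refine isTest_ofReal ((hp.comp contDiff_fst).mul (hη.comp contDiff_snd))
    ((hpc.prod hηc).of_isClosed_subset (isClosed_tsupport _) hsub) fun x hx => ?_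
  exact hηs (hsub hx).2

lemma fderiv_mul_vert {p : Hor m → ℝ} {η : ℝ → ℝ} (hp : ContDiff ℝ ∞ p) (hη : ContDiff ℝ ∞ η)
    (x : Pt m) : fderiv ℝ (fun x : Pt m => ((p x.1 * η x.2 : ℝ) : ℂ)) x (dirVec vert)
      = ((p x.1 * deriv η x.2 : ℝ) : ℂ) := by
  have hd : ContDiff ℝ ∞ fun x : Pt m => ((p x.1 * η x.2 : ℝ) : ℂ) :=
    Complex.ofRealCLM.contDiff.comp ((hp.comp contDiff_fst).mul (hη.comp contDiff_snd))
  rw [← (hd.differentiable (by simp) x).lineDeriv_eq_fderiv, lineDeriv]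
  have e : (fun s : ℝ => ((p (x + s • (dirVec vert : Pt m)).1
      * η (x + s • (dirVec vert : Pt m)).2 : ℝ) : ℂ)) = fun s => ((p x.1 * η (x.2 + s) : ℝ) : ℂ) := by
    ext s; simp [dirVec]
  rw [e]
  have h1 : HasDerivAt η (deriv η x.2) (x.2 + 0) := by
    rw [add_zero]; exact (hη.differentiable (by simp) x.2).hasDerivAt
  have h2 : HasDerivAt (fun s => p x.1 * η (x.2 + s)) (p x.1 * deriv η x.2) 0 :=
    (h1.comp_const_add x.2 0).const_mul _
  exact h2.ofReal_comp.deriv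

/-- The Fourier coefficients of the weak vertical derivative are the weak derivatives of the
Fourier coefficients. -/
lemma IsWeakPartial.integral_coeff {R : ℝ} {f g : Pt m → ℂ}
    (h : IsWeakPartial R vert f g) (hf : LocSq (volStrip m R) stripIdx f)
    (hg : LocSq (volStrip m R) stripIdx g) {η : ℝ → ℝ} (hη : ContDiff ℝ ∞ η)
    (hηc : HasCompactSupport η) (hηs : tsupport η ⊆ Set.Ioo 0 R) (α : Hor m) (j : Fin m → ℤ) :
    ∫ t in Set.Ioo 0 R, (coeff α (fun y => f (y, t)) j * (deriv η t : ℝ)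
      + coeff α (fun y => g (y, t)) j * (η t : ℝ)) = 0 := by
  set F : Pt m → ℂ := fun x => f x * (deriv η x.2 : ℝ) + g x * (η x.2 : ℝ) with hF
  have hηd : Continuous (deriv η) := hη.continuous_deriv (by simp)
  obtain ⟨C, hC⟩ := hηc.exists_bound_of_continuous hη.continuous
  obtain ⟨D, hD⟩ := hηc.deriv.exists_bound_of_continuous hηd
  have hFi : ∀ μ : Measure (Pt m), Integrable f μ → Integrable g μ → Integrable F μ :=
    fun μ h1 h2 => by
      refine (h1.mul_bdd (c := D) ?_ ?_).add (h2.mul_bdd (c := C) ?_ ?_)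
      · exact (Complex.continuous_ofReal.comp (hηd.comp continuous_snd)).aestronglyMeasurable
      · exact Eventually.of_forall fun x => by simpa using hD x.2
      · exact (Complex.continuous_ofReal.comp
          (hη.continuous.comp continuous_snd)).aestronglyMeasurable
      · exact Eventually.of_forall fun x => by simpa using hC x.2
  -- The vertical integrals of `F` vanish at almost every horizontal point.
  have hΦ : ∀ᵐ y : Hor m, ∫ t in Set.Ioo 0 R, F (y, t) = 0 := by
    refine ae_eq_zero_of_integral_contDiff_smul_eq_zero ?_ fun p hp hpc => ?_
    · rw [locallyIntegrable_iff]
      intro K hK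
      exact (hFi _ (hf.integrable_slab hK) (hg.integrable_slab hK)).integral_prod_left
    · have ht := isTest_mul hp hpc hη hηc hηs
      obtain ⟨B, b1, b2, -⟩ := ht.exists_isTileTest R (dirVec vert)
      have h1 := (isWeakPartial_iff vert hf hg).1 h _ ht
      have h2 : Integrable (fun x => g x * ((p x.1 * η x.2 : ℝ) : ℂ)
          + f x * fderiv ℝ (fun x : Pt m => ((p x.1 * η x.2 : ℝ) : ℂ)) x (dirVec vert))
          (volStrip m R) := (hg.integrable_mul b1).add (hf.integrable_mul b2)
      change ∫ x, _ ∂(volStrip m R) = _ at h1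
      rw [volStrip_eq] at h1 h2
      rw [integral_prod _ h2] at h1
      rw [← h1]
      refine integral_congr_ae (Eventually.of_forall fun y => ?_)
      simp only
      rw [← integral_smul]
      refine integral_congr_ae (Eventually.of_forall fun t => ?_)
      simp only [fderiv_mul_vert hp hη, hF, Complex.real_smul]
      push_cast
      ring
  have hfc := hf.memLp_cell.integrable one_le_two
  have hgc := hg.memLp_cell.integrable one_le_two
  -- Integration against a character over the cell, in the other order, gives the coefficients.
  have hFc : Integrable (fun x : Pt m => F x * expo (α + lat j) x.1)
      ((volCell m).prod (volume.restrict (Set.Ioo 0 R))) :=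
    (hFi _ hfc hgc).mul_bdd (c := 1)
      (continuous_expo.comp (continuous_const.prodMk continuous_fst)).aestronglyMeasurable
      (Eventually.of_forall fun x => by simp)
  have h0 : ∫ x, F x * expo (α + lat j) x.1 ∂((volCell m).prod (volume.restrict (Set.Ioo 0 R)))
      = 0 := by
    rw [integral_prod _ hFc]
    refine integral_eq_zero_of_ae ?_
    filter_upwards [ae_restrict_of_ae hΦ] with y hy
    rw [integral_mul_const, hy, zero_mul]
    rfl
  rw [integral_prod_symm _ hFc] at h0
  rw [← mul_zero (nrm m : ℂ), ← h0, ← integral_const_mul]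
  refine integral_congr_ae ?_
  filter_upwards [hfc.prod_left_ae, hgc.prod_left_ae] with t h1 h2
  have k1 := integrable_mul_expo h1 (α + lat j)
  have k2 := integrable_mul_expo h2 (α + lat j)
  simp only [coeff_eq]
  rw [mul_assoc, mul_assoc, ← mul_add, ← integral_mul_const, ← integral_mul_const,
    ← integral_add (k1.mul_const _) (k2.mul_const _)]
  congr 1
  refine integral_congr_ae (Eventually.of_forall fun y => ?_)
  simp only [hF]
  ring

lemma LocSq.integrable_coeff {R : ℝ} {f : Pt m → ℂ} (hf : LocSq (volStrip m R) stripIdx f)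
    (α : Hor m) (j : Fin m → ℤ) :
    Integrable (fun t => coeff α (fun y => f (y, t)) j) (volume.restrict (Set.Ioo 0 R)) := by
  simp only [coeff_eq]
  have h : Integrable (fun x : Pt m => f x * expo (α + lat j) x.1)
      ((volCell m).prod (volume.restrict (Set.Ioo 0 R))) :=
    (hf.memLp_cell.integrable one_le_two).mul_bdd (c := 1)
      (continuous_expo.comp (continuous_const.prodMk continuous_fst)).aestronglyMeasurable
      (Eventually.of_forall fun x => by simp)
  exact h.integral_prod_right.const_mul _

/-- Where a Fourier coefficient is continuously differentiable, its derivative is the Fourier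
coefficient of the weak vertical derivative. -/
lemma IsWeakPartial.coeff_eq_deriv {R R' : ℝ} (hR : 0 ≤ R) {f g : Pt m → ℂ}
    (h : IsWeakPartial R' vert f g) (hf : LocSq (volStrip m R') stripIdx f)
    (hg : LocSq (volStrip m R') stripIdx g) {α : Hor m} {j : Fin m → ℤ} {c c' : ℝ → ℂ}
    (hc : ∀ t, HasDerivAt c (c' t) t) (hc' : Continuous c')
    (hcf : ∀ᵐ t ∂(volume.restrict (Set.Ioo R R')), coeff α (fun y => f (y, t)) j = c t) :
    ∀ᵐ t ∂(volume.restrict (Set.Ioo R R')), coeff α (fun y => g (y, t)) j = c' t := by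
  have hcc : Continuous c := continuous_iff_continuousAt.2 fun t => (hc t).continuousAt
  have hsub : Set.Ioo R R' ⊆ Set.Ioo 0 R' := Set.Ioo_subset_Ioo_left hR
  have key := (isOpen_Ioo (a := R) (b := R')).ae_eq_zero_of_integral_contDiff_smul_eq_zero
    (μ := volume.restrict (Set.Ioo 0 R')) (f := fun t => coeff α (fun y => g (y, t)) j - c' t)
    (((hg.integrable_coeff α j).locallyIntegrable.sub
      hc'.locallyIntegrable).locallyIntegrableOn _) fun η hη hηc hηs => by
    have hηd : Continuous (deriv η) := hη.continuous_deriv (by simp)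
    obtain ⟨C, hC⟩ := hηc.exists_bound_of_continuous hη.continuous
    obtain ⟨D, hD⟩ := hηc.deriv.exists_bound_of_continuous hηd
    have hηC : Continuous fun t => ((η t : ℝ) : ℂ) := Complex.continuous_ofReal.comp hη.continuous
    have hηD : Continuous fun t => ((deriv η t : ℝ) : ℂ) := Complex.continuous_ofReal.comp hηd
    have hX : Integrable (fun t => coeff α (fun y => f (y, t)) j * (deriv η t : ℝ)
        + coeff α (fun y => g (y, t)) j * (η t : ℝ)) (volume.restrict (Set.Ioo 0 R')) :=
      ((hf.integrable_coeff α j).mul_bdd (c := D) hηD.aestronglyMeasurable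
        (Eventually.of_forall fun x => by simpa using hD x)).add
      ((hg.integrable_coeff α j).mul_bdd (c := C) hηC.aestronglyMeasurable
        (Eventually.of_forall fun x => by simpa using hC x))
    have hcs : HasCompactSupport fun t => ((η t : ℝ) : ℂ) :=
      hηc.comp_left (g := fun s : ℝ => (s : ℂ)) Complex.ofReal_zero
    have hcs' : HasCompactSupport fun t => ((deriv η t : ℝ) : ℂ) :=
      hηc.deriv.comp_left (g := fun s : ℝ => (s : ℂ)) Complex.ofReal_zero
    have hY : Integrable fun t => c t * (deriv η t : ℝ) + c' t * (η t : ℝ) :=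
      ((hcc.mul hηD).integrable_of_hasCompactSupport hcs'.mul_left).add
        ((hc'.mul hηC).integrable_of_hasCompactSupport hcs.mul_left)
    have hoff : ∀ t, t ∉ Set.Ioo R R' → η t = 0 ∧ deriv η t = 0 := fun t ht => by
      have h1 : t ∉ tsupport η := fun h => ht (hηs h)
      refine ⟨image_eq_zero_of_notMem_tsupport h1, ?_⟩
      by_contra h2
      exact h1 (support_deriv_subset h2)
    -- Here `c η' + c' η` is the derivative of `c η`, which has compact support.
    have hY0 : ∫ t in Set.Ioo 0 R', (c t * (deriv η t : ℝ) + c' t * (η t : ℝ)) = 0 := by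
      rw [setIntegral_eq_integral_of_forall_compl_eq_zero]
      · refine integral_eq_zero_of_hasDerivAt_of_integrable (f := fun t => c t * (η t : ℝ))
          (fun t => ?_) hY ((hcc.mul hηC).integrable_of_hasCompactSupport hcs.mul_left)
        have h1 := (hc t).mul (hη.differentiable (by simp) t).hasDerivAt.ofReal_comp
        exact h1.congr_deriv (add_comm _ _)
      · intro t ht
        obtain ⟨h1, h2⟩ := hoff t fun h => ht (hsub h)
        simp [h1, h2]
    rw [← sub_eq_zero_of_eq ((h.integral_coeff hf hg hη hηc (hηs.trans hsub) α j).trans hY0.symm),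
      ← integral_sub hX hY.restrict]
    refine integral_congr_ae ?_
    have h1 := (ae_restrict_iff' measurableSet_Ioo).1 hcf
    filter_upwards [ae_restrict_of_ae h1] with t ht
    by_cases htm : t ∈ Set.Ioo R R'
    · rw [ht htm, Complex.real_smul]; ring
    · obtain ⟨h1, h2⟩ := hoff t htm
      simp [h1, h2]
  rw [ae_restrict_iff' measurableSet_Ioo] at key ⊢
  filter_upwards [key] with t ht hts
  exact sub_eq_zero.1 (ht (hsub hts) hts)

/-! ### The boundary values of outgoing waves -/

/-- The weight of `H^{1/2}` is controlled by the energy of a mode in the slab of height one above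
the boundary. With `b = |√(k² - |ξ|²)|` and `l = (1 + b²)^{1/2}` the mode decays at most at the
rate `l`, so it keeps its size over the height `1 / l`, and `(1 + b²) / l = l`. -/
lemma lintegral_propagator_ge (k R : ℝ) (ξ : Hor m) :
    ENNReal.ofReal (halfWeight ξ) ≤ ENNReal.ofReal (Real.exp 2 * √(1 + k ^ 2)) *
      (ENNReal.ofReal (1 + ‖sqrtBranch (k ^ 2 - ‖ξ‖ ^ 2)‖ ^ 2) *
        ∫⁻ t in Set.Ioo R (R + 1), ‖propagator k (t - R) ξ‖ₑ ^ 2) := by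
  set b := ‖sqrtBranch (k ^ 2 - ‖ξ‖ ^ 2)‖ with hb
  have hb2 : b ^ 2 = |k ^ 2 - ‖ξ‖ ^ 2| := by
    rw [hb, norm_sqrtBranch, Real.sq_sqrt (abs_nonneg _)]
  set l := √(1 + b ^ 2) with hl
  have hl2 : l ^ 2 = 1 + b ^ 2 := Real.sq_sqrt (by positivity)
  have hl1 : 1 ≤ l := Real.one_le_sqrt.2 (by nlinarith [sq_nonneg b])
  have hl0 : 0 < l := one_pos.trans_le hl1
  have hw : halfWeight ξ ≤ √(1 + k ^ 2) * l := by
    rw [halfWeight, ← Real.sqrt_eq_rpow, hl, ← Real.sqrt_mul (by positivity), hb2]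
    refine Real.sqrt_le_sqrt ?_
    nlinarith [neg_abs_le (k ^ 2 - ‖ξ‖ ^ 2), abs_nonneg (k ^ 2 - ‖ξ‖ ^ 2), sq_nonneg k,
      mul_nonneg (sq_nonneg k) (abs_nonneg (k ^ 2 - ‖ξ‖ ^ 2))]
  have hint : ENNReal.ofReal (Real.exp (-2) * l⁻¹)
      ≤ ∫⁻ t in Set.Ioo R (R + 1), ‖propagator k (t - R) ξ‖ₑ ^ 2 := by
    calc ENNReal.ofReal (Real.exp (-2) * l⁻¹)
        = ∫⁻ t in Set.Ioo R (R + l⁻¹), ENNReal.ofReal (Real.exp (-2)) := by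
          rw [lintegral_const, Measure.restrict_apply_univ, Real.volume_Ioo,
            ENNReal.ofReal_mul (Real.exp_pos _).le]
          congr 2; ring
      _ ≤ ∫⁻ t in Set.Ioo R (R + l⁻¹), ‖propagator k (t - R) ξ‖ₑ ^ 2 := by
          refine setLIntegral_mono' measurableSet_Ioo fun t ht => ?_
          rw [← ofReal_norm, ← ENNReal.ofReal_pow (norm_nonneg _), norm_propagator,
            ← Real.exp_nat_mul]
          refine ENNReal.ofReal_le_ofReal (Real.exp_le_exp.2 ?_)
          have h1 : √(‖ξ‖ ^ 2 - k ^ 2) ≤ l := by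
            refine Real.sqrt_le_sqrt ?_
            rw [hb2]
            linarith [neg_abs_le (k ^ 2 - ‖ξ‖ ^ 2)]
          have h2 : t - R ≤ l⁻¹ := by linarith [ht.2]
          have h3 : √(‖ξ‖ ^ 2 - k ^ 2) * (t - R) ≤ l * l⁻¹ :=
            mul_le_mul h1 h2 (by linarith [ht.1]) hl0.le
          rw [mul_inv_cancel₀ hl0.ne'] at h3
          push_cast
          linarith
      _ ≤ _ := by
          refine lintegral_mono_set (Set.Ioo_subset_Ioo_right ?_)
          linarith [inv_le_one_of_one_le₀ hl1]
  calc ENNReal.ofReal (halfWeight ξ)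
      ≤ ENNReal.ofReal (Real.exp 2 * √(1 + k ^ 2) * ((1 + b ^ 2) * (Real.exp (-2) * l⁻¹))) := by
        refine ENNReal.ofReal_le_ofReal (hw.trans (le_of_eq ?_))
        rw [← hl2, Real.exp_neg]
        field_simp
    _ = ENNReal.ofReal (Real.exp 2 * √(1 + k ^ 2)) * (ENNReal.ofReal (1 + b ^ 2) *
        ENNReal.ofReal (Real.exp (-2) * l⁻¹)) := by
        rw [ENNReal.ofReal_mul (by positivity), ENNReal.ofReal_mul (p := 1 + b ^ 2) (by positivity)]
    _ ≤ _ := by gcongr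

lemma hasDerivAt_propagator (k R : ℝ) (a : ℂ) (ξ : Hor m) (t : ℝ) :
    HasDerivAt (fun t => a * propagator k (t - R) ξ)
      (a * (Complex.I * sqrtBranch (k ^ 2 - ‖ξ‖ ^ 2)) * propagator k (t - R) ξ) t := by
  have h1 : HasDerivAt (fun t : ℝ => ((t - R : ℝ) : ℂ)) 1 t :=
    ((hasDerivAt_id t).sub_const R).ofReal_comp
  have h2 := ((h1.const_mul (Complex.I * sqrtBranch (k ^ 2 - ‖ξ‖ ^ 2))).cexp).const_mul a
  refine h2.congr_deriv ?_
  simp only [propagator]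
  ring

lemma continuous_propagator (k R : ℝ) (ξ : Hor m) :
    Continuous fun t => propagator k (t - R) ξ := by
  unfold propagator; fun_prop

/-- The `H^{1/2}` norm of the boundary values of an outgoing wave is bounded by the `L²` norms of
the wave and of its vertical derivative in the slab of height one above the boundary. -/
lemma tsum_halfWeight_le {k R : ℝ} (hR : 0 ≤ R) {f g : Pt m → ℂ}
    (h : IsWeakPartial (R + 1) vert f g) (hf : LocSq (volStrip m (R + 1)) stripIdx f)
    (hg : LocSq (volStrip m (R + 1)) stripIdx g) {α : Hor m} {a : (Fin m → ℤ) → ℂ}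
    (ha : ∀ j, ∀ᵐ t ∂(volume.restrict (Set.Ioo R (R + 1))),
      coeff α (fun y => f (y, t)) j = a j * propagator k (t - R) (α + lat j)) :
    ∑' j, ENNReal.ofReal (halfWeight (α + lat j) * ‖a j‖ ^ 2)
      ≤ ENNReal.ofReal (Real.exp 2 * √(1 + k ^ 2)) *
        ∫⁻ x, ‖f x‖ₑ ^ 2 + ‖g x‖ₑ ^ 2 ∂((volCell m).prod (volume.restrict (Set.Ioo 0 (R + 1)))) := by
  have hd : ∀ j, ∀ᵐ t ∂(volume.restrict (Set.Ioo R (R + 1))), coeff α (fun y => g (y, t)) j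
      = a j * (Complex.I * beta k α j) * propagator k (t - R) (α + lat j) := fun j =>
    h.coeff_eq_deriv hR hf hg (fun t => hasDerivAt_propagator k R (a j) (α + lat j) t)
      (continuous_const.mul (continuous_propagator k R _)) (ha j)
  have hsub : volume.restrict (Set.Ioo R (R + 1)) ≤ volume.restrict (Set.Ioo 0 (R + 1)) :=
    Measure.restrict_mono (Set.Ioo_subset_Ioo_left hR) le_rfl
  have hpm : ∀ j, Measurable fun t => ‖propagator k (t - R) (α + lat j)‖ₑ ^ 2 := fun j =>
    (continuous_propagator k R _).measurable.enorm.pow_const 2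
  have hsum : ∀ᵐ t ∂(volume.restrict (Set.Ioo R (R + 1))),
      ∑' j, ENNReal.ofReal (1 + ‖beta k α j‖ ^ 2) * ‖a j‖ₑ ^ 2
        * ‖propagator k (t - R) (α + lat j)‖ₑ ^ 2
      = ∫⁻ y, ‖f (y, t)‖ₑ ^ 2 + ‖g (y, t)‖ₑ ^ 2 ∂(volCell m) := by
    filter_upwards [ae_all_iff.2 ha, ae_all_iff.2 hd, ae_mono hsub (memLp_two_prod_left hf.memLp_cell),
      ae_mono hsub (memLp_two_prod_left hg.memLp_cell)] with t h1 h2 h3 h4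
    rw [lintegral_add_left' (h3.1.enorm.pow_const 2), ← tsum_enorm_coeff α h3,
      ← tsum_enorm_coeff α h4, ← ENNReal.tsum_add]
    refine tsum_congr fun j => ?_
    rw [h1, h2, ENNReal.ofReal_add zero_le_one (sq_nonneg _), ENNReal.ofReal_pow (norm_nonneg _),
      ofReal_norm, ENNReal.ofReal_one]
    simp only [enorm_mul, mul_pow]
    have : ‖Complex.I‖ₑ = 1 := by simp [enorm_eq_nnnorm]
    rw [this]
    ring
  calc ∑' j, ENNReal.ofReal (halfWeight (α + lat j) * ‖a j‖ ^ 2)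
      ≤ ∑' j, ENNReal.ofReal (Real.exp 2 * √(1 + k ^ 2)) *
          (∫⁻ t in Set.Ioo R (R + 1), ENNReal.ofReal (1 + ‖beta k α j‖ ^ 2) * ‖a j‖ₑ ^ 2
            * ‖propagator k (t - R) (α + lat j)‖ₑ ^ 2) := by
        refine ENNReal.tsum_le_tsum fun j => ?_
        rw [ENNReal.ofReal_mul (halfWeight_pos _).le, ENNReal.ofReal_pow (norm_nonneg _),
          ofReal_norm, lintegral_const_mul _ (hpm j)]
        refine (mul_le_mul_left (lintegral_propagator_ge k R (α + lat j)) _).trans (le_of_eq ?_)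
        rw [beta]
        ring
    _ = ENNReal.ofReal (Real.exp 2 * √(1 + k ^ 2)) * ∫⁻ t in Set.Ioo R (R + 1),
          ∫⁻ y, ‖f (y, t)‖ₑ ^ 2 + ‖g (y, t)‖ₑ ^ 2 ∂(volCell m) := by
        rw [ENNReal.tsum_mul_left, ← lintegral_tsum fun j => ((hpm j).const_mul _).aemeasurable,
          lintegral_congr_ae hsum]
    _ ≤ _ := by
        gcongr
        rw [lintegral_prod_symm (fun x : Hor m × ℝ => ‖f x‖ₑ ^ 2 + ‖g x‖ₑ ^ 2) ((hf.memLp_cell.1.enorm.pow_const 2).add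
          (hg.memLp_cell.1.enorm.pow_const 2))]
        exact lintegral_mono' hsub le_rfl

/-- Rayleigh expansions converge absolutely above the boundary, for almost every `α`. The null set
does not depend on the height because the propagator decreases with the height. -/
lemma ae_summable_propagator {k : ℝ} (hk : 0 < k) : ∀ᵐ α ∂(volI m), ∀ h : ℝ, 0 < h →
    Summable fun j => ‖propagator k h (α + lat j)‖ := by
  have h1 : ∀ n : ℕ, ∀ᵐ α ∂(volI m),
      Summable fun j => ‖propagator k (1 / ((n : ℝ) + 1)) (-(α + lat j))‖ := fun n =>
    (integral_neg_lattice (integrable_propagator hk Nat.one_div_pos_of_nat)).2.1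
  filter_upwards [ae_all_iff.2 h1] with α hα h hh
  obtain ⟨n, hn⟩ := exists_nat_one_div_lt hh
  refine (hα n).of_nonneg_of_le (fun _ => norm_nonneg _) fun j => ?_
  rw [propagator_neg]
  exact norm_propagator_anti k hn.le _

lemma norm_coeff_le (α : Hor m) (τ : Hor m → ℂ) (j : Fin m → ℤ) :
    ‖coeff α τ j‖ ≤ nrm m * ∫ y, ‖τ y‖ ∂(volCell m) := by
  rw [coeff_eq, norm_mul, Complex.norm_real, Real.norm_of_nonneg nrm_pos.le]
  refine mul_le_mul_of_nonneg_left ?_ nrm_pos.le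
  refine (norm_integral_le_integral_norm _).trans (le_of_eq ?_)
  simp

/-- The Fourier coefficients of a Rayleigh expansion. -/
lemma coeff_of_rayleigh {k R : ℝ} {α : Hor m} (hα : ∀ h : ℝ, 0 < h →
      Summable fun j => ‖propagator k h (α + lat j)‖) {τ : Hor m → ℂ} {f : Pt m → ℂ}
    (hf : ∀ᵐ x : Pt m, R < x.2 →
      f x = fiberSeries α (fun j => coeff α τ j * propagator k (x.2 - R) (α + lat j)) x.1)
    (j : Fin m → ℤ) : ∀ᵐ t : ℝ, R < t →
      coeff α (fun y => f (y, t)) j = coeff α τ j * propagator k (t - R) (α + lat j) := by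
  rw [Measure.volume_eq_prod] at hf
  filter_upwards [ae_swap hf] with t ht htR
  rw [coeff_congr α (σ := fiberSeries α fun j => coeff α τ j * propagator k (t - R) (α + lat j))]
  · refine coeff_fiberSeries α ?_ j
    refine ((hα _ (sub_pos.2 htR)).mul_left (nrm m * ∫ y, ‖τ y‖ ∂(volCell m))).of_nonneg_of_le
      (fun _ => norm_nonneg _) fun j => ?_
    rw [norm_mul]
    exact mul_le_mul_of_nonneg_right (norm_coeff_le α τ j) (norm_nonneg _)
  · filter_upwards [ae_restrict_of_ae ht] with y hy
    exact hy htR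

/-- The boundary coefficients of an outgoing wave, recovered from the wave in the slab of height
one above the boundary. -/
def slabCoeff (k R : ℝ) (w : Hor m → Pt m → ℂ) (j : Fin m → ℤ) (α : Hor m) : ℂ :=
  nrm m * ∫ x, w α x * expo (α + lat j) x.1 * (propagator k (x.2 - R) (α + lat j))⁻¹
    ∂((volCell m).prod (volume.restrict (Set.Ioo R (R + 1))))

/-- Dividing the coefficient at height `t` by the propagator gives the constant `a`, whose mean over
the unit interval is `a`. -/
lemma slabCoeff_eq {k R : ℝ} {w : Hor m → Pt m → ℂ} {α : Hor m} {j : Fin m → ℤ} {a : ℂ}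
    (hw : Integrable (w α) ((volCell m).prod (volume.restrict (Set.Ioo R (R + 1)))))
    (ha : ∀ᵐ t ∂(volume.restrict (Set.Ioo R (R + 1))),
      coeff α (fun y => w α (y, t)) j = a * propagator k (t - R) (α + lat j)) :
    slabCoeff k R w j α = a := by
  have hne : ∀ t, propagator k (t - R) (α + lat j) ≠ 0 := fun t => Complex.exp_ne_zero _
  have hi : Integrable (fun x : Pt m => w α x * expo (α + lat j) x.1 *
      (propagator k (x.2 - R) (α + lat j))⁻¹)
      ((volCell m).prod (volume.restrict (Set.Ioo R (R + 1)))) := by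
    refine Integrable.mul_bdd (c := Real.exp √(‖α + lat j‖ ^ 2 - k ^ 2))
      (hw.mul_bdd (c := 1) ?_ ?_) ?_ ?_
    · exact (continuous_expo.comp (continuous_const.prodMk continuous_fst)).aestronglyMeasurable
    · exact Eventually.of_forall fun x => by simp
    · exact (((continuous_propagator k R (α + lat j)).comp continuous_snd).inv₀
        fun x => hne x.2).aestronglyMeasurable
    · have h1 : ∀ᵐ x ∂((volCell m).prod (volume.restrict (Set.Ioo R (R + 1)))),
          x.2 ∈ Set.Ioo R (R + 1) :=
        Measure.quasiMeasurePreserving_snd.ae (ae_restrict_mem measurableSet_Ioo)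
      filter_upwards [h1] with x hx
      rw [norm_inv, norm_propagator, ← Real.exp_neg, neg_neg]
      refine Real.exp_le_exp.2 (mul_le_of_le_one_right (Real.sqrt_nonneg _) ?_)
      linarith [hx.2]
  rw [slabCoeff, integral_prod_symm _ hi, ← integral_const_mul]
  have e : ∀ᵐ t ∂(volume.restrict (Set.Ioo R (R + 1))),
      nrm m * ∫ y, w α (y, t) * expo (α + lat j) y * (propagator k (t - R) (α + lat j))⁻¹
        ∂(volCell m) = a := by
    filter_upwards [ha] with t ht
    rw [integral_mul_const, ← mul_assoc, ← coeff_eq α (fun y => w α (y, t)), ht,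
      mul_inv_cancel_right₀ (hne t)]
  rw [integral_congr_ae e, integral_const]
  simp

lemma aestronglyMeasurable_slabCoeff (k R : ℝ) {w : Hor m → Pt m → ℂ}
    (hw : AEStronglyMeasurable (Function.uncurry w)
      ((volI m).prod ((volCell m).prod (volume.restrict (Set.Ioo R (R + 1)))))) (j : Fin m → ℤ) :
    AEStronglyMeasurable (slabCoeff k R w j) (volI m) := by
  refine AEStronglyMeasurable.const_mul ?_ _
  refine AEStronglyMeasurable.integral_prod_right' (f := fun p : Hor m × Pt m =>
    w p.1 p.2 * expo (p.1 + lat j) p.2.1 * (propagator k (p.2.2 - R) (p.1 + lat j))⁻¹)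
    ((hw.mul ?_).mul ?_)
  · exact (continuous_expo.comp (f := fun p : Hor m × Pt m => (p.1 + lat j, p.2.1))
      (by fun_prop)).aestronglyMeasurable
  · have h1 : Measurable fun p : Hor m × Pt m => (p.2.2 - R, p.1 + lat j) := by fun_prop
    exact ((measurable_propagator k).comp h1).inv.aestronglyMeasurable

/-- Functions `A j` on the Brillouin zone are the pieces of one function on `ℝ^m`. -/
lemma exists_lattice_glue (A : (Fin m → ℤ) → Hor m → ℂ)
    (hA : ∀ j, AEStronglyMeasurable (A j) (volI m)) :
    ∃ s : Hor m → ℂ, Measurable s ∧ ∀ᵐ α ∂(volI m), ∀ j, s (-(α + lat j)) = A j α := by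
  have T := isTiling_hor (m := m) one_pos
  refine ⟨fun ξ => (hA (horIdx 1 (-ξ))).mk _ (-ξ - lat (horIdx 1 (-ξ))), ?_, ?_⟩
  · have h1 : Measurable fun p : (Fin m → ℤ) × Hor m => (hA p.1).mk _ p.2 :=
      measurable_from_prod_countable_right fun j => (hA j).stronglyMeasurable_mk.measurable
    have h2 : Measurable fun ξ : Hor m => horIdx 1 (-ξ) := T.meas.comp measurable_neg
    have h3 : Measurable (lat : (Fin m → ℤ) → Hor m) := Measurable.of_discrete
    exact h1.comp (h2.prodMk (measurable_neg.sub (h3.comp h2)))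
  · have h0 : ∀ᵐ α ∂(volI m), horIdx 1 α = 0 := by
      rw [← cellMeasure_unit]
      exact ae_restrict_mem (T.measurableSet_tile 0)
    filter_upwards [h0, ae_all_iff.2 fun j => (hA j).ae_eq_mk] with α h1 h2 j
    have h3 : horIdx 1 (α + lat j) = j := by
      have := T.idx j α
      rw [h1, zero_add] at this
      simpa [horShift] using this
    simp only [neg_neg, h3, add_sub_cancel_right]
    exact (h2 j).symm

/-- Quasi-periodic functions with the same Fourier coefficients agree. -/
lemma ae_eq_of_coeff {α : Hor m} {τ σ : Hor m → ℂ}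
    (hτ : ∀ j : Fin m → ℤ, ∀ᵐ y : Hor m, τ (y + (2 * Real.pi) • lat j) = qpFactor α j * τ y)
    (hσ : ∀ j : Fin m → ℤ, ∀ᵐ y : Hor m, σ (y + (2 * Real.pi) • lat j) = qpFactor α j * σ y)
    (hτ2 : MemLp τ 2 (volCell m)) (hσ2 : MemLp σ 2 (volCell m))
    (h : ∀ j, coeff α τ j = coeff α σ j) : τ =ᵐ[volume] σ := by
  have h1 := ae_eq_zero_of_coeff α
    ((hτ2.integrable one_le_two).sub (hσ2.integrable one_le_two)) fun j => by
      exact (coeff_sub α (hτ2.integrable one_le_two) (hσ2.integrable one_le_two) j).trans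
        (sub_eq_zero.2 (h j))
  refine isTiling_twoPi.ae_of_cell fun j => ?_
  rw [cellMeasure_twoPi]
  filter_upwards [h1, ae_restrict_of_ae (hτ j), ae_restrict_of_ae (hσ j)] with y a b c
  rw [horShift, b, c, sub_eq_zero.1 a]

/-- If the fibres of the Bloch transform of `u` have Rayleigh expansions, then `u` has a trace on
`Γ^R`, and the Rayleigh coefficients of the fibres are the values of the Fourier transform of the
trace. -/
theorem exists_trace_of_rayleigh {k R : ℝ} (hk : 0 < k) (hR : 0 < R) {u : Pt m → ℂ}
    {w : Hor m → Pt m → ℂ} (hu : ∀ R', StripBT R' u w) {G G' : Dir m → Pt m → ℂ}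
    (hG : IsH1 R u G) (hG' : IsH1 (R + 1) u G')
    (hw : ∀ᵐ α ∂(volI m), SatisfiesRayleigh k R α (w α)) :
    ∃ t, IsTrace R u G t ∧ ∀ᵐ α ∂(volI m), ∀ᵐ x : Pt m, R < x.2 →
      w α x = blochSynth (outgoing k t (x.2 - R)) α x.1 := by
  obtain ⟨W, hW⟩ := exists_fields hG
  obtain ⟨W', hW'⟩ := exists_fields hG'
  have hL := (isH1_iff (hu R) hW).1 hG
  have hL' := (isH1_iff (hu (R + 1)) hW').1 hG'
  have T := isTiling_strip (m := m) R
  have T' := isTiling_strip (m := m) (R + 1)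
  have hsub : volume.restrict (Set.Ioo R (R + 1)) ≤ volume.restrict (Set.Ioo 0 (R + 1)) :=
    Measure.restrict_mono (Set.Ioo_subset_Ioo_left hR.le) le_rfl
  set N : Hor m → ℝ≥0∞ := fun α => ENNReal.ofReal (Real.exp 2 * √(1 + k ^ 2)) *
    ∫⁻ x, ‖w α x‖ₑ ^ 2 + ‖W' α vert x‖ₑ ^ 2
      ∂((volCell m).prod (volume.restrict (Set.Ioo 0 (R + 1)))) with hN
  -- The traces of the fibres need not depend measurably on `α`, but their coefficients do.
  have key : ∀ᵐ α ∂(volI m), ∃ τ : Hor m → ℂ, MemHalfQP α τ ∧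
      HasUpperTrace R (w α) (W α vert) τ ∧ (∀ j, slabCoeff k R w j α = coeff α τ j) ∧
      (∀ᵐ x : Pt m, R < x.2 → w α x = nrm m * ∑' j : Fin m → ℤ, coeff α τ j *
        Complex.exp (-(Complex.I * (inner ℝ (α + lat j) x.1 : ℝ))
          + Complex.I * beta k α j * ((x.2 - R : ℝ) : ℂ))) ∧
      ∑' j, ENNReal.ofReal (halfWeight (α + lat j) * ‖slabCoeff k R w j α‖ ^ 2) ≤ N α := by
    filter_upwards [hw, hL.fiber, hL'.fiber, (hW vert).field.ae_locSq T,
      (hu (R + 1)).field.ae_locSq T', (hW' vert).field.ae_locSq T',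
      ae_summable_propagator (m := m) hk] with α ⟨Gα, τ, h1, h2, h3⟩ f1 f2 l1 l2 l3 hs
    -- The gradient of the fibre is determined by the fibre.
    have hgrad : Gα vert =ᵐ[volStrip m R] W α vert :=
      (h1.weak vert).unique (f1.weak vert)
        (locSq_of_qp T (h1.grad_meas vert) (h1.grad_qp vert)
          (by rw [cellMeasure_strip]; exact h1.grad_memLp vert)) l1
    have hc : ∀ j, ∀ᵐ t ∂(volume.restrict (Set.Ioo R (R + 1))), coeff α (fun y => w α (y, t)) j
        = coeff α τ j * propagator k (t - R) (α + lat j) := fun j => by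
      have h3' : ∀ᵐ x : Pt m, R < x.2 → w α x = fiberSeries α
          (fun j => coeff α τ j * propagator k (x.2 - R) (α + lat j)) x.1 := by
        filter_upwards [h3] with x hx hxR
        rw [hx hxR, rayleigh_eq]
      filter_upwards [ae_restrict_of_ae (coeff_of_rayleigh hs h3' j),
        ae_restrict_mem measurableSet_Ioo] with t ht htm
      exact ht htm.1
    have hA : ∀ j, slabCoeff k R w j α = coeff α τ j := fun j =>
      slabCoeff_eq ((l2.memLp_cell.integrable one_le_two).mono_measure
        (Measure.prod_mono le_rfl hsub)) (hc j)
    refine ⟨τ, h2.half, fun φ hφ => ?_, hA, h3, ?_⟩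
    · rw [← h2.green φ hφ]
      refine integral_congr_ae ?_
      filter_upwards [hgrad] with x hx
      rw [hx]
    · simp only [hA]
      exact tsum_halfWeight_le hR.le (f2.weak vert) l2 l3 hc
  have hwm : AEStronglyMeasurable (Function.uncurry w)
      ((volI m).prod ((volCell m).prod (volume.restrict (Set.Ioo R (R + 1))))) := by
    have := (hu (R + 1)).field.memLp.1
    rw [cellMeasure_strip_prod] at this
    exact this.mono_measure (Measure.prod_mono le_rfl (Measure.prod_mono le_rfl hsub))
  -- The Fourier transform `s` of the trace is prescribed by the coefficients of the fibres.
  obtain ⟨s, hsm, hs⟩ := exists_lattice_glue (slabCoeff k R w)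
    (aestronglyMeasurable_slabCoeff k R hwm)
  have hNfin : ∫⁻ α, N α ∂(volI m) < ⊤ := by
    have p1 := (hu (R + 1)).field.memLp
    have p2 := (hW' vert).field.memLp
    rw [cellMeasure_strip_prod] at p1 p2
    have q1 := (memLp_two_iff_lintegral p1.1).1 p1
    have q2 := (memLp_two_iff_lintegral p2.1).1 p2
    have e := lintegral_prod _ ((p1.1.enorm.pow_const 2).add (p2.1.enorm.pow_const 2))
    rw [hN, lintegral_const_mul' _ _ ENNReal.ofReal_ne_top]
    refine ENNReal.mul_lt_top ENNReal.ofReal_lt_top ?_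
    refine lt_of_le_of_lt (le_of_eq e.symm) ?_
    have e2 := lintegral_add_left' (p1.1.enorm.pow_const 2)
      (fun p => ‖Function.uncurry (fun α x => W' α vert x) p‖ₑ ^ 2)
    refine lt_of_le_of_lt (le_of_eq e2) (ENNReal.add_lt_top.2 ⟨q1, q2⟩)
  have hsfin : ∫⁻ ξ, ENNReal.ofReal (halfWeight ξ * ‖s ξ‖ ^ 2) < ⊤ := by
    have hm : Measurable fun ξ : Hor m => ENNReal.ofReal (halfWeight ξ * ‖s ξ‖ ^ 2) :=
      (continuous_halfWeight.measurable.mul (hsm.norm.pow_const 2)).ennreal_ofReal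
    rw [lintegral_neg_lattice hm.aemeasurable]
    refine lt_of_le_of_lt (lintegral_mono_ae ?_) hNfin
    filter_upwards [key, hs] with α ⟨_, _, _, _, _, h⟩ hα
    simpa only [hα, halfWeight_neg] using h
  have hs2 : MemLp s 2 volume := by
    rw [memLp_two_iff_lintegral hsm.aestronglyMeasurable]
    refine lt_of_le_of_lt (lintegral_mono fun ξ => ?_) hsfin
    rw [← ofReal_norm, ← ENNReal.ofReal_pow (norm_nonneg _)]
    exact ENNReal.ofReal_le_ofReal (le_mul_of_one_le_left (sq_nonneg _) (one_le_halfWeight _))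
  obtain ⟨t, ht, hts⟩ := exists_fourierHat_eq hs2
  obtain ⟨z, hz, -⟩ := exists_isBT isTiling_twoPi ht
  have hhalf : MemHalf t := by
    rw [memHalf_iff ht]
    refine lt_of_le_of_lt (le_of_eq (lintegral_congr_ae ?_)) hsfin
    filter_upwards [hts] with ξ hξ
    rw [hξ]
  refine ⟨t, ⟨hhalf, (hasUpperTrace_iff_ae (hu R) (hW vert) hz).2 ?_⟩, ?_⟩
  · filter_upwards [key, hs, ae_neg_lattice hts, hz.coeff_eq_fourierHat,
      memLp_two_prod_right hz.field.memLp_volCell,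
      ae_all_iff.2 fun j => Measure.ae_ae_of_ae_prod (hz.field.qp j)]
      with α ⟨τ, h1, h2, h3, _, _⟩ c1 c2 c3 c4 c5
    -- The fibre of the trace has the coefficients of `τ`, hence coincides with it.
    have hzτ : z α =ᵐ[volume] τ := ae_eq_of_coeff c5 h1.qp c4 h1.memLp fun j => by
      rw [c3, c2, c1, h3]
    intro φ hφ
    rw [h2 φ hφ]
    refine integral_congr_ae ?_
    filter_upwards [hzτ] with y hy
    rw [hy]
  · filter_upwards [key, hs, ae_neg_lattice hts] with α ⟨τ, _, _, h3, h4, _⟩ c1 c2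
    filter_upwards [h4] with x hx hxR
    rw [hx hxR]
    exact rayleigh_eq_blochSynth k R (fun j => by rw [c2, c1, h3]) x

/-- The two radiation conditions are equivalent. -/
theorem satisfiesAngularSpectrum_iff {k R : ℝ} (hk : 0 < k) (hR : 0 < R) {u : Pt m → ℂ}
    {w : Hor m → Pt m → ℂ} (hu : ∀ R', StripBT R' u w) (h1 : MemH1 R u) (h2 : MemH1 (R + 1) u) :
    SatisfiesAngularSpectrum k R u ↔ ∀ᵐ α ∂(volI m), SatisfiesRayleigh k R α (w α) := by
  constructor
  · rintro ⟨G, t, hG, ht, h⟩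
    obtain ⟨W, hW⟩ := exists_fields hG
    obtain ⟨z, hz, -⟩ := exists_isBT isTiling_twoPi ht.half.memLp
    have hL := (isH1_iff (hu R) hW).1 hG
    have hT := (isTrace_iff (hu R) (hW vert) hz).1 ht
    simp only [angular_eq] at h
    filter_upwards [(angular_iff hk hR hu ht.half.memLp).1 h, hL.fiber, hT.fiber,
      hz.coeff_eq_fourierHat] with α a1 a2 a3 a4
    refine ⟨W α, z α, a2, a3, ?_⟩
    filter_upwards [a1] with x hx hxR
    rw [hx hxR, rayleigh_eq_blochSynth k R a4]
  · intro h
    obtain ⟨G, hG⟩ := h1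
    obtain ⟨G', hG'⟩ := h2
    obtain ⟨t, ht, hw⟩ := exists_trace_of_rayleigh hk hR hu hG hG' h
    refine ⟨G, t, hG, ht, ?_⟩
    simp only [angular_eq]
    exact (angular_iff hk hR hu ht.half.memLp).2 hw

end BlochScattering

end

open BlochScattering in
theorem mainTheorem2 (m : ℕ) (hm : m = 1 ∨ m = 2) (k R₀ R : ℝ) (hk : 0 < k) (hR₀ : 0 < R₀)
    (hR : R₀ < R) (n2 : Pt m → ℂ) (hn2 : IsPeriodicIndex R₀ n2) :
    -- the Bloch-Floquet transform is defined on all of `L²(Ω^R)`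
    (∀ g : Pt m → ℂ, MemLp g 2 (MeasureTheory.volume.restrict (strip m R)) →
      ∃ w, IsBlochTransform R g w) ∧
    -- equivalence of the variational problems, for `w = J u` and `F = J f`
    (∀ (f u : Pt m → ℂ) (F w : Hor m → Pt m → ℂ),
      MemLp f 2 (MeasureTheory.volume.restrict (strip m R)) →
      MemLp u 2 (MeasureTheory.volume.restrict (strip m R)) →
      IsBlochTransform R f F → IsBlochTransform R u w →
      (MemH1 R u ↔ MemL2H1 R w) ∧
      (IsStripSolution k R n2 f u ↔ IsBlochSolution k R n2 F w)) ∧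
    -- equivalence of the radiation conditions, for fields in the half space
    (∀ u : Pt m → ℂ, (∀ R', R₀ < R' → MemH1 R' u) →
      (∃ w : Hor m → Pt m → ℂ, ∀ R', R₀ < R' → IsBlochTransform R' u w) ∧
      ∀ w : Hor m → Pt m → ℂ, (∀ R', R₀ < R' → IsBlochTransform R' u w) →
        (SatisfiesAngularSpectrum k R u ↔
          ∀ᵐ α ∂(MeasureTheory.volume.restrict (brillouin m)),
            SatisfiesRayleigh k R α (w α))) := by
  refine ⟨fun g hg => exists_isBlochTransform hg, fun f u F w hf hu hF hw => ?_, fun u hu => ?_⟩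
  · have hw' := hw.stripBT hu
    exact ⟨memH1_iff hw', isStripSolution_iff k hn2 (hF.stripBT hf) hw'⟩
  · have hL2 : ∀ R', R₀ < R' → MeasureTheory.MemLp u 2 (volStrip m R') := fun R' h => by
      obtain ⟨G, hG⟩ := hu R' h
      exact hG.memLp
    refine ⟨?_, fun w hw => ?_⟩
    · obtain ⟨w, hw⟩ := exists_transform_halfSpace hL2
      exact ⟨w, fun R' _ => (hw R').isBlochTransform⟩
    · have hall : ∀ R', StripBT R' u w := fun R' => by
        have h : R₀ < max R' (R₀ + 1) := lt_max_of_lt_right (lt_add_one _)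
        exact ((hw _ h).stripBT (hL2 _ h)).mono_strip (le_max_left _ _)
      exact satisfiesAngularSpectrum_iff hk (hR₀.trans hR) hall (hu R hR)
        (hu (R + 1) (hR.trans (lt_add_one R)))
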